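/- Let $N\ge 3$, let $\mathbb{S}^{N-1}\subset\mathbb{R}^N$ be the round unit sphere and $\mathbb{S}^{N-1}_+=\mathbb{S}^{N-1}\cap\{x_N>0\}$ the open upper hemisphere. Write points of $\mathbb{S}^{N-1}$ in polar coordinates $(r,\omega)$, where $r$ is the geodesic distance from the north pole and $\omega\in\mathbb{S}^{N-2}$. Let $D\subset\mathbb{S}^{N-1}_+$ be a smooth domain, that is, a nonempty connected open set with smooth boundary that lies locally on one side of its boundary. For $\alpha\in(0,2)$ let $D_\alpha=\phi_\alpha(D)$, where $\phi_\alpha(r,\omega)=(\alpha r,\omega)$. Denote by $0=\lambda_0(D_\alpha)<\lambda_1(D_\alpha)\le\lambda_2(D_\alpha)\le\cdots$ the eigenvalues, repeated according to multiplicity, of the Laplace–Beltrami operator $-\Delta_{\mathbb{S}^{N-1}}$ on $D_\alpha$ with homogeneous Neumann boundary conditions (in the weak sense: $\lambda$ is an eigenvalue if there is $0\ne u\in H^1(D_\alpha)$ with $\int_{D_\alpha}\langle\nabla u,\nabla v\rangle\,d\sigma=\lambda\int_{D_\alpha}uv\,d\sigma$ for all $v\in H^1(D_\alpha)$). Then,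 for every $j\ge 1$, $$\lim_{\alpha\to 0^+}\lambda_j(D_\alpha)=+\infty .$$ -/

import Mathlib

open MeasureTheory Metric Filter Topology
open scoped RealInnerProductSpace ContDiff

/-- The ambient Euclidean space `ℝ ^ N`, with `N = d + 1`. -/
abbrev AmbientSpace (d : ℕ) : Type := EuclideanSpace ℝ (Fin (d + 1))

/-- The unit sphere of `ℝ ^ N`; it has dimension `d = N - 1`. -/
abbrev UnitSphere (d : ℕ) : Type := sphere (0 : AmbientSpace d) 1

/-- The north pole `(0, …, 0, 1)`. -/
noncomputable def northPole (d : ℕ) : AmbientSpace d :=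
  EuclideanSpace.single (Fin.last d) 1

/-- The open upper hemisphere: the last coordinate is positive. -/
def upperHemisphere (d : ℕ) : Set (UnitSphere d) :=
  {p | 0 < (p : AmbientSpace d) (Fin.last d)}

/-- The surface measure of the round unit sphere. -/
noncomputable def surfaceMeasure (d : ℕ) : Measure (UnitSphere d) :=
  (volume : Measure (AmbientSpace d)).toSphere

/-- The surface measure on a domain `D` of the sphere. -/
noncomputable def domainMeasure {d : ℕ} (D : Set (UnitSphere d)) : Measure (UnitSphere d) :=
  (surfaceMeasure d).restrict D

/-- A smooth domain of the sphere: a nonempty connected open set that near each of its boundary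
points is a sublevel set `{h < 0}` of a smooth function `h` whose differential along the sphere
does not vanish at that point. -/
structure IsSmoothDomain {d : ℕ} (D : Set (UnitSphere d)) : Prop where
  isOpen : IsOpen D
  isConnected : IsConnected D
  smooth_boundary : ∀ p ∈ frontier D, ∃ h : AmbientSpace d → ℝ, ContDiff ℝ ∞ h ∧
    (∃ v : AmbientSpace d, ⟪(p : AmbientSpace d), v⟫ = 0 ∧ fderiv ℝ h p v ≠ 0) ∧
    ∀ᶠ x in 𝓝 p, (x ∈ D ↔ h x < 0)

/-- The polar coordinate `r` of `p`: its geodesic distance from the north pole. -/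
noncomputable def polarRadius {d : ℕ} (p : UnitSphere d) : ℝ :=
  InnerProductGeometry.angle (northPole d) (p : AmbientSpace d)

/-- The polar coordinate `w` of `p`: the unit vector, orthogonal to the north pole, that points
from the axis to `p` (and `0` if `p` lies on the axis). -/
noncomputable def polarDirection {d : ℕ} (p : UnitSphere d) : AmbientSpace d :=
  ‖(p : AmbientSpace d) - ⟪northPole d, (p : AmbientSpace d)⟫ • northPole d‖⁻¹ •
    ((p : AmbientSpace d) - ⟪northPole d, (p : AmbientSpace d)⟫ • northPole d)

/-- The point with polar coordinates `(r, w)`. -/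
noncomputable def polarPoint {d : ℕ} (r : ℝ) (w : AmbientSpace d) : AmbientSpace d :=
  Real.cos r • northPole d + Real.sin r • w

/-- The dilation `(r, w) ↦ (α r, w)` with respect to the north pole. -/
noncomputable def polarDilation {d : ℕ} (α : ℝ) (p : UnitSphere d) : AmbientSpace d :=
  polarPoint (α * polarRadius p) (polarDirection p)

/-- The dilated domain `D_α`, the image of `D` under the dilation. -/
def dilatedDomain {d : ℕ} (α : ℝ) (D : Set (UnitSphere d)) : Set (UnitSphere d) :=
  {q | ∃ p ∈ D, polarDilation α p = (q : AmbientSpace d)}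

/-- The divergence along the sphere at `p`: the trace of the derivative of `X` over the tangent
space `pᗮ`. For a field that is tangent to the sphere it is the Riemannian divergence. -/
noncomputable def sphericalDiv {d : ℕ} (X : AmbientSpace d → AmbientSpace d)
    (p : AmbientSpace d) : ℝ :=
  LinearMap.trace ℝ (AmbientSpace d) (fderiv ℝ X p).toLinearMap - ⟪fderiv ℝ X p p, p⟫

/-- A test field on `D`: a smooth vector field, tangent to the sphere along the sphere, whose
restriction to the sphere has compact support in `D`. -/
structure IsTestField {d : ℕ} (D : Set (UnitSphere d))
    (X : AmbientSpace d → AmbientSpace d) : Prop where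
  contDiff : ContDiff ℝ ∞ X
  hasCompactSupport : HasCompactSupport X
  support_subset : ∀ p : UnitSphere d, (p : AmbientSpace d) ∈ tsupport X → p ∈ D
  tangent : ∀ p : UnitSphere d, ⟪(p : AmbientSpace d), X p⟫ = 0

/-- `u` belongs to the Sobolev space `H¹(D)` and `G` is its weak gradient: both are square
integrable, `G` is tangent to the sphere, and integration by parts against test fields holds. -/
structure HasWeakGradient {d : ℕ} (D : Set (UnitSphere d)) (u : UnitSphere d → ℝ)
    (G : UnitSphere d → AmbientSpace d) : Prop where
  memLp : MemLp u 2 (domainMeasure D)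
  memLp_grad : MemLp G 2 (domainMeasure D)
  tangent : ∀ᵐ p : UnitSphere d ∂(domainMeasure D), ⟪(p : AmbientSpace d), G p⟫ = 0
  integral_by_parts : ∀ X : AmbientSpace d → AmbientSpace d, IsTestField D X →
    ∫ p : UnitSphere d, u p * sphericalDiv X p ∂(domainMeasure D) =
      -∫ p : UnitSphere d, ⟪G p, X p⟫ ∂(domainMeasure D)

/-- `u ∈ H¹(D)` is a weak solution of `-Δ u = μ u` in `D` with the Neumann condition
`∂_ν u = 0` on the boundary: `∫_D ⟨∇u, ∇v⟩ = μ ∫_D u v` for all `v ∈ H¹(D)`. -/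
def IsNeumannSolution {d : ℕ} (D : Set (UnitSphere d)) (μ : ℝ) (u : UnitSphere d → ℝ) : Prop :=
  ∃ G : UnitSphere d → AmbientSpace d, HasWeakGradient D u G ∧
    ∀ (v : UnitSphere d → ℝ) (H : UnitSphere d → AmbientSpace d), HasWeakGradient D v H →
      ∫ p, ⟪G p, H p⟫ ∂(domainMeasure D) = μ * ∫ p, u p * v p ∂(domainMeasure D)

instance instIsFiniteMeasureDomainMeasure {d : ℕ} (D : Set (UnitSphere d)) :
    IsFiniteMeasure (domainMeasure D) := by
  unfold domainMeasure surfaceMeasure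
  infer_instance

theorem IsTestField.continuous_sphericalDiv {d : ℕ} {D : Set (UnitSphere d)}
    {X : AmbientSpace d → AmbientSpace d} (hX : IsTestField D X) :
    Continuous (fun p : UnitSphere d => sphericalDiv X p) := by
  have h1 : Continuous (fderiv ℝ X) := hX.contDiff.continuous_fderiv (by simp)
  have h2 : Continuous (fun T : AmbientSpace d →L[ℝ] AmbientSpace d =>
      LinearMap.trace ℝ (AmbientSpace d) T.toLinearMap) :=
    LinearMap.continuous_of_finiteDimensional
      ((LinearMap.trace ℝ (AmbientSpace d)) ∘ₗ ContinuousLinearMap.coeLM ℝ)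
  have h3 : Continuous (fun p : UnitSphere d => fderiv ℝ X (p : AmbientSpace d)) :=
    h1.comp continuous_subtype_val
  exact (h2.comp h3).sub ((h3.clm_apply continuous_subtype_val).inner continuous_subtype_val)

theorem Continuous.memLp_domainMeasure {d : ℕ} (D : Set (UnitSphere d)) {E : Type*}
    [NormedAddCommGroup E] [SecondCountableTopologyEither (UnitSphere d) E]
    {f : UnitSphere d → E} (hf : Continuous f) :
    MemLp f 2 (domainMeasure D) := by
  obtain ⟨C, hC⟩ := isCompact_univ.exists_bound_of_continuousOn hf.continuousOn
  exact MemLp.of_bound hf.aestronglyMeasurable C (ae_of_all _ fun p => hC p (Set.mem_univ p))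

theorem MemLp.integrable_inner_domainMeasure {d : ℕ} {D : Set (UnitSphere d)}
    {G H : UnitSphere d → AmbientSpace d} (hG : MemLp G 2 (domainMeasure D))
    (hH : MemLp H 2 (domainMeasure D)) :
    Integrable (fun p => ⟪G p, H p⟫) (domainMeasure D) := by
  refine (hG.norm.integrable_mul hH.norm).mono'
    (hG.aestronglyMeasurable.inner hH.aestronglyMeasurable) (ae_of_all _ fun p => ?_)
  exact norm_inner_le_norm _ _

theorem MemLp.integrable_mul_domainMeasure {d : ℕ} {D : Set (UnitSphere d)}
    {u v : UnitSphere d → ℝ} (hu : MemLp u 2 (domainMeasure D))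
    (hv : MemLp v 2 (domainMeasure D)) :
    Integrable (fun p => u p * v p) (domainMeasure D) :=
  hu.integrable_mul hv

theorem HasWeakGradient.congr {d : ℕ} {D : Set (UnitSphere d)} {u v : UnitSphere d → ℝ}
    {G : UnitSphere d → AmbientSpace d} (h : HasWeakGradient D u G)
    (huv : u =ᵐ[domainMeasure D] v) : HasWeakGradient D v G where
  memLp := (memLp_congr_ae huv).1 h.memLp
  memLp_grad := h.memLp_grad
  tangent := h.tangent
  integral_by_parts X hX := by
    rw [← h.integral_by_parts X hX]
    exact integral_congr_ae (huv.mono fun p hp => by simp [hp])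

theorem HasWeakGradient.add {d : ℕ} {D : Set (UnitSphere d)} {u v : UnitSphere d → ℝ}
    {G H : UnitSphere d → AmbientSpace d} (hu : HasWeakGradient D u G)
    (hv : HasWeakGradient D v H) : HasWeakGradient D (u + v) (G + H) where
  memLp := hu.memLp.add hv.memLp
  memLp_grad := hu.memLp_grad.add hv.memLp_grad
  tangent := by
    filter_upwards [hu.tangent, hv.tangent] with p h1 h2
    simp [inner_add_right, h1, h2]
  integral_by_parts X hX := by
    have hd := hX.continuous_sphericalDiv.memLp_domainMeasure D
    have hc : MemLp (fun p : UnitSphere d => X p) 2 (domainMeasure D) :=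
      (hX.contDiff.continuous.comp continuous_subtype_val).memLp_domainMeasure D
    simp only [Pi.add_apply, add_mul, inner_add_left]
    rw [integral_add (MemLp.integrable_mul_domainMeasure hu.memLp hd)
        (MemLp.integrable_mul_domainMeasure hv.memLp hd),
      integral_add (MemLp.integrable_inner_domainMeasure hu.memLp_grad hc)
        (MemLp.integrable_inner_domainMeasure hv.memLp_grad hc),
      hu.integral_by_parts X hX, hv.integral_by_parts X hX]
    ring

theorem HasWeakGradient.smul {d : ℕ} {D : Set (UnitSphere d)} {u : UnitSphere d → ℝ}
    {G : UnitSphere d → AmbientSpace d} (c : ℝ) (hu : HasWeakGradient D u G) :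
    HasWeakGradient D (c • u) (c • G) where
  memLp := hu.memLp.const_smul c
  memLp_grad := hu.memLp_grad.const_smul c
  tangent := by
    filter_upwards [hu.tangent] with p h1
    simp [inner_smul_right, h1]
  integral_by_parts X hX := by
    simp only [Pi.smul_apply, smul_eq_mul, mul_assoc, real_inner_smul_left, integral_const_mul]
    rw [hu.integral_by_parts X hX]
    ring

theorem IsNeumannSolution.congr {d : ℕ} {D : Set (UnitSphere d)} {μ : ℝ}
    {u v : UnitSphere d → ℝ} (h : IsNeumannSolution D μ u) (huv : u =ᵐ[domainMeasure D] v) :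
    IsNeumannSolution D μ v := by
  obtain ⟨G, hG, hw⟩ := h
  refine ⟨G, hG.congr huv, fun w H hH => ?_⟩
  rw [hw w H hH]
  congr 1
  exact integral_congr_ae (huv.mono fun p hp => by simp [hp])

theorem IsNeumannSolution.zero {d : ℕ} (D : Set (UnitSphere d)) (μ : ℝ) :
    IsNeumannSolution D μ 0 :=
  ⟨0, ⟨MemLp.zero, MemLp.zero, ae_of_all _ fun p => inner_zero_right _, fun X _ => by simp⟩,
    fun v H _ => by simp⟩

theorem IsNeumannSolution.add {d : ℕ} {D : Set (UnitSphere d)} {μ : ℝ}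
    {u v : UnitSphere d → ℝ} (hu : IsNeumannSolution D μ u) (hv : IsNeumannSolution D μ v) :
    IsNeumannSolution D μ (u + v) := by
  obtain ⟨G, hG, hGw⟩ := hu
  obtain ⟨K, hK, hKw⟩ := hv
  refine ⟨G + K, hG.add hK, fun w H hH => ?_⟩
  simp only [Pi.add_apply, add_mul, inner_add_left]
  rw [integral_add (MemLp.integrable_inner_domainMeasure hG.memLp_grad hH.memLp_grad)
      (MemLp.integrable_inner_domainMeasure hK.memLp_grad hH.memLp_grad),
    integral_add (MemLp.integrable_mul_domainMeasure hG.memLp hH.memLp)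
      (MemLp.integrable_mul_domainMeasure hK.memLp hH.memLp),
    hGw w H hH, hKw w H hH]
  ring

theorem IsNeumannSolution.smul {d : ℕ} {D : Set (UnitSphere d)} {μ : ℝ}
    {u : UnitSphere d → ℝ} (c : ℝ) (hu : IsNeumannSolution D μ u) :
    IsNeumannSolution D μ (c • u) := by
  obtain ⟨G, hG, hGw⟩ := hu
  refine ⟨c • G, hG.smul c, fun w H hH => ?_⟩
  simp only [Pi.smul_apply, smul_eq_mul, mul_assoc, real_inner_smul_left, integral_const_mul]
  rw [hGw w H hH]
  ring

/-- The Neumann eigenspace of `-Δ` on `D` for the value `μ`: the subspace of `L²(D)` of all weak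
solutions `u` of `-Δ u = μ u` with Neumann condition. Thus `μ` is a Neumann eigenvalue of `D` if
and only if this space is nonzero, and its dimension is the multiplicity of `μ`. -/
noncomputable def neumannEigenspace {d : ℕ} (D : Set (UnitSphere d)) (μ : ℝ) :
    Submodule ℝ (Lp ℝ 2 (domainMeasure D)) where
  carrier := {u | IsNeumannSolution D μ u}
  zero_mem' := (IsNeumannSolution.zero D μ).congr (Lp.coeFn_zero _ _ _).symm
  add_mem' {u v} hu hv := (IsNeumannSolution.add hu hv).congr (Lp.coeFn_add u v).symm
  smul_mem' c u hu := (IsNeumannSolution.smul c hu).congr (Lp.coeFn_smul c u).symm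

/-- The number of Neumann eigenvalues of `D` that are at most `t`, counted with multiplicity: the
dimension of the sum of their eigenspaces (eigenspaces for distinct eigenvalues are orthogonal). -/
noncomputable def neumannCount {d : ℕ} (D : Set (UnitSphere d)) (t : ℝ) : Cardinal :=
  Module.rank ℝ (⨆ μ ∈ Set.Iic t, neumannEigenspace D μ : Submodule ℝ (Lp ℝ 2 (domainMeasure D)))

/-- The `j`-th Neumann eigenvalue `λ_j(D)`, for `j = 0, 1, 2, …`, when the eigenvalues are listed
in nondecreasing order and repeated according to multiplicity: the least `t` such that at least
`j + 1` eigenvalues, counted with multiplicity, are at most `t`. It is a real number; if `D` had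
no more than `j` eigenvalues, it would be `0` by the convention for the infimum of the empty set. -/
noncomputable def neumannEigenvalue {d : ℕ} (D : Set (UnitSphere d)) (j : ℕ) : ℝ :=
  sInf {t : ℝ | ((j + 1 : ℕ) : Cardinal) ≤ neumannCount D t}

/-! Write `D` in normal coordinates at the north pole: `D` is the image under the exponential map
`polarMap` of a bounded connected open set `Ω = polarDomain D` in the Euclidean space orthogonal to
the pole, and the dilation becomes multiplication by `α`. Every `D_α` is thus parametrised by the
one fixed set `Ω` through `x ↦ polarMap (α • x)`. Write `n` for the dimension of that space. The
surface density of this chart is `α ^ n` times a factor bounded above and below independently of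
`α`, and its derivative is at most a constant times `α`. A Poincaré inequality on `Ω` with constant
`C` therefore transfers to `D_α`: the two powers `α ^ n` cancel and the gradient contributes `α ^
2`, so the constant on `D_α` is `B * α ^ 2`. A Neumann solution for a value below `(B * α ^ 2)⁻¹`
must be constant, hence every eigenvalue of index at least one is at least `(B * α ^ 2)⁻¹`, which
tends to infinity.

The analytic input is the Poincaré inequality on `Ω` for weak gradients. The smooth boundary gives
`Ω` local interior cones. Averaging over balls that recede into such a cone moves an `H¹` function
in `L²` by at most a constant times the scale times the norm of its gradient; this gives the
compactness of `H¹(Ω) → L²(Ω)` (`HasInteriorCones.isRellichSet`). Compactness, together with the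
fact that a function without gradient is constant on a connected set, gives
`HasInteriorCones.poincare`.

Weak gradients pass from the sphere to the chart by turning Euclidean test fields into spherical
ones (`HasChartDensity.exists_testField`), which rests on the divergence theorem on the sphere.

An infimum over the empty set is `0`, so the lower bound also needs at least `j + 1` eigenvalues to
exist. This follows from the spectral theorem for a compact operator
(`IsGraphPair.exists_le_rank_iSup`), the compactness being transferred to `D_α` along the same
chart. -/

/-! ### Averaging kernels and their derivative in the scale -/

section WeakGradient

variable {E : Type*} [NormedAddCommGroup E] [InnerProductSpace ℝ E]

/-- The divergence of a vector field on a Euclidean space. -/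
noncomputable def euclideanDiv (X : E → E) (x : E) : ℝ :=
  LinearMap.trace ℝ E (fderiv ℝ X x).toLinearMap

/-- `G` is the weak gradient of `w ∈ H¹(Ω)`, for a set `Ω` in a Euclidean space. -/
structure HasEuclideanWeakGradient [FiniteDimensional ℝ E] [MeasurableSpace E] [BorelSpace E]
    (Ω : Set E) (w : E → ℝ) (G : E → E) : Prop where
  memLp : MemLp w 2 (volume.restrict Ω)
  memLp_grad : MemLp G 2 (volume.restrict Ω)
  integral_by_parts : ∀ X : E → E, ContDiff ℝ ∞ X → HasCompactSupport X → tsupport X ⊆ Ω →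
    ∫ x in Ω, w x * euclideanDiv X x = -∫ x in Ω, ⟪G x, X x⟫

/-- The averaging kernel with profile `φ`, scale `s` and drift `v`. -/
noncomputable def scaledKernel (φ : E → ℝ) (v : E) (s : ℝ) (x y : E) : ℝ :=
  (s ^ Module.finrank ℝ E)⁻¹ * φ (s⁻¹ • (y - x) - v)

/-- The radial derivative profile of the averaging kernel. -/
noncomputable def kernelDerivProfile (φ : E → ℝ) (v : E) (z : E) : ℝ :=
  Module.finrank ℝ E * φ z + fderiv ℝ φ z (z + v)

/-- The kernels at different scales are dilates of each other about `x`, so they obey the continuity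
equation of the velocity field `(y - x) / s`. Together with `euclideanDiv_kernelField` this says `∂ₛ
k = -div k (y - x) / s`. -/
theorem hasDerivAt_scaledKernel {φ : E → ℝ} (hφ : Differentiable ℝ φ) (v : E) {s : ℝ}
    (hs : s ≠ 0) (x y : E) :
    HasDerivAt (fun s => scaledKernel φ v s x y)
      (-((s ^ (Module.finrank ℝ E + 1))⁻¹ * kernelDerivProfile φ v (s⁻¹ • (y - x) - v))) s := by
  set n := Module.finrank ℝ E
  have h1 : HasDerivAt (fun s : ℝ => (s ^ n)⁻¹) (-(n * s ^ (n - 1)) / (s ^ n) ^ 2) s :=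
    (hasDerivAt_pow n s).inv (pow_ne_zero n hs)
  have h2 : HasDerivAt (fun s : ℝ => s⁻¹ • (y - x) - v) (-(s ^ 2)⁻¹ • (y - x)) s :=
    ((hasDerivAt_inv hs).smul_const (y - x)).sub_const v
  have h3 := (hφ (s⁻¹ • (y - x) - v)).hasFDerivAt.comp_hasDerivAt s h2
  have h4 := h1.mul h3
  refine h4.congr_deriv ?_
  have e1 : (-(s ^ 2)⁻¹ • (y - x)) = -s⁻¹ • ((s⁻¹ • (y - x) - v) + v) := by
    rw [sub_add_cancel, smul_smul]; congr 1; field_simp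
  rw [e1, map_smul, kernelDerivProfile]
  simp only [smul_eq_mul, Function.comp_apply]
  -- The exponent `n - 1` is a truncated subtraction, so dimension zero is separate.
  rcases Nat.eq_zero_or_pos n with h0 | h0
  · simp [h0]
    field_simp
    exact Or.inl (Or.inl h0)
  · have : s ^ n = s * s ^ (n - 1) := by rw [← pow_succ']; congr 1; omega
    have h5 : s ^ (n + 1) = s * s * s ^ (n - 1) := by rw [pow_succ, this]; ring
    have h6 : s ^ (n - 1) ≠ 0 := pow_ne_zero _ hs
    rw [h5, this]
    field_simp
    ring

/-- The field whose divergence is the derivative of the averaging kernel in the scale. -/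
noncomputable def kernelField (φ : E → ℝ) (v : E) (s : ℝ) (x y : E) : E :=
  ((s ^ (Module.finrank ℝ E + 1))⁻¹ * φ (s⁻¹ • (y - x) - v)) • (y - x)

theorem contDiff_kernelField {φ : E → ℝ} (hφ : ContDiff ℝ ∞ φ) (v : E) (s : ℝ) (x : E) :
    ContDiff ℝ ∞ (kernelField φ v s x) := by
  unfold kernelField
  fun_prop

theorem euclideanDiv_smul [FiniteDimensional ℝ E] {f : E → ℝ} {X : E → E} {x : E}
    (hf : DifferentiableAt ℝ f x)
    (hX : DifferentiableAt ℝ X x) :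
    euclideanDiv (fun y => f y • X y) x = f x * euclideanDiv X x + fderiv ℝ f x (X x) := by
  unfold euclideanDiv
  rw [show fderiv ℝ (fun y => f y • X y) x = _ from fderiv_fun_smul hf hX]
  have : (f x • fderiv ℝ X x + (fderiv ℝ f x).smulRight (X x)).toLinearMap
      = f x • (fderiv ℝ X x).toLinearMap + (fderiv ℝ f x).toLinearMap.smulRight (X x) := rfl
  rw [this, map_add, map_smul, LinearMap.trace_smulRight]
  simp

theorem euclideanDiv_kernelField [FiniteDimensional ℝ E] {φ : E → ℝ} (hφ : Differentiable ℝ φ)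
    (v : E) (s : ℝ) (x y : E) :
    euclideanDiv (kernelField φ v s x) y =
      (s ^ (Module.finrank ℝ E + 1))⁻¹ * kernelDerivProfile φ v (s⁻¹ • (y - x) - v) := by
  set n := Module.finrank ℝ E
  have h2 : HasFDerivAt (fun y : E => s⁻¹ • (y - x) - v) (s⁻¹ • ContinuousLinearMap.id ℝ E) y :=
    (((hasFDerivAt_id y).sub_const x).const_smul s⁻¹).sub_const v
  have h3 : HasFDerivAt (fun y => (s ^ (n + 1))⁻¹ * φ (s⁻¹ • (y - x) - v)) _ y :=
    ((hφ (s⁻¹ • (y - x) - v)).hasFDerivAt.comp y h2).const_mul _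
  have h4 : HasFDerivAt (fun y : E => y - x) (ContinuousLinearMap.id ℝ E) y :=
    (hasFDerivAt_id y).sub_const x
  have := euclideanDiv_smul h3.differentiableAt h4.differentiableAt
  change euclideanDiv (fun y => ((s ^ (n + 1))⁻¹ * φ (s⁻¹ • (y - x) - v)) • (y - x)) y = _
  rw [this, h3.fderiv, euclideanDiv, h4.fderiv]
  have e1 : s⁻¹ • (y - x) - v + v = s⁻¹ • (y - x) := by abel
  simp only [ContinuousLinearMap.coe_id, LinearMap.trace_id, kernelDerivProfile, e1]
  simp
  ring

theorem support_scaledKernel_subset {φ : E → ℝ} {c : ℝ} (hφ : tsupport φ ⊆ closedBall 0 c)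
    {v : E} {s : ℝ} (hs : 0 < s) {x y : E} (h : φ (s⁻¹ • (y - x) - v) ≠ 0) :
    y ∈ closedBall (x + s • v) (s * c) := by
  have := hφ (subset_tsupport φ h)
  rw [mem_closedBall_zero_iff] at this
  rw [mem_closedBall, dist_eq_norm]
  have e : y - (x + s • v) = s • (s⁻¹ • (y - x) - v) := by
    rw [smul_sub, smul_inv_smul₀ hs.ne']; abel
  rw [e, norm_smul, Real.norm_of_nonneg hs.le]
  gcongr

theorem tsupport_kernelField_subset {φ : E → ℝ} {c : ℝ} (hφ : tsupport φ ⊆ closedBall 0 c)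
    {v : E} {s : ℝ} (hs : 0 < s) (x : E) :
    tsupport (kernelField φ v s x) ⊆ closedBall (x + s • v) (s * c) := by
  refine closure_minimal (fun y hy => support_scaledKernel_subset hφ hs ?_) isClosed_closedBall
  rintro h0
  exact hy (by simp [kernelField, h0])

/-- On the support `‖y - x‖` is at most `s * (‖v‖ + c)`, which absorbs the extra factor `s⁻¹` of the
field. The resulting factor does not depend on `s`, so the bound can be integrated down to scale
zero. -/
theorem norm_kernelField_le {φ : E → ℝ} {c : ℝ} (hφ : tsupport φ ⊆ closedBall 0 c)
    (hφ0 : ∀ z, 0 ≤ φ z)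
    {v : E} {s : ℝ} (hs : 0 < s) (x y : E) :
    ‖kernelField φ v s x y‖ ≤ (‖v‖ + c) * scaledKernel φ v s x y := by
  unfold kernelField scaledKernel
  by_cases h : φ (s⁻¹ • (y - x) - v) = 0
  · simp [h]
  · have h1 := support_scaledKernel_subset hφ hs h
    rw [mem_closedBall, dist_eq_norm] at h1
    have h2 : ‖y - x‖ ≤ s * (‖v‖ + c) := by
      calc ‖y - x‖ = ‖(y - (x + s • v)) + s • v‖ := by congr 1; abel
        _ ≤ s * c + s * ‖v‖ := by
          refine (norm_add_le _ _).trans (add_le_add h1 ?_)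
          rw [norm_smul, Real.norm_of_nonneg hs.le]
        _ = _ := by ring
    rw [norm_smul, Real.norm_of_nonneg (mul_nonneg (by positivity) (hφ0 _)), pow_succ, mul_inv]
    calc _ ≤ (s ^ Module.finrank ℝ E)⁻¹ * s⁻¹ * φ (s⁻¹ • (y - x) - v) * (s * (‖v‖ + c)) := by
          gcongr
          exact mul_nonneg (by positivity) (hφ0 _)
      _ = _ := by field_simp

variable [FiniteDimensional ℝ E] [MeasurableSpace E] [BorelSpace E]

theorem exists_bound_of_hasCompactSupport {X : Type*} [TopologicalSpace X] {f : X → ℝ}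
    (hf : Continuous f) (hc : HasCompactSupport f) : ∃ M, 0 < M ∧ ∀ z, |f z| ≤ M := by
  obtain ⟨C, hC⟩ := hc.exists_bound_of_continuous hf
  exact ⟨max C 1, by positivity, fun z => (hC z).trans (le_max_left _ _)⟩

/-- Differentiating under the integral produces minus the divergence of `kernelField`, which is an
admissible test field because its support stays in `Ω`; the weak gradient then takes over the
derivative. -/
theorem HasEuclideanWeakGradient.hasDerivAt_average {Ω : Set E} {w : E → ℝ} {G : E → E}
    (h : HasEuclideanWeakGradient Ω w G) (hΩ : volume Ω ≠ ⊤)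
    {φ : E → ℝ} (hφ : ContDiff ℝ ∞ φ)
    {c : ℝ} (hsupp : tsupport φ ⊆ closedBall 0 c) {v x : E} {s : ℝ} (hs : 0 < s)
    (hx : closedBall (x + s • v) (s * c) ⊆ Ω) :
    HasDerivAt (fun s => ∫ y in Ω, scaledKernel φ v s x y * w y)
      (∫ y in Ω, ⟪G y, kernelField φ v s x y⟫) s := by
  set n := Module.finrank ℝ E with hn
  have hc : HasCompactSupport φ := (isCompact_closedBall 0 c).of_isClosed_subset
    (isClosed_tsupport _) hsupp
  have hφd : Differentiable ℝ φ := hφ.differentiable (by simp)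
  have hq : Continuous (kernelDerivProfile φ v) := by
    unfold kernelDerivProfile
    have := hφ.continuous
    have h2 := hφ.continuous_fderiv (by simp)
    fun_prop
  have hqc : HasCompactSupport (kernelDerivProfile φ v) := by
    refine HasCompactSupport.intro' hc (isClosed_tsupport _) fun z hz => ?_
    have h1 : φ z = 0 := image_eq_zero_of_notMem_tsupport hz
    have h2 : fderiv ℝ φ z = 0 := by
      by_contra h
      exact hz (support_fderiv_subset ℝ h)
    simp [kernelDerivProfile, h1, h2]
  obtain ⟨M, hM0, hM⟩ := exists_bound_of_hasCompactSupport hq hqc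
  obtain ⟨M', hM0', hM'⟩ := exists_bound_of_hasCompactSupport hφ.continuous hc
  have : IsFiniteMeasure (volume.restrict Ω) := ⟨by simpa using hΩ.lt_top⟩
  have hw : Integrable w (volume.restrict Ω) := h.memLp.integrable (by norm_num)
  have hkc : ∀ s, Continuous (scaledKernel φ v s x) := fun s => by
    unfold scaledKernel
    have := hφ.continuous
    fun_prop
  -- Scales above `s / 2` form a neighbourhood of `s` on which the negative power of the scale stays
  -- bounded.
  have key := hasDerivAt_integral_of_dominated_loc_of_deriv_le (μ := volume.restrict Ω)
    (F := fun s y => scaledKernel φ v s x y * w y)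
    (F' := fun s y => -((s ^ (n + 1))⁻¹ * kernelDerivProfile φ v (s⁻¹ • (y - x) - v)) * w y)
    (x₀ := s) (s := Set.Ioi (s / 2)) (bound := fun y => (((s / 2) ^ (n + 1))⁻¹ * M) * |w y|)
    (Ioi_mem_nhds (by linarith))
    (Eventually.of_forall fun s => (hkc s).aestronglyMeasurable.mul hw.aestronglyMeasurable)
    ?_ ?_ ?_ ?_ ?_
  · refine key.2.congr_deriv ?_
    have := h.integral_by_parts (kernelField φ v s x) (contDiff_kernelField hφ v s x)
      ((isCompact_closedBall _ _).of_isClosed_subset (isClosed_tsupport _)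
        (tsupport_kernelField_subset hsupp hs x))
      ((tsupport_kernelField_subset hsupp hs x).trans hx)
    rw [eq_comm, ← neg_inj, ← this, ← integral_neg]
    congr 1
    ext y
    rw [euclideanDiv_kernelField hφd v s]
    ring
  · refine hw.bdd_mul (c := (s ^ n)⁻¹ * M') (hkc s).aestronglyMeasurable (ae_of_all _ fun y => ?_)
    rw [scaledKernel, norm_mul, Real.norm_of_nonneg (by positivity)]
    gcongr
    exact hM' _
  · refine AEStronglyMeasurable.mul (Continuous.aestronglyMeasurable ?_) hw.aestronglyMeasurable
    fun_prop
  · refine ae_of_all _ fun y t ht => ?_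
    have ht' : s / 2 < t := ht
    have ht0 : 0 < t := by linarith
    rw [norm_mul, norm_neg, norm_mul, Real.norm_of_nonneg (by positivity)]
    gcongr
    · exact hM _
    · exact le_rfl
  · exact hw.abs.const_mul _
  · refine ae_of_all _ fun y t ht => ?_
    have ht' : s / 2 < t := ht
    exact (hasDerivAt_scaledKernel hφd v (by linarith) x y).mul_const (w y)

end WeakGradient

/-! ### Distance in L² between a Sobolev function and its averages -/

section Averaging

variable {E : Type*} [NormedAddCommGroup E] [InnerProductSpace ℝ E]
  [FiniteDimensional ℝ E] [MeasurableSpace E] [BorelSpace E]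

/-- A mollifier profile supported in the closed ball of radius `c` around the origin. -/
structure IsAveragingProfile (φ : E → ℝ) (c : ℝ) : Prop where
  contDiff : ContDiff ℝ ∞ φ
  nonneg : ∀ z, 0 ≤ φ z
  tsupport_subset : tsupport φ ⊆ closedBall 0 c
  integral_eq_one : ∫ z, φ z = 1

theorem exists_isAveragingProfile {c : ℝ} (hc : 0 < c) :
    ∃ φ : E → ℝ, IsAveragingProfile φ c := by
  let ρ : ContDiffBump (0 : E) := ⟨c / 2, c, by positivity, by linarith⟩
  exact ⟨ρ.normed volume, ρ.contDiff_normed, ρ.nonneg_normed, (ρ.tsupport_normed_eq).le,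
    ρ.integral_normed⟩

theorem IsAveragingProfile.hasCompactSupport {φ : E → ℝ} {c : ℝ} (h : IsAveragingProfile φ c) :
    HasCompactSupport φ :=
  (isCompact_closedBall 0 c).of_isClosed_subset (isClosed_tsupport _) h.tsupport_subset

theorem IsAveragingProfile.lintegral_eq_one {φ : E → ℝ} {c : ℝ} (h : IsAveragingProfile φ c) :
    ∫⁻ z, ENNReal.ofReal (φ z) = 1 := by
  rw [← ofReal_integral_eq_lintegral_ofReal
    (h.contDiff.continuous.integrable_of_hasCompactSupport h.hasCompactSupport)
    (ae_of_all _ h.nonneg), h.integral_eq_one, ENNReal.ofReal_one]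

theorem lintegral_comp_smul_of_pos {f : E → ENNReal} (hf : Measurable f) {r : ℝ} (hr : 0 < r) :
    ∫⁻ y, f (r • y) = ENNReal.ofReal ((r ^ Module.finrank ℝ E)⁻¹) * ∫⁻ y, f y := by
  rw [← lintegral_map hf (measurable_const_smul r), Measure.map_addHaar_smul _ hr.ne',
    lintegral_smul_measure, abs_of_pos (by positivity), smul_eq_mul]

theorem IsAveragingProfile.lintegral_scaledKernel_right {φ : E → ℝ} {c : ℝ}
    (h : IsAveragingProfile φ c) (v : E) {s : ℝ} (hs : 0 < s) (x : E) :
    ∫⁻ y, ENNReal.ofReal (scaledKernel φ v s x y) = 1 := by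
  have hm : Measurable fun z => ENNReal.ofReal (φ z) :=
    ENNReal.measurable_ofReal.comp h.contDiff.continuous.measurable
  have e : ∀ y, ENNReal.ofReal (scaledKernel φ v s x y) =
      ENNReal.ofReal ((s ^ Module.finrank ℝ E)⁻¹) *
        ENNReal.ofReal (φ (s⁻¹ • (y - (x + s • v)))) := fun y => by
    rw [scaledKernel, ENNReal.ofReal_mul (by positivity)]
    congr 4
    rw [← sub_sub, smul_sub _ _ (s • v), inv_smul_smul₀ hs.ne']
  simp only [e]
  rw [lintegral_const_mul' _ _ ENNReal.ofReal_ne_top,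
    lintegral_sub_right_eq_self (fun y => ENNReal.ofReal (φ (s⁻¹ • y))) (x + s • v),
    lintegral_comp_smul_of_pos hm (inv_pos.2 hs), h.lintegral_eq_one, mul_one,
    ← ENNReal.ofReal_mul (by positivity), inv_pow, inv_inv, inv_mul_cancel₀ (by positivity),
    ENNReal.ofReal_one]

theorem IsAveragingProfile.lintegral_scaledKernel_left {φ : E → ℝ} {c : ℝ}
    (h : IsAveragingProfile φ c) (v : E) {s : ℝ} (hs : 0 < s) (y : E) :
    ∫⁻ x, ENNReal.ofReal (scaledKernel φ v s x y) = 1 := by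
  have hm : Measurable fun z => ENNReal.ofReal (φ z) :=
    ENNReal.measurable_ofReal.comp h.contDiff.continuous.measurable
  have e : ∀ x, ENNReal.ofReal (scaledKernel φ v s x y) =
      ENNReal.ofReal ((s ^ Module.finrank ℝ E)⁻¹) *
        ENNReal.ofReal (φ (s⁻¹ • ((y - s • v) - x))) := fun x => by
    rw [scaledKernel, ENNReal.ofReal_mul (by positivity)]
    congr 4
    rw [sub_right_comm, smul_sub _ _ (s • v), inv_smul_smul₀ hs.ne']
  simp only [e]
  rw [lintegral_const_mul' _ _ ENNReal.ofReal_ne_top,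
    lintegral_sub_left_eq_self (fun y => ENNReal.ofReal (φ (s⁻¹ • y))) (y - s • v),
    lintegral_comp_smul_of_pos hm (inv_pos.2 hs), h.lintegral_eq_one, mul_one,
    ← ENNReal.ofReal_mul (by positivity), inv_pow, inv_inv, inv_mul_cancel₀ (by positivity),
    ENNReal.ofReal_one]

theorem IsAveragingProfile.scaledKernel_nonneg {φ : E → ℝ} {c : ℝ}
    (h : IsAveragingProfile φ c) (v : E) {s : ℝ} (hs : 0 ≤ s) (x y : E) :
    0 ≤ scaledKernel φ v s x y :=
  mul_nonneg (by positivity) (h.nonneg _)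

theorem IsAveragingProfile.continuous_scaledKernel {φ : E → ℝ} {c : ℝ}
    (h : IsAveragingProfile φ c) (v : E) (s : ℝ) :
    Continuous (fun p : E × E => scaledKernel φ v s p.1 p.2) := by
  unfold scaledKernel
  have := h.contDiff.continuous
  fun_prop

theorem IsAveragingProfile.measurable_scaledKernel {φ : E → ℝ} {c : ℝ}
    (h : IsAveragingProfile φ c) (v : E) :
    Measurable (fun p : ℝ × E × E => scaledKernel φ v p.1 p.2.1 p.2.2) := by
  unfold scaledKernel
  have := h.contDiff.continuous.measurable
  fun_prop

/-- The fundamental theorem of calculus in the scale. The right side no longer contains the lower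
scale `a`, which prepares the limit `a → 0`. -/
theorem HasEuclideanWeakGradient.enorm_average_sub_average_le {Ω : Set E} {w : E → ℝ} {G : E → E}
    (h : HasEuclideanWeakGradient Ω w G) (hΩ : volume Ω ≠ ⊤) {φ : E → ℝ} {c : ℝ}
    (hφ : IsAveragingProfile φ c) (hc : 0 < c) {v x : E} {a b : ℝ} (ha : 0 < a) (hab : a ≤ b)
    (hx : ∀ s ∈ Set.Ioc 0 b, closedBall (x + s • v) (s * c) ⊆ Ω) :
    ‖(∫ y in Ω, scaledKernel φ v b x y * w y) - ∫ y in Ω, scaledKernel φ v a x y * w y‖ₑ ≤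
      ENNReal.ofReal (‖v‖ + c) * ∫⁻ s in Set.Ioc 0 b, ∫⁻ y in Ω,
        ENNReal.ofReal (scaledKernel φ v s x y) * ‖G y‖ₑ := by
  set T : ℝ → ℝ := fun s => ∫ y in Ω, scaledKernel φ v s x y * w y with hT
  have : IsFiniteMeasure (volume.restrict Ω) := ⟨by simpa using hΩ.lt_top⟩
  have hG : Integrable G (volume.restrict Ω) := h.memLp_grad.integrable (by norm_num)
  obtain ⟨M, hM0, hM⟩ := exists_bound_of_hasCompactSupport hφ.contDiff.continuous
    hφ.hasCompactSupport
  have hder : ∀ s ∈ Set.Ioc 0 b, HasDerivAt T (∫ y in Ω, ⟪G y, kernelField φ v s x y⟫) s :=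
    fun s hs => h.hasDerivAt_average hΩ hφ.contDiff hφ.tsupport_subset hs.1 (hx s hs)
  have hpt : ∀ s, 0 < s → ∀ y, ‖⟪G y, kernelField φ v s x y⟫‖ ≤
      (‖v‖ + c) * scaledKernel φ v s x y * ‖G y‖ := fun s hs y => by
    refine (norm_inner_le_norm _ _).trans ?_
    rw [mul_comm]
    gcongr
    exact norm_kernelField_le hφ.tsupport_subset hφ.nonneg hs x y
  -- The integrand is taken to be `deriv T` since a derivative is automatically measurable; only a
  -- bound on `(a, b]` is left to find.
  have hint : IntervalIntegrable (deriv T) volume a b := by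
    rw [intervalIntegrable_iff, Set.uIoc_of_le hab]
    refine IntegrableOn.of_bound (C := ∫ y in Ω, (‖v‖ + c) * ((a ^ Module.finrank ℝ E)⁻¹ * M)
      * ‖G y‖) (by simp) (measurable_deriv T).aestronglyMeasurable ?_
    refine (ae_restrict_iff' measurableSet_Ioc).2 (ae_of_all _ fun s hs => ?_)
    have hs0 : 0 < s := ha.trans hs.1
    rw [(hder s ⟨hs0, hs.2⟩).deriv]
    refine norm_integral_le_of_norm_le (hG.norm.const_mul _) (ae_of_all _ fun y => ?_)
    refine (hpt s hs0 y).trans ?_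
    gcongr
    unfold scaledKernel
    gcongr
    · exact hφ.nonneg _
    · exact hs.1.le
    · exact (le_abs_self _).trans (hM _)
  have hftc := intervalIntegral.integral_eq_sub_of_hasDerivAt (f := T) (f' := deriv T)
    (a := a) (b := b) (fun s hs => by
      rw [Set.uIcc_of_le hab] at hs
      have := hder s ⟨ha.trans_le hs.1, hs.2⟩
      rwa [this.deriv]) hint
  rw [← hftc, intervalIntegral.integral_of_le hab]
  refine (enorm_integral_le_lintegral_enorm _).trans ?_
  rw [← lintegral_const_mul' _ _ ENNReal.ofReal_ne_top]
  refine (lintegral_mono_set (Set.Ioc_subset_Ioc_left ha.le)).trans ?_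
  refine setLIntegral_mono' measurableSet_Ioc fun s hs => ?_
  rw [(hder s hs).deriv, ← lintegral_const_mul' _ _ ENNReal.ofReal_ne_top]
  refine (enorm_integral_le_lintegral_enorm _).trans (lintegral_mono fun y => ?_)
  have hk := hφ.scaledKernel_nonneg v hs.1.le x y
  rw [← mul_assoc, ← ENNReal.ofReal_mul (by positivity), ← ofReal_norm,
    ← ofReal_norm (G y), ← ENNReal.ofReal_mul (by positivity)]
  exact ENNReal.ofReal_le_ofReal (hpt s hs.1 y)

theorem IsAveragingProfile.setIntegral_mul_sub {φ : E → ℝ} {c : ℝ}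
    (hφ : IsAveragingProfile φ c) {Ω : Set E} (hΩm : MeasurableSet Ω) {w : E → ℝ}
    (hw : IntegrableOn w Ω) {v x : E} {s : ℝ} (hs : 0 < s) (t : ℝ) :
    (∫ y in Ω, scaledKernel φ v s x y * w y) - t =
      ∫ y in closedBall (x + s • v) (s * c), scaledKernel φ v s x y * (Ω.indicator w y - t) := by
  have hk : Continuous (scaledKernel φ v s x) := by
    unfold scaledKernel
    have := hφ.contDiff.continuous
    fun_prop
  have hzero : ∀ y, y ∉ closedBall (x + s • v) (s * c) → scaledKernel φ v s x y = 0 := by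
    intro y hy
    by_contra h0
    exact hy (support_scaledKernel_subset hφ.tsupport_subset hs
      fun h => h0 (by simp [scaledKernel, h]))
  have hkc : HasCompactSupport (scaledKernel φ v s x) :=
    HasCompactSupport.intro (isCompact_closedBall (x + s • v) (s * c)) fun y hy => hzero y hy
  obtain ⟨M, -, hM⟩ := exists_bound_of_hasCompactSupport hk hkc
  have hki : Integrable (scaledKernel φ v s x) := hk.integrable_of_hasCompactSupport hkc
  have h1 : ∫ y, scaledKernel φ v s x y = 1 := by
    rw [integral_eq_lintegral_of_nonneg_ae (ae_of_all _ fun y =>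
      hφ.scaledKernel_nonneg v hs.le x y) hk.aestronglyMeasurable,
      hφ.lintegral_scaledKernel_right v hs x, ENNReal.toReal_one]
  have e0 : ∫ y in closedBall (x + s • v) (s * c), scaledKernel φ v s x y * (Ω.indicator w y - t)
      = ∫ y, scaledKernel φ v s x y * (Ω.indicator w y - t) :=
    setIntegral_eq_integral_of_forall_compl_eq_zero fun y hy => by rw [hzero y hy, zero_mul]
  rw [e0]
  have hwi : Integrable (Ω.indicator w) := (integrable_indicator_iff hΩm).2 hw
  have e1 : ∫ y in Ω, scaledKernel φ v s x y * w y
      = ∫ y, scaledKernel φ v s x y * Ω.indicator w y := by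
    rw [← integral_indicator hΩm]
    congr 1
    ext y
    by_cases hy : y ∈ Ω <;> simp [hy]
  simp only [mul_sub]
  rw [integral_sub (hwi.bdd_mul (c := M) hk.aestronglyMeasurable (ae_of_all _ hM))
    (hki.mul_const t), integral_mul_const, h1, one_mul, e1]

/-- Lebesgue differentiation along balls that are not centred at `x` but contain it after
enlargement by a fixed factor. Letting that factor run through the naturals keeps the exceptional
set null and independent of profile, drift and scale. The independence matters later, where the
drift is chosen depending on `x`. -/
theorem ae_tendsto_average_scaledKernel {Ω : Set E} (hΩm : MeasurableSet Ω) {w : E → ℝ}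
    (hw : IntegrableOn w Ω) :
    ∀ᵐ x, x ∈ Ω → ∀ (φ : E → ℝ) (c : ℝ) (v : E) (b : ℝ), IsAveragingProfile φ c → 0 < c → 0 < b →
      (∀ s ∈ Set.Ioc 0 b, closedBall (x + s • v) (s * c) ⊆ Ω) →
      Tendsto (fun s => ∫ y in Ω, scaledKernel φ v s x y * w y) (𝓝[>] 0) (𝓝 (w x)) := by
  have hwi : Integrable (Ω.indicator w) := (integrable_indicator_iff hΩm).2 hw
  have hL : ∀ᵐ x : E, ∀ K : ℕ, ∀ (z : ℝ → E) (δ : ℝ → ℝ), Tendsto δ (𝓝[>] 0) (𝓝[>] 0) →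
      (∀ᶠ j in 𝓝[>] 0, x ∈ closedBall (z j) (K * δ j)) →
      Tendsto (fun j => ⨍ y in closedBall (z j) (δ j), ‖Ω.indicator w y - Ω.indicator w x‖)
        (𝓝[>] 0) (𝓝 0) := by
    rw [ae_all_iff]
    intro K
    filter_upwards [IsUnifLocDoublingMeasure.ae_tendsto_average_norm_sub volume
      hwi.locallyIntegrable (K : ℝ)] with x hx z δ h1 h2 using hx z δ h1 h2
  filter_upwards [hL] with x hx hxΩ φ c v b hφ hc hb hball
  -- The ball at scale `s` has radius `s * c` and centre at distance `s * ‖v‖` from `x`, so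
  -- enlarging it by `‖v‖ / c` reaches `x`.
  obtain ⟨K, hK⟩ := exists_nat_ge (‖v‖ / c)
  obtain ⟨M, hM0, hM⟩ := exists_bound_of_hasCompactSupport hφ.contDiff.continuous
    hφ.hasCompactSupport
  have hδ : Tendsto (fun s : ℝ => s * c) (𝓝[>] 0) (𝓝[>] 0) := by
    refine tendsto_nhdsWithin_iff.2 ⟨?_, ?_⟩
    · have : Tendsto (fun s : ℝ => s * c) (𝓝 0) (𝓝 (0 * c)) := tendsto_id.mul_const c
      rw [zero_mul] at this
      exact this.mono_left nhdsWithin_le_nhds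
    · filter_upwards [self_mem_nhdsWithin] with s hs using mul_pos hs hc
  have hlim := hx K (fun s => x + s • v) (fun s => s * c) hδ (by
    filter_upwards [self_mem_nhdsWithin] with s hs
    have hs : 0 < s := hs
    rw [mem_closedBall, dist_eq_norm, sub_add_cancel_left, norm_neg, norm_smul,
      Real.norm_of_nonneg hs.le]
    rw [div_le_iff₀ hc] at hK
    calc s * ‖v‖ ≤ s * (K * c) := by gcongr
      _ = _ := by ring)
  rw [tendsto_iff_norm_sub_tendsto_zero]
  set C : ℝ := M * volume.real (closedBall (0 : E) c) with hC
  refine squeeze_zero' (Eventually.of_forall fun _ => norm_nonneg _) ?_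
    (by simpa using hlim.const_mul C)
  filter_upwards [Ioc_mem_nhdsGT hb] with s hs
  rw [hφ.setIntegral_mul_sub hΩm hw hs.1]
  have hcv : IsFiniteMeasure (volume.restrict (closedBall (x + s • v) (s * c))) :=
    ⟨by simpa using measure_closedBall_lt_top⟩
  have hwx : Ω.indicator w x = w x := Set.indicator_of_mem hxΩ w
  have hi : IntegrableOn (fun y => (s ^ Module.finrank ℝ E)⁻¹ * M *
      ‖Ω.indicator w y - Ω.indicator w x‖) (closedBall (x + s • v) (s * c)) :=
    ((hwi.restrict.sub (integrable_const _)).norm).const_mul _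
  refine (norm_integral_le_of_norm_le hi (ae_of_all _ fun y => ?_)).trans ?_
  · rw [hwx, norm_mul]
    gcongr
    unfold scaledKernel
    rw [norm_mul, Real.norm_of_nonneg (inv_nonneg.2 (pow_nonneg hs.1.le _))]
    exact mul_le_mul_of_nonneg_left (hM _) (inv_nonneg.2 (pow_nonneg hs.1.le _))
  · rw [integral_const_mul, setAverage_eq, smul_eq_mul]
    have hsn : 0 < s ^ Module.finrank ℝ E := pow_pos hs.1 _
    have hv : volume.real (closedBall (x + s • v) (s * c)) =
        s ^ Module.finrank ℝ E * volume.real (closedBall (0 : E) c) := by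
      rw [Measure.addHaar_real_closedBall' volume _ (mul_pos hs.1 hc).le,
        Measure.addHaar_real_closedBall' volume (0 : E) hc.le, mul_pow]
      ring
    have hpos : 0 < volume.real (closedBall (0 : E) c) :=
      ENNReal.toReal_pos (measure_closedBall_pos volume _ hc).ne' measure_closedBall_lt_top.ne
    rw [hv, hC]
    apply le_of_eq
    field_simp
    rfl

theorem HasEuclideanWeakGradient.ae_enorm_average_sub_le {Ω : Set E} {w : E → ℝ} {G : E → E}
    (h : HasEuclideanWeakGradient Ω w G) (hΩm : MeasurableSet Ω) (hΩ : volume Ω ≠ ⊤) :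
    ∀ᵐ x, x ∈ Ω → ∀ (φ : E → ℝ) (c : ℝ) (v : E) (b : ℝ), IsAveragingProfile φ c → 0 < c → 0 < b →
      (∀ s ∈ Set.Ioc 0 b, closedBall (x + s • v) (s * c) ⊆ Ω) →
      ‖(∫ y in Ω, scaledKernel φ v b x y * w y) - w x‖ₑ ≤
      ENNReal.ofReal (‖v‖ + c) * ∫⁻ s in Set.Ioc 0 b, ∫⁻ y in Ω,
        ENNReal.ofReal (scaledKernel φ v s x y) * ‖G y‖ₑ := by
  have : IsFiniteMeasure (volume.restrict Ω) := ⟨by simpa using hΩ.lt_top⟩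
  filter_upwards [ae_tendsto_average_scaledKernel hΩm (h.memLp.integrable (by norm_num))]
    with x hx hxΩ φ c v b hφ hc hb hball
  have hlim := (hx hxΩ φ c v b hφ hc hb hball).const_sub
    (∫ y in Ω, scaledKernel φ v b x y * w y)
  refine le_of_tendsto hlim.enorm ?_
  filter_upwards [Ioc_mem_nhdsGT hb] with s hs
  exact h.enorm_average_sub_average_le hΩ hφ hc hs.1 hs.2 hball

/-- Cauchy–Schwarz after splitting `k * g` as `√k * (√k * g)`. -/
theorem sq_lintegral_mul_le {α : Type*} [MeasurableSpace α] (μ : Measure α) {k g : α → ENNReal}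
    (hk : AEMeasurable k μ) (hg : AEMeasurable g μ) :
    (∫⁻ x, k x * g x ∂μ) ^ 2 ≤ (∫⁻ x, k x ∂μ) * ∫⁻ x, k x * g x ^ 2 ∂μ := by
  have hh : Real.HolderConjugate 2 2 := Real.HolderConjugate.two_two
  have := ENNReal.lintegral_mul_le_Lp_mul_Lq μ hh (f := fun x => k x ^ (1 / 2 : ℝ))
    (g := fun x => k x ^ (1 / 2 : ℝ) * g x) (hk.pow_const _) ((hk.pow_const _).mul hg)
  have e1 : ∀ x, k x ^ (1 / 2 : ℝ) * k x ^ (1 / 2 : ℝ) = k x := fun x => by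
    rw [← ENNReal.rpow_add_of_nonneg _ _ (by norm_num) (by norm_num)]; norm_num
  have e2 : ∀ a : ENNReal, a ^ (2 : ℝ) = a ^ 2 := fun a => by
    rw [← ENNReal.rpow_natCast]; norm_num
  have e3 : ∀ a : ENNReal, (a ^ (1 / 2 : ℝ)) ^ 2 = a := fun a => by
    rw [sq, ← ENNReal.rpow_add_of_nonneg _ _ (by norm_num) (by norm_num)]; norm_num
  have h2 := pow_le_pow_left' this 2
  simp only [Pi.mul_apply, ← mul_assoc, e1, e2, mul_pow, e3] at h2
  exact h2

/-- A Schur test. The kernel has mass at most one in `y`, which together with the interval of scales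
gives one factor `b` through Cauchy–Schwarz; after exchanging the integrals it has mass one in `x`,
and integrating over the scales gives the second factor `b`. -/
theorem HasEuclideanWeakGradient.lintegral_average_sub_sq_le {Ω : Set E} {w : E → ℝ} {G : E → E}
    (h : HasEuclideanWeakGradient Ω w G) (hΩm : MeasurableSet Ω) (hΩ : volume Ω ≠ ⊤)
    {φ : E → ℝ} {c : ℝ} (hφ : IsAveragingProfile φ c) (hc : 0 < c) {A : Set E}
    (hA : A ⊆ Ω) (hAm : MeasurableSet A) {v : E} {b : ℝ} (hb : 0 < b)
    (hball : ∀ x ∈ A, ∀ s ∈ Set.Ioc 0 b, closedBall (x + s • v) (s * c) ⊆ Ω) :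
    ∫⁻ x in A, ‖(∫ y in Ω, scaledKernel φ v b x y * w y) - w x‖ₑ ^ 2 ≤
      ENNReal.ofReal ((‖v‖ + c) * b) ^ 2 * ∫⁻ y in Ω, ‖G y‖ₑ ^ 2 := by
  set k : ℝ → E → E → ENNReal := fun s x y => ENNReal.ofReal (scaledKernel φ v s x y) with hk
  have hkm : Measurable (fun p : ℝ × E × E => k p.1 p.2.1 p.2.2) :=
    ENNReal.measurable_ofReal.comp (hφ.measurable_scaledKernel v)
  set g : E → ENNReal := fun y => ‖G y‖ₑ with hg
  have hgm : AEMeasurable g (volume.restrict Ω) := h.memLp_grad.aestronglyMeasurable.enorm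
  set μ := (volume.restrict (Set.Ioc 0 b)).prod (volume.restrict Ω) with hμ
  have hgm' : AEMeasurable (fun p : ℝ × E => g p.2) μ :=
    hgm.comp_quasiMeasurePreserving Measure.quasiMeasurePreserving_snd
  have hkx : ∀ x, Measurable (fun p : ℝ × E => k p.1 x p.2) := fun x =>
    hkm.comp (f := fun p : ℝ × E => (p.1, x, p.2)) (by fun_prop)
  have step1 : ∀ x, (∫⁻ s in Set.Ioc 0 b, ∫⁻ y in Ω, k s x y * g y) ^ 2 ≤
      ENNReal.ofReal b * ∫⁻ p, k p.1 x p.2 * g p.2 ^ 2 ∂μ := fun x => by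
    rw [← lintegral_prod (fun p : ℝ × E => k p.1 x p.2 * g p.2)
      ((hkx x).aemeasurable.mul hgm')]
    refine (sq_lintegral_mul_le μ (hkx x).aemeasurable hgm').trans ?_
    gcongr
    rw [lintegral_prod _ (hkx x).aemeasurable]
    calc ∫⁻ s in Set.Ioc 0 b, ∫⁻ y in Ω, k s x y
        ≤ ∫⁻ s in Set.Ioc 0 b, 1 := setLIntegral_mono' measurableSet_Ioc fun s hs =>
          (setLIntegral_le_lintegral _ _).trans (hφ.lintegral_scaledKernel_right v hs.1 x).le
      _ = ENNReal.ofReal b := by simp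
  calc ∫⁻ x in A, ‖(∫ y in Ω, scaledKernel φ v b x y * w y) - w x‖ₑ ^ 2
      ≤ ∫⁻ x in A, ENNReal.ofReal (‖v‖ + c) ^ 2 *
          (ENNReal.ofReal b * ∫⁻ p, k p.1 x p.2 * g p.2 ^ 2 ∂μ) := by
        refine lintegral_mono_ae ?_
        filter_upwards [ae_restrict_of_ae (h.ae_enorm_average_sub_le hΩm hΩ),
          ae_restrict_mem hAm] with x hx hxA
        refine (pow_le_pow_left' (hx (hA hxA) φ c v b hφ hc hb (hball x hxA)) 2).trans ?_
        rw [mul_pow]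
        gcongr
        exact step1 x
    _ ≤ ENNReal.ofReal (‖v‖ + c) ^ 2 *
          (ENNReal.ofReal b * ∫⁻ x, ∫⁻ p, k p.1 x p.2 * g p.2 ^ 2 ∂μ) := by
        rw [lintegral_const_mul' _ _ (by finiteness), lintegral_const_mul' _ _ (by finiteness)]
        gcongr
        exact Measure.restrict_le_self
    _ = ENNReal.ofReal (‖v‖ + c) ^ 2 *
          (ENNReal.ofReal b * ∫⁻ p, (∫⁻ x, k p.1 x p.2) * g p.2 ^ 2 ∂μ) := by
        rw [lintegral_lintegral_swap]
        · congr 3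
          ext p
          rw [lintegral_mul_const' _ _ (by simp [hg])]
        · refine AEMeasurable.mul
            (hkm.comp (f := fun q : E × ℝ × E => (q.2.1, q.1, q.2.2)) (by fun_prop)).aemeasurable ?_
          exact (hgm'.pow_const 2).comp_quasiMeasurePreserving
            Measure.quasiMeasurePreserving_snd
    _ = ENNReal.ofReal (‖v‖ + c) ^ 2 *
          (ENNReal.ofReal b * ∫⁻ p, g p.2 ^ 2 ∂μ) := by
        congr 2
        refine lintegral_congr_ae ?_
        have : ∀ᵐ p ∂μ, p.1 ∈ Set.Ioc 0 b :=
          Measure.quasiMeasurePreserving_fst.ae (ae_restrict_mem measurableSet_Ioc)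
        filter_upwards [this] with p hp
        rw [hφ.lintegral_scaledKernel_left v hp.1, one_mul]
    _ = _ := by
        rw [lintegral_prod _ (hgm'.pow_const 2)]
        simp only [lintegral_const, Measure.restrict_apply_univ, Real.volume_Ioc, sub_zero]
        rw [ENNReal.ofReal_mul (by positivity)]
        ring

end Averaging

/-! ### Compactness of the Sobolev embedding under an interior cone condition -/

section Rellich

theorem ofReal_integral_norm_sq {α F : Type*} [MeasurableSpace α] [NormedAddCommGroup F]
    {μ : Measure α} {f : α → F} (hf : MemLp f 2 μ) :
    ENNReal.ofReal (∫ x, ‖f x‖ ^ 2 ∂μ) = ∫⁻ x, ‖f x‖ₑ ^ 2 ∂μ := by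
  rw [ofReal_integral_eq_lintegral_ofReal hf.norm.integrable_sq
    (ae_of_all _ fun x => sq_nonneg _)]
  congr 1
  ext x
  rw [ENNReal.ofReal_pow (norm_nonneg _), ofReal_norm]

/-- The quadratic polynomial `t ↦ ∫ (|f| + t) ^ 2` is nonnegative; its minimum, at `t = -I / m`,
gives the claim. -/
theorem sq_integral_abs_le {α : Type*} [MeasurableSpace α] {μ : Measure α} [IsFiniteMeasure μ]
    {f : α → ℝ} (hf : MemLp f 2 μ) :
    (∫ x, |f x| ∂μ) ^ 2 ≤ μ.real Set.univ * ∫ x, f x ^ 2 ∂μ := by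
  have h1 : Integrable (fun x => |f x|) μ := (hf.integrable (by norm_num)).abs
  set I := ∫ x, |f x| ∂μ
  set J := ∫ x, f x ^ 2 ∂μ
  set m := μ.real Set.univ
  have h2 : ∀ t : ℝ, 0 ≤ J + 2 * t * I + t ^ 2 * m := fun t => by
    have : ∫ x, (|f x| + t) ^ 2 ∂μ = J + 2 * t * I + t ^ 2 * m := by
      have e : ∀ x, (|f x| + t) ^ 2 = f x ^ 2 + 2 * t * |f x| + t ^ 2 := fun x => by
        rw [← sq_abs (f x)]; ring
      simp only [e]
      have h3 := hf.integrable_sq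
      have h4 : Integrable (fun x => f x ^ 2 + 2 * t * |f x|) μ := h3.add (h1.const_mul _)
      rw [integral_add h4 (integrable_const _),
        integral_add h3 (h1.const_mul _), integral_const_mul, integral_const, smul_eq_mul]
      ring
    rw [← this]
    exact integral_nonneg fun x => sq_nonneg _
  have hm : 0 ≤ m := measureReal_nonneg
  rcases hm.eq_or_lt with h0 | h0
  · have : μ = 0 := by
      rw [← Measure.measure_univ_eq_zero]
      exact (measureReal_eq_zero_iff).1 h0.symm
    simp [I, this, ← h0]
  · have := h2 (-I / m)
    have e : J + 2 * (-I / m) * I + (-I / m) ^ 2 * m = J - I ^ 2 / m := by field_simp; ring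
    rw [e, sub_nonneg, div_le_iff₀ h0] at this
    linarith

variable {E : Type*} [NormedAddCommGroup E] [InnerProductSpace ℝ E]
  [FiniteDimensional ℝ E] [MeasurableSpace E] [BorelSpace E]

/-- `H¹(Ω)` functions on `A ∩ Ω` are controlled in `L²`, up to a small multiple of the `H¹` norm,
by finitely many linear functionals. -/
def IsRellichSet (Ω A : Set E) : Prop :=
  ∀ ε : ℝ, 0 < ε → ∃ (S : Finset (E → ℝ)) (C : ℝ), 0 ≤ C ∧
    (∀ k ∈ S, MemLp k 2 (volume.restrict Ω)) ∧
    ∀ (w : E → ℝ) (G : E → E), HasEuclideanWeakGradient Ω w G →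
      ∫ x in A ∩ Ω, w x ^ 2 ≤ ε * ((∫ x in Ω, w x ^ 2) + ∫ x in Ω, ‖G x‖ ^ 2) +
        C * ∑ k ∈ S, (∫ x in Ω, k x * w x) ^ 2

/-- At a small fixed scale `w` is close in `L²` to its averages, with error governed by the
gradient. The averages depend on `x` uniformly continuously, so their values on a finite net of the
ball control them everywhere; these values are the finitely many functionals. -/
theorem isRellichSet_ball {Ω : Set E} (hΩm : MeasurableSet Ω) (hΩ : volume Ω ≠ ⊤)
    {v p : E} {c b r : ℝ} (hc : 0 < c) (hb : 0 < b)
    (hball : ∀ x ∈ ball p r ∩ Ω, ∀ s ∈ Set.Ioc 0 b, closedBall (x + s • v) (s * c) ⊆ Ω) :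
    IsRellichSet Ω (ball p r) := by
  classical
  intro ε hε
  have hfin : IsFiniteMeasure (volume.restrict Ω) := ⟨by simpa using hΩ.lt_top⟩
  set V : ℝ := (volume.restrict Ω).real Set.univ with hV
  have hV0 : 0 ≤ V := measureReal_nonneg
  obtain ⟨φ, hφ⟩ := exists_isAveragingProfile (E := E) hc
  obtain ⟨η, hη0, hη⟩ : ∃ η : ℝ, 0 < η ∧ 4 * V ^ 2 * η ^ 2 ≤ ε := by
    -- With `η ≤ 1` the square of `η` is at most `η`, so a bound linear in `ε` suffices; the same
    -- device selects the scale `b'`.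
    refine ⟨min 1 (ε / (4 * V ^ 2 + 1)), by positivity, ?_⟩
    set η := min 1 (ε / (4 * V ^ 2 + 1))
    have h1 : η ≤ 1 := min_le_left _ _
    have h0 : 0 < η := by positivity
    have h2 : η ≤ ε / (4 * V ^ 2 + 1) := min_le_right _ _
    rw [le_div_iff₀ (by positivity)] at h2
    nlinarith [sq_nonneg V, mul_nonneg (sq_nonneg V) h0.le]
  obtain ⟨b', hb0, hbb, hb'⟩ : ∃ b' : ℝ, 0 < b' ∧ b' ≤ b ∧ 2 * ((‖v‖ + c) * b') ^ 2 ≤ ε := by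
    set L := ‖v‖ + c
    refine ⟨min b (min 1 (ε / (2 * L ^ 2 + 1))), by positivity, min_le_left _ _, ?_⟩
    set η := min b (min 1 (ε / (2 * L ^ 2 + 1)))
    have h1 : η ≤ 1 := (min_le_right _ _).trans (min_le_left _ _)
    have h0 : 0 < η := by positivity
    have h2 : η ≤ ε / (2 * L ^ 2 + 1) := (min_le_right _ _).trans (min_le_right _ _)
    rw [le_div_iff₀ (by positivity)] at h2
    nlinarith [sq_nonneg L, mul_nonneg (sq_nonneg L) h0.le]
  have huc : UniformContinuous φ :=
    hφ.hasCompactSupport.uniformContinuous_of_continuous hφ.contDiff.continuous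
  set n := Module.finrank ℝ E with hn
  obtain ⟨δ, hδ0, hδ⟩ : ∃ δ > 0, ∀ x x' : E, dist x x' < δ → ∀ y,
      |scaledKernel φ v b' x y - scaledKernel φ v b' x' y| ≤ η := by
    obtain ⟨δ, hδ0, hδ⟩ := Metric.uniformContinuous_iff.1 huc (b' ^ n * η) (by positivity)
    refine ⟨b' * δ, by positivity, fun x x' hxx y => ?_⟩
    have h1 : dist (b'⁻¹ • (y - x) - v) (b'⁻¹ • (y - x') - v) < δ := by
      rw [dist_sub_right, dist_smul₀, dist_sub_left, Real.norm_of_nonneg (by positivity),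
        inv_mul_lt_iff₀ hb0]
      exact hxx
    have h2 := (hδ h1).le
    rw [Real.dist_eq] at h2
    rw [scaledKernel, scaledKernel, ← mul_sub, abs_mul, abs_of_nonneg (by positivity),
      inv_mul_le_iff₀ (by positivity)]
    exact h2
  obtain ⟨t, -, htf, ht⟩ := (isCompact_closedBall p r).finite_cover_balls hδ0
  have hkc : ∀ x, Continuous (scaledKernel φ v b' x) := fun x =>
    (hφ.continuous_scaledKernel v b').comp (by fun_prop : Continuous fun y : E => (x, y))
  obtain ⟨M, hM0, hM⟩ := exists_bound_of_hasCompactSupport hφ.contDiff.continuous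
    hφ.hasCompactSupport
  have hkb : ∀ x y, ‖scaledKernel φ v b' x y‖ ≤ (b' ^ n)⁻¹ * M := fun x y => by
    rw [scaledKernel, norm_mul, Real.norm_of_nonneg (by positivity)]
    gcongr
    exact hM _
  refine ⟨htf.toFinset.image (scaledKernel φ v b'),
    4 * V * (htf.toFinset.image (scaledKernel φ v b')).card, by positivity, ?_, ?_⟩
  · intro k hk
    obtain ⟨x, -, rfl⟩ := Finset.mem_image.1 hk
    exact MemLp.of_bound (hkc x).aestronglyMeasurable _ (ae_of_all _ (hkb x))
  intro w G h
  set S := htf.toFinset.image (scaledKernel φ v b') with hS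
  have hw : Integrable w (volume.restrict Ω) := h.memLp.integrable (by norm_num)
  set I := ∫ x in Ω, |w x|
  set J := ∫ x in Ω, w x ^ 2
  set Q := ∫ x in Ω, ‖G x‖ ^ 2
  have hQ0 : 0 ≤ Q := integral_nonneg fun x => sq_nonneg _
  have hJ0 : 0 ≤ J := integral_nonneg fun x => sq_nonneg _
  have hI0 : 0 ≤ I := integral_nonneg fun x => abs_nonneg _
  have hIJ : I ^ 2 ≤ V * J := sq_integral_abs_le h.memLp
  set Λ := ∑ k ∈ S, |∫ x in Ω, k x * w x| with hΛ
  have hΛ0 : 0 ≤ Λ := Finset.sum_nonneg fun _ _ => abs_nonneg _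
  have hΛsq : Λ ^ 2 ≤ S.card * ∑ k ∈ S, (∫ x in Ω, k x * w x) ^ 2 := by
    refine sq_sum_le_card_mul_sum_sq.trans_eq ?_
    simp only [sq_abs]
  have hTi : ∀ x, IntegrableOn (fun y => scaledKernel φ v b' x y * w y) Ω := fun x =>
    hw.bdd_mul (c := (b' ^ n)⁻¹ * M) (hkc x).aestronglyMeasurable (ae_of_all _ (hkb x))
  have hT : ∀ x ∈ ball p r, |∫ y in Ω, scaledKernel φ v b' x y * w y| ≤ η * I + Λ := by
    intro x hx
    obtain ⟨x', hx't, hxx'⟩ := Set.mem_iUnion₂.1 (ht (ball_subset_closedBall hx))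
    have h1 : |∫ y in Ω, scaledKernel φ v b' x' y * w y| ≤ Λ := by
      refine Finset.single_le_sum (f := fun k : E → ℝ => |∫ y in Ω, k y * w y|)
        (fun _ _ => abs_nonneg _) (Finset.mem_image_of_mem _ (htf.mem_toFinset.2 hx't))
    have h2 : |(∫ y in Ω, scaledKernel φ v b' x y * w y) -
        ∫ y in Ω, scaledKernel φ v b' x' y * w y| ≤ η * I := by
      rw [← integral_sub (hTi x) (hTi x'), ← integral_const_mul]
      rw [← Real.norm_eq_abs]
      refine norm_integral_le_of_norm_le (hw.abs.const_mul η) (ae_of_all _ fun y => ?_)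
      rw [← sub_mul, norm_mul]
      exact mul_le_mul_of_nonneg_right (hδ x x' hxx' y) (abs_nonneg _)
    have h3 := abs_sub_abs_le_abs_sub (∫ y in Ω, scaledKernel φ v b' x y * w y)
      (∫ y in Ω, scaledKernel φ v b' x' y * w y)
    linarith
  have hAm : MeasurableSet (ball p r ∩ Ω) := measurableSet_ball.inter hΩm
  have hest := h.lintegral_average_sub_sq_le hΩm hΩ hφ hc Set.inter_subset_right hAm hb0
    (fun x hx s hs => hball x hx s ⟨hs.1, hs.2.trans hbb⟩)
  have hwA : MemLp w 2 (volume.restrict (ball p r ∩ Ω)) :=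
    h.memLp.mono_measure (Measure.restrict_mono Set.inter_subset_right le_rfl)
  have e2 : ∀ a : ℝ, ‖a‖ₑ ^ 2 = ENNReal.ofReal (a ^ 2) := fun a => by
    rw [Real.enorm_eq_ofReal_abs, ← ENNReal.ofReal_pow (abs_nonneg _), sq_abs]
  -- Pointwise `w² ≤ 2 (T - w)² + 2 T²` for the average `T`. The first term is the Schur estimate,
  -- the second is at most `(η * I + Λ) ^ 2` by the net.
  have main : ∫ x in ball p r ∩ Ω, w x ^ 2 ≤
      2 * (((‖v‖ + c) * b') ^ 2 * Q) + 2 * (η * I + Λ) ^ 2 * V := by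
    rw [← ENNReal.ofReal_le_ofReal_iff (by positivity)]
    have e1 := ofReal_integral_norm_sq hwA
    simp only [Real.norm_eq_abs, sq_abs] at e1
    rw [e1]
    calc ∫⁻ x in ball p r ∩ Ω, ‖w x‖ₑ ^ 2
        ≤ ∫⁻ x in ball p r ∩ Ω, (2 * ‖(∫ y in Ω, scaledKernel φ v b' x y * w y) - w x‖ₑ ^ 2 +
            ENNReal.ofReal (2 * (η * I + Λ) ^ 2)) := by
          refine setLIntegral_mono' hAm fun x hx => ?_
          rw [e2, e2, show (2 : ENNReal) = ENNReal.ofReal 2 by simp,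
            ← ENNReal.ofReal_mul (by norm_num), ← ENNReal.ofReal_add (by positivity)
              (by positivity)]
          refine ENNReal.ofReal_le_ofReal ?_
          have h1 := sq_le_sq' (abs_le.1 (hT x hx.1)).1 (abs_le.1 (hT x hx.1)).2
          set T := ∫ y in Ω, scaledKernel φ v b' x y * w y
          nlinarith [sq_nonneg (T - w x + T)]
      _ ≤ ENNReal.ofReal (2 * (((‖v‖ + c) * b') ^ 2 * Q)) +
          ENNReal.ofReal (2 * (η * I + Λ) ^ 2) * volume (ball p r ∩ Ω) := by
          rw [lintegral_add_right _ measurable_const, setLIntegral_const,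
            lintegral_const_mul' _ _ (by norm_num)]
          gcongr
          rw [ENNReal.ofReal_mul (by norm_num), ENNReal.ofReal_mul (by positivity),
            ENNReal.ofReal_pow (by positivity), ofReal_integral_norm_sq h.memLp_grad]
          simpa using mul_le_mul_right hest 2
      _ ≤ _ := by
          rw [ENNReal.ofReal_add (by positivity) (by positivity)]
          gcongr
          rw [ENNReal.ofReal_mul (q := V) (by positivity)]
          gcongr
          rw [hV, measureReal_restrict_apply_univ, ofReal_measureReal hΩ]
          exact measure_mono Set.inter_subset_right
  have h4 : (η * I + Λ) ^ 2 ≤ 2 * (η ^ 2 * (V * J)) + 2 * Λ ^ 2 := by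
    nlinarith [sq_nonneg (η * I - Λ), mul_le_mul_of_nonneg_left hIJ (sq_nonneg η)]
  calc _ ≤ _ := main
    _ ≤ 2 * (((‖v‖ + c) * b') ^ 2 * Q) +
        2 * (2 * (η ^ 2 * (V * J)) +
          2 * (S.card * ∑ k ∈ S, (∫ x in Ω, k x * w x) ^ 2)) * V := by
        gcongr
        linarith
    _ = (2 * ((‖v‖ + c) * b') ^ 2) * Q + (4 * V ^ 2 * η ^ 2) * J +
        4 * V * S.card * ∑ k ∈ S, (∫ x in Ω, k x * w x) ^ 2 := by ring
    _ ≤ ε * Q + ε * J + 4 * V * S.card * ∑ k ∈ S, (∫ x in Ω, k x * w x) ^ 2 := by gcongr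
    _ = _ := by ring

theorem IsRellichSet.union {Ω A B : Set E} (hA : IsRellichSet Ω A) (hB : IsRellichSet Ω B) :
    IsRellichSet Ω (A ∪ B) := by
  classical
  intro ε hε
  obtain ⟨S, C, hC, hS, h1⟩ := hA (ε / 2) (by positivity)
  obtain ⟨S', C', hC', hS', h2⟩ := hB (ε / 2) (by positivity)
  refine ⟨S ∪ S', C + C', by positivity, fun k hk => ?_, fun w G h => ?_⟩
  · exact (Finset.mem_union.1 hk).elim (hS k) (hS' k)
  · have hle : ∫ x in (A ∪ B) ∩ Ω, w x ^ 2 ≤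
        (∫ x in A ∩ Ω, w x ^ 2) + ∫ x in B ∩ Ω, w x ^ 2 := by
      have hi := h.memLp.integrable_sq
      have hiA := hi.mono_measure (Measure.restrict_mono (Set.inter_subset_right (s := A)) le_rfl)
      have hiB := hi.mono_measure (Measure.restrict_mono (Set.inter_subset_right (s := B)) le_rfl)
      rw [← integral_add_measure hiA hiB, Set.union_inter_distrib_right]
      exact integral_mono_measure (Measure.restrict_union_le _ _)
        (ae_of_all _ fun x => sq_nonneg _) (hiA.add_measure hiB)
    have hs1 : ∑ k ∈ S, (∫ x in Ω, k x * w x) ^ 2 ≤ ∑ k ∈ S ∪ S', (∫ x in Ω, k x * w x) ^ 2 :=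
      Finset.sum_le_sum_of_subset_of_nonneg Finset.subset_union_left fun _ _ _ => sq_nonneg _
    have hs2 : ∑ k ∈ S', (∫ x in Ω, k x * w x) ^ 2 ≤ ∑ k ∈ S ∪ S', (∫ x in Ω, k x * w x) ^ 2 :=
      Finset.sum_le_sum_of_subset_of_nonneg Finset.subset_union_right fun _ _ _ => sq_nonneg _
    have := h1 w G h
    have := h2 w G h
    have := mul_le_mul_of_nonneg_left hs1 hC
    have := mul_le_mul_of_nonneg_left hs2 hC'
    linarith

/-- A uniform interior cone condition, locally near each point of the closure. -/
def HasInteriorCones (Ω : Set E) : Prop :=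
  ∀ p ∈ closure Ω, ∃ (v : E) (c b r : ℝ), 0 < c ∧ 0 < b ∧ 0 < r ∧
    ∀ x ∈ ball p r ∩ Ω, ∀ s ∈ Set.Ioc 0 b, closedBall (x + s • v) (s * c) ⊆ Ω

/-- The closure of `Ω` is compact and the property passes to subsets and finite unions, so the balls
provided by the cone condition suffice. -/
theorem HasInteriorCones.isRellichSet {Ω : Set E} (h : HasInteriorCones Ω)
    (hΩm : MeasurableSet Ω) (hb : Bornology.IsBounded Ω) :
    IsRellichSet Ω Ω := by
  have hmono : ∀ ⦃s t : Set E⦄, s ⊆ t → IsRellichSet Ω t → IsRellichSet Ω s := by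
    intro s t hst ht ε hε
    obtain ⟨S, C, hC, hS, h1⟩ := ht ε hε
    refine ⟨S, C, hC, hS, fun w G hw => le_trans ?_ (h1 w G hw)⟩
    refine setIntegral_mono_set ?_ (ae_of_all _ fun x => sq_nonneg _)
      (Set.inter_subset_inter_left Ω hst).eventuallyLE
    exact hw.memLp.integrable_sq.mono_measure
      (Measure.restrict_mono Set.inter_subset_right le_rfl)
  refine hmono subset_closure ?_
  have hcpt : IsCompact (closure Ω) := hb.isCompact_closure
  refine hcpt.induction_on ?_ hmono (fun s t hs ht => hs.union ht) fun p hp => ?_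
  · intro ε hε
    refine ⟨∅, 0, le_rfl, by simp, fun w G hw => ?_⟩
    simp only [Set.empty_inter, Measure.restrict_empty, integral_zero_measure, Finset.sum_empty,
      mul_zero, add_zero]
    exact mul_nonneg hε.le (add_nonneg (integral_nonneg fun x => sq_nonneg _)
      (integral_nonneg fun x => sq_nonneg _))
  · obtain ⟨v, c, b, r, hc, hb', hr, hball⟩ := h p hp
    exact ⟨ball p r, mem_nhdsWithin_of_mem_nhds (ball_mem_nhds p hr),
      isRellichSet_ball hΩm hb.measure_lt_top.ne hc hb' hball⟩

end Rellich

/-! ### Compact operators on Hilbert spaces: coercivity and existence of eigenvectors -/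

section HilbertSpace

variable {V H K : Type*} [NormedAddCommGroup V] [InnerProductSpace ℝ V] [CompleteSpace V]
  [NormedAddCommGroup H] [InnerProductSpace ℝ H] [CompleteSpace H]
  [NormedAddCommGroup K] [InnerProductSpace ℝ K] [CompleteSpace K]

omit [CompleteSpace V] in
-- Composing `P` with the projection onto the span of `S` gives a finite rank operator within `ε` of
-- `P`, and compact operators form a closed set.
theorem isCompactOperator_of_small_on_finite_codim (P : V →L[ℝ] H)
    (h : ∀ ε : ℝ, 0 < ε → ∃ S : Set V, S.Finite ∧
      ∀ x, (∀ f ∈ S, ⟪f, x⟫ = 0) → ‖P x‖ ≤ ε * ‖x‖) :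
    IsCompactOperator P := by
  have hcl : IsClosed {f : V →L[ℝ] H | IsCompactOperator f} := isClosed_setOfPred_isCompactOperator
  suffices P ∈ closure {f : V →L[ℝ] H | IsCompactOperator f} by rwa [hcl.closure_eq] at this
  rw [Metric.mem_closure_iff]
  intro ε hε
  obtain ⟨S, hS, hSx⟩ := h (ε / 2) (by positivity)
  set L := Submodule.span ℝ S with hL
  have : FiniteDimensional ℝ L := FiniteDimensional.span_of_finite ℝ hS
  refine ⟨P ∘L L.subtypeL ∘L L.orthogonalProjectionOnto, ?_, ?_⟩
  · exact (isCompactOperator_of_locallyCompactSpace_dom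
      (L.orthogonalProjectionOnto : V →L[ℝ] L)).clm_comp (P ∘L L.subtypeL)
  · rw [dist_eq_norm]
    refine lt_of_le_of_lt (ContinuousLinearMap.opNorm_le_bound _ (by positivity)
      (fun x => ?_) : _ ≤ ε / 2) (by linarith)
    have e : (P - P ∘L L.subtypeL ∘L L.orthogonalProjectionOnto) x =
        P (x - L.orthogonalProjectionOnto x) := by
      simp
    rw [e]
    have hmem : x - L.orthogonalProjectionOnto x ∈ Lᗮ := by
      exact Submodule.sub_starProjection_mem_orthogonal (K := L) x
    refine (hSx _ fun f hf => (Submodule.mem_orthogonal _ _).1 hmem f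
      (Submodule.subset_span hf)).trans ?_
    gcongr
    have hp := L.norm_sq_eq_add_norm_sq_projection x
    have e2 : x - L.orthogonalProjectionOnto x = Lᗮ.starProjection x := by
      rw [Submodule.starProjection_orthogonal_val]; rfl
    rw [e2]
    exact Submodule.norm_starProjection_apply_le _ _

/-- The pair of bounded operators `(P, D)` is an isometric embedding of `V` in `H × K`. -/
def IsGraphPair (P : V →L[ℝ] H) (D : V →L[ℝ] K) : Prop :=
  ∀ x y : V, ⟪x, y⟫ = ⟪P x, P y⟫ + ⟪D x, D y⟫

open ContinuousLinearMap in
-- The graph norm identity reads `P* P - 1 = -D* D`. If `1` were an eigenvalue of the compact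
-- operator `P* P`, then `D` would vanish on an eigenvector. Since it is not, the Fredholm
-- alternative bounds `x` by `D* D x`.
theorem IsGraphPair.exists_norm_le {P : V →L[ℝ] H} {D : V →L[ℝ] K} (h : IsGraphPair P D)
    (hP : IsCompactOperator P) (hD : ∀ x, D x = 0 → x = 0) :
    ∃ C : ℝ, 0 ≤ C ∧ ∀ x, ‖x‖ ≤ C * ‖D x‖ := by
  set B : V →L[ℝ] V := adjoint P ∘L P with hB
  have hBc : IsCompactOperator B := hP.clm_comp (adjoint P)
  have hBD : ∀ x, B x - x = -adjoint D (D x) := fun x => by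
    refine ext_inner_right ℝ fun y => ?_
    rw [inner_sub_left, inner_neg_left, hB, comp_apply, adjoint_inner_left, adjoint_inner_left,
      h x y]
    ring
  obtain ⟨C, hC⟩ := hBc.antilipschitz_of_not_hasEigenvalue (μ := (1 : ℝ)) one_ne_zero (by
    intro hev
    obtain ⟨x, hx⟩ := hev.exists_hasEigenvector
    refine hx.2 (hD x ?_)
    have h1 : B x = x := by simpa using hx.apply_eq_smul
    have h2 := hBD x
    rw [h1, sub_self, eq_comm, neg_eq_zero] at h2
    rw [← inner_self_eq_zero (𝕜 := ℝ), ← adjoint_inner_left, h2, inner_zero_left])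
  refine ⟨C * ‖adjoint D‖, by positivity, fun x => ?_⟩
  have h1 := hC.le_mul_dist x 0
  simp only [dist_zero_right, map_zero] at h1
  have h2 : (B - (1 : ℝ) • (1 : V →L[ℝ] V)) x = -adjoint D (D x) := by
    rw [← hBD]; simp
  rw [h2, norm_neg] at h1
  calc ‖x‖ ≤ C * ‖adjoint D (D x)‖ := h1
    _ ≤ C * (‖adjoint D‖ * ‖D x‖) := by gcongr; exact le_opNorm _ _
    _ = _ := by ring

theorem le_rank_of_linearIndependent {W : Type*} [AddCommGroup W] [Module ℝ W]
    (L : Submodule ℝ W) {m : ℕ} {v : Fin m → W} (hv : LinearIndependent ℝ v)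
    (hL : ∀ i, v i ∈ L) : (m : Cardinal) ≤ Module.rank ℝ L := by
  have hli : LinearIndependent ℝ (fun i => (⟨v i, hL i⟩ : L)) :=
    LinearIndependent.of_comp L.subtype hv
  exact Module.le_rank_iff.2 ⟨_, hli⟩

theorem exists_le_rank_of_le_rank_iSup {W : Type*} [AddCommGroup W] [Module ℝ W]
    {M : ℝ → Submodule ℝ W} (hM : Monotone M) {m : ℕ}
    (h : (m : Cardinal) ≤ Module.rank ℝ (⨆ t, M t : Submodule ℝ W)) :
    ∃ t, (m : Cardinal) ≤ Module.rank ℝ (M t) := by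
  obtain ⟨w, hw⟩ := Module.le_rank_iff.1 h
  have hex : ∀ i, ∃ t, (w i : W) ∈ M t := fun i =>
    (Submodule.mem_iSup_of_directed M hM.directed_le).1 (w i).2
  choose τ hτ using hex
  obtain ⟨t, ht⟩ := (Set.finite_range τ).bddAbove
  exact ⟨t, le_rank_of_linearIndependent (M t)
    (hw.map' (⨆ t, M t : Submodule ℝ W).subtype (Submodule.ker_subtype _))
    fun i => hM (ht ⟨i, rfl⟩) (hτ i)⟩

omit [CompleteSpace K] in
open ContinuousLinearMap Module.End in
-- An eigenvector of `P* P` for `β ≠ 0` solves the weak equation with value `1 / β - 1`, and for `β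
-- = 0` it is killed by `P`.
theorem IsGraphPair.map_eigenspace_le {P : V →L[ℝ] H} {D : V →L[ℝ] K} (h : IsGraphPair P D)
    {N : ℝ → Submodule ℝ H}
    (hN : ∀ x ν, (∀ y, ⟪D x, D y⟫ = ν * ⟪P x, P y⟫) → P x ∈ N ν) {β : ℝ} {x : V}
    (hx : (adjoint P ∘L P) x = β • x) : P x ∈ ⨆ t : ℝ, ⨆ ν ∈ Set.Iic t, N ν := by
  have hBi : ∀ y, β * ⟪x, y⟫ = ⟪P x, P y⟫ := fun y => by
    rw [← real_inner_smul_left, ← hx, comp_apply, adjoint_inner_left]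
  rcases eq_or_ne β 0 with rfl | hβ
  · have : ⟪P x, P x⟫ = 0 := by rw [← hBi, zero_mul]
    rw [inner_self_eq_zero.1 this]
    exact Submodule.zero_mem _
  · refine Submodule.mem_iSup_of_mem (1 / β - 1) ?_
    refine Submodule.mem_iSup_of_mem (1 / β - 1)
      (Submodule.mem_iSup_of_mem (Set.mem_Iic.2 le_rfl) (hN x _ fun y => ?_))
    have h1 := hBi y
    rw [h x y] at h1
    field_simp
    linarith

open ContinuousLinearMap Module.End in
-- The eigenvectors of the compact symmetric operator `P* P` span a dense subspace, and the preimage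
-- of `L` is closed.
theorem forall_mem_of_eigenvectors_mem {P : V →L[ℝ] H} (hP : IsCompactOperator P)
    {L : Submodule ℝ H} (hL : IsClosed (L : Set H))
    (hE : ∀ (β : ℝ) (x : V), (adjoint P ∘L P) x = β • x → P x ∈ L) (x : V) : P x ∈ L := by
  have hBc : IsCompactOperator (adjoint P ∘L P : V →L[ℝ] V) := hP.clm_comp (adjoint P)
  have hBs : ((adjoint P ∘L P : V →L[ℝ] V) : V →ₗ[ℝ] V).IsSymmetric := fun x y => by
    rw [coe_coe, comp_apply, comp_apply, adjoint_inner_left, adjoint_inner_right]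
  have hdense := orthogonalComplement_iSup_eigenspaces_eq_bot hBc hBs
  have hsub : (⨆ β, eigenspace ((adjoint P ∘L P : V →L[ℝ] V) : V →ₗ[ℝ] V) β) ≤
      L.comap (P : V →ₗ[ℝ] H) :=
    iSup_le fun β x hx => hE β x (mem_eigenspace_iff.1 hx)
  have hle := Submodule.topologicalClosure_minimal _ hsub (hL.preimage P.continuous)
  rw [Submodule.topologicalClosure_eq_top_iff.2 hdense] at hle
  exact hle (Submodule.mem_top (x := x))

omit [CompleteSpace K] in
-- If all eigenspaces together had rank less than `m`, their sum would be finite dimensional, hence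
-- closed, hence would contain the whole range of `P` and with it `m` independent vectors. That a
-- single threshold `t` suffices follows since `m` vectors lie in one member of an increasing
-- family.
theorem IsGraphPair.exists_le_rank_iSup {P : V →L[ℝ] H} {D : V →L[ℝ] K} (h : IsGraphPair P D)
    (hP : IsCompactOperator P) (N : ℝ → Submodule ℝ H)
    (hN : ∀ x ν, (∀ y, ⟪D x, D y⟫ = ν * ⟪P x, P y⟫) → P x ∈ N ν) {m : ℕ} {v : Fin m → V}
    (hv : LinearIndependent ℝ (fun i => P (v i))) :
    ∃ t : ℝ, (m : Cardinal) ≤ Module.rank ℝ (⨆ ν ∈ Set.Iic t, N ν : Submodule ℝ H) := by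
  refine exists_le_rank_of_le_rank_iSup (M := fun t : ℝ => ⨆ ν ∈ Set.Iic t, N ν)
    (fun s t hst => biSup_mono fun ν hν => (show ν ≤ t from (show ν ≤ s from hν).trans hst)) ?_
  have hE := fun (β : ℝ) (x : V) => h.map_eigenspace_le hN (β := β) (x := x)
  generalize (⨆ t : ℝ, ⨆ ν ∈ Set.Iic t, N ν : Submodule ℝ H) = L at hE ⊢
  by_contra hlt
  rw [not_le] at hlt
  have hfin : FiniteDimensional ℝ L :=
    Module.rank_lt_aleph0_iff.1 (hlt.trans Cardinal.natCast_lt_aleph0)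
  refine absurd (le_rank_of_linearIndependent L hv fun i => ?_) (not_le.2 hlt)
  exact forall_mem_of_eigenvectors_mem hP (Submodule.closed_of_finiteDimensional L) hE (v i)

end HilbertSpace

/-! ### Pairs of an L² function and an L² field -/

section PairSpace

variable {α F : Type*} [MeasurableSpace α] [NormedAddCommGroup F] [InnerProductSpace ℝ F]
  {μ : Measure α}

/-- Pairs of an `L²` function and an `L²` field. -/
abbrev L2Pair (F : Type*) [NormedAddCommGroup F] (μ : Measure α) : Type _ :=
  WithLp 2 (Lp ℝ 2 μ × Lp F 2 μ)

/-- The function component on a closed space of pairs. -/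
noncomputable def pairFst (V : Submodule ℝ (L2Pair F μ)) : V →L[ℝ] Lp ℝ 2 μ :=
  (WithLp.fstL 2 ℝ (Lp ℝ 2 μ) (Lp F 2 μ)) ∘L V.subtypeL

/-- The field component on a closed space of pairs. -/
noncomputable def pairSnd (V : Submodule ℝ (L2Pair F μ)) : V →L[ℝ] Lp F 2 μ :=
  (WithLp.sndL 2 ℝ (Lp ℝ 2 μ) (Lp F 2 μ)) ∘L V.subtypeL

theorem isGraphPair_pairFst_pairSnd (V : Submodule ℝ (L2Pair F μ)) :
    IsGraphPair (pairFst V) (pairSnd V) := fun _ _ => WithLp.prod_inner_apply _ _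

theorem inner_toLp_toLp {f g : α → F} (hf : MemLp f 2 μ) (hg : MemLp g 2 μ) :
    ⟪hf.toLp f, hg.toLp g⟫ = ∫ x, ⟪f x, g x⟫ ∂μ := by
  rw [L2.inner_def]
  refine integral_congr_ae ?_
  filter_upwards [hf.coeFn_toLp, hg.coeFn_toLp] with x h1 h2
  rw [h1, h2]

theorem norm_sq_toLp {f : α → F} (hf : MemLp f 2 μ) :
    ‖hf.toLp f‖ ^ 2 = ∫ x, ‖f x‖ ^ 2 ∂μ := by
  rw [← real_inner_self_eq_norm_sq, inner_toLp_toLp]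
  simp only [real_inner_self_eq_norm_sq]

theorem norm_sq_Lp (f : Lp F 2 μ) : ‖f‖ ^ 2 = ∫ x, ‖f x‖ ^ 2 ∂μ := by
  rw [← real_inner_self_eq_norm_sq, L2.inner_def]
  simp only [real_inner_self_eq_norm_sq]

/-- A pair of an `L²` function and an `L²` field, from representatives. -/
noncomputable def mkPair {u : α → ℝ} {G : α → F} (hu : MemLp u 2 μ) (hG : MemLp G 2 μ) :
    L2Pair F μ :=
  WithLp.toLp 2 (hu.toLp u, hG.toLp G)

theorem inner_mkPair {u a : α → ℝ} {G X : α → F} (hu : MemLp u 2 μ) (hG : MemLp G 2 μ)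
    (ha : MemLp a 2 μ) (hX : MemLp X 2 μ) :
    ⟪mkPair ha hX, mkPair hu hG⟫ = (∫ x, u x * a x ∂μ) + ∫ x, ⟪G x, X x⟫ ∂μ := by
  rw [mkPair, mkPair, WithLp.prod_inner_apply]
  simp only
  rw [inner_toLp_toLp, inner_toLp_toLp]
  simp only [real_inner_comm, RCLike.inner_apply, conj_trivial]

omit [InnerProductSpace ℝ F] in
theorem mkPair_coe (x : L2Pair F μ) : mkPair (Lp.memLp x.fst) (Lp.memLp x.snd) = x := by
  rw [mkPair, Lp.toLp_coeFn, Lp.toLp_coeFn]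
  rfl

/-- Orthogonality of the function component to `k` is orthogonality of the pair to the image of `k`
under the adjoint, so conditions in `L²` become conditions in `V`. -/
theorem isCompactOperator_pairFst [CompleteSpace F] (V : Submodule ℝ (L2Pair F μ)) [CompleteSpace V]
    (h : ∀ ε : ℝ, 0 < ε → ∃ S : Set (Lp ℝ 2 μ), S.Finite ∧
      ∀ x ∈ V, (∀ k ∈ S, ⟪k, x.fst⟫ = 0) → ‖x.fst‖ ≤ ε * ‖x‖) :
    IsCompactOperator (pairFst V) := by
  refine isCompactOperator_of_small_on_finite_codim _ fun ε hε => ?_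
  obtain ⟨S, hS, hx⟩ := h ε hε
  refine ⟨ContinuousLinearMap.adjoint (pairFst V) '' S, hS.image _, fun x h0 => hx x x.2 ?_⟩
  intro k hk
  have := h0 _ (Set.mem_image_of_mem _ hk)
  rwa [ContinuousLinearMap.adjoint_inner_left] at this

theorem mem_orthogonal_span_iff {W : Type*} [NormedAddCommGroup W] [InnerProductSpace ℝ W]
    {T : Set W} {x : W} : x ∈ (Submodule.span ℝ T)ᗮ ↔ ∀ t ∈ T, ⟪t, x⟫ = 0 := by
  refine ⟨fun h t ht => (Submodule.mem_orthogonal _ _).1 h t (Submodule.subset_span ht), fun h => ?_⟩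
  have : Submodule.span ℝ T ≤ (Submodule.span ℝ {x})ᗮ := Submodule.span_le.2 fun t ht =>
    Submodule.mem_orthogonal_singleton_iff_inner_left.2 (h t ht)
  exact (Submodule.mem_orthogonal _ _).2 fun u hu =>
    Submodule.mem_orthogonal_singleton_iff_inner_left.1 (this hu)

end PairSpace

/-! ### The Poincaré inequality on a connected Euclidean domain -/

section Poincare

variable {E : Type*} [NormedAddCommGroup E] [InnerProductSpace ℝ E]
  [FiniteDimensional ℝ E] [MeasurableSpace E] [BorelSpace E]

/-- Without gradient a function equals its averages at every scale. The drift `R⁻¹ • (p - x)` moves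
the kernel of scale `R` to the centre `p`, so the same average serves all `x` in the ball. -/
theorem HasEuclideanWeakGradient.ae_eq_const_ball {Ω : Set E} {w : E → ℝ}
    (h : HasEuclideanWeakGradient Ω w 0) (hΩm : MeasurableSet Ω) (hΩ : volume Ω ≠ ⊤)
    {p : E} {R : ℝ} (hR : 0 < R) (hp : closedBall p (2 * R) ⊆ Ω) :
    ∃ c : ℝ, ∀ᵐ x, x ∈ ball p R → w x = c := by
  obtain ⟨φ, hφ⟩ := exists_isAveragingProfile (E := E) one_pos
  refine ⟨∫ y in Ω, (R ^ Module.finrank ℝ E)⁻¹ * φ (R⁻¹ • (y - p)) * w y, ?_⟩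
  filter_upwards [h.ae_enorm_average_sub_le hΩm hΩ] with x hx hxp
  have hxp' : ‖p - x‖ < R := by rwa [← dist_eq_norm, dist_comm]
  have hxΩ : x ∈ Ω := hp (ball_subset_closedBall.trans
    (closedBall_subset_closedBall (by linarith)) hxp)
  have := hx hxΩ φ 1 (R⁻¹ • (p - x)) R hφ one_pos hR (fun s hs => by
    refine (closedBall_subset_closedBall' ?_).trans hp
    have e : x + s • R⁻¹ • (p - x) - p = (1 - s * R⁻¹) • (x - p) := by
      module
    have h1 : s * R⁻¹ ≤ 1 := by
      rw [← div_eq_mul_inv, div_le_one hR]; exact hs.2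
    have h0 : 0 ≤ s * R⁻¹ := mul_nonneg hs.1.le (by positivity)
    rw [dist_eq_norm, e, norm_smul, Real.norm_of_nonneg (by linarith), norm_sub_rev]
    have h2 := hs.2
    nlinarith [norm_nonneg (p - x)])
  simp only [Pi.zero_apply, enorm_zero, mul_zero, lintegral_zero, nonpos_iff_eq_zero,
    enorm_eq_zero] at this
  rw [sub_eq_zero] at this
  rw [← this]
  congr 1
  ext y
  rw [scaledKernel, ← smul_sub, sub_sub_sub_cancel_right]

theorem HasEuclideanWeakGradient.ae_eq_const {Ω : Set E} {w : E → ℝ}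
    (h : HasEuclideanWeakGradient Ω w 0) (hΩo : IsOpen Ω) (hΩ : volume Ω ≠ ⊤)
    (hconn : IsConnected Ω) : ∃ c : ℝ, ∀ᵐ x, x ∈ Ω → w x = c := by
  have hloc : ∀ p ∈ Ω, ∃ R > 0, ball p R ⊆ Ω ∧ ∃ c : ℝ, ∀ᵐ x, x ∈ ball p R → w x = c := by
    intro p hp
    obtain ⟨r, hr, hball⟩ := Metric.nhds_basis_closedBall.mem_iff.1 (hΩo.mem_nhds hp)
    refine ⟨r / 2, by positivity, ?_, h.ae_eq_const_ball hΩo.measurableSet hΩ (by positivity) ?_⟩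
    · exact ball_subset_closedBall.trans ((closedBall_subset_closedBall (by linarith)).trans hball)
    · rwa [mul_div_cancel₀ _ two_ne_zero]
  obtain ⟨p₀, hp₀⟩ := hconn.nonempty
  obtain ⟨R₀, hR₀, hb₀, c, hc⟩ := hloc p₀ hp₀
  refine ⟨c, ?_⟩
  set U : Set E := {p | ∃ r > 0, ∀ᵐ x, x ∈ ball p r → w x = c} with hU
  have hUo : IsOpen U := by
    rw [Metric.isOpen_iff]
    rintro p ⟨r, hr, hpr⟩
    refine ⟨r / 2, by positivity, fun q hq => ⟨r / 2, by positivity, ?_⟩⟩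
    filter_upwards [hpr] with x hx hxq
    refine hx (ball_subset_ball' ?_ hxq)
    linarith [mem_ball.1 hq]
  have hsub : Ω ⊆ U := by
    -- Near a limit point of `U` in `Ω` the function is constant on a ball which overlaps, in
    -- positive measure, a ball where the constant is `c`; so the two constants agree and `U` is
    -- closed relative to `Ω`.
    refine hconn.isPreconnected.subset_of_closure_inter_subset hUo
      ⟨p₀, hp₀, R₀, hR₀, hc⟩ ?_
    rintro q ⟨hqU, hqΩ⟩
    obtain ⟨R, hR, -, c', hc'⟩ := hloc q hqΩ
    obtain ⟨p, ⟨r, hr, hpr⟩, hpq⟩ := Metric.mem_closure_iff.1 hqU R hR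
    have hne : (ball p r ∩ ball q R).Nonempty :=
      ⟨p, mem_ball_self hr, by rwa [mem_ball, dist_comm]⟩
    have hpos : volume (ball p r ∩ ball q R) ≠ 0 :=
      ((isOpen_ball.inter isOpen_ball).measure_pos volume hne).ne'
    obtain ⟨x, hx, h1, h2⟩ : ∃ x ∈ ball p r ∩ ball q R, (x ∈ ball p r → w x = c) ∧
        (x ∈ ball q R → w x = c') := by
      by_contra! hcon
      refine hpos (measure_mono_null (fun x hx => ?_) (hpr.and hc'))
      rintro ⟨h1, h2⟩
      exact (hcon x hx h1).2 (h2 ((hcon x hx h1).1))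
    have hcc : c' = c := (h2 hx.2).symm.trans (h1 hx.1)
    exact ⟨R, hR, hcc ▸ hc'⟩
  have hnull : volume {x | x ∈ Ω ∧ w x ≠ c} = 0 := by
    refine measure_null_of_locally_null _ fun p hp => ?_
    obtain ⟨r, hr, hpr⟩ := hsub hp.1
    refine ⟨ball p r ∩ {x | w x ≠ c}, ?_, ?_⟩
    · exact inter_mem (mem_nhdsWithin_of_mem_nhds (ball_mem_nhds p hr))
        (mem_of_superset self_mem_nhdsWithin fun x hx => hx.2)
    · refine measure_mono_null (fun x hx => ?_) hpr
      exact fun hcon => hx.2 (hcon hx.1)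
  rw [ae_iff]
  refine measure_mono_null (fun x hx => ?_) hnull
  simpa using hx

/-- The test pairs that characterise functions of mean zero with their weak gradients. -/
def euclideanTestPairs (Ω : Set E) : Set (L2Pair E (volume.restrict Ω)) :=
  {t | ∃ (X : E → E) (ha : MemLp (euclideanDiv X) 2 (volume.restrict Ω))
      (hX : MemLp X 2 (volume.restrict Ω)), ContDiff ℝ ∞ X ∧ HasCompactSupport X ∧
      tsupport X ⊆ Ω ∧ t = mkPair ha hX} ∪
  {t | ∃ (ha : MemLp (fun _ => (1 : ℝ)) 2 (volume.restrict Ω))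
      (hX : MemLp (0 : E → E) 2 (volume.restrict Ω)), t = mkPair ha hX}

omit [MeasurableSpace E] [BorelSpace E] in
theorem continuous_euclideanDiv {X : E → E} (hX : ContDiff ℝ ∞ X) :
    Continuous (euclideanDiv X) := by
  have h1 : Continuous (fderiv ℝ X) := hX.continuous_fderiv (by simp)
  have h2 : Continuous (fun T : E →L[ℝ] E => LinearMap.trace ℝ E T.toLinearMap) :=
    LinearMap.continuous_of_finiteDimensional
      ((LinearMap.trace ℝ E) ∘ₗ ContinuousLinearMap.coeLM ℝ)
  exact h2.comp h1

omit [FiniteDimensional ℝ E] [MeasurableSpace E] [BorelSpace E] in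
theorem hasCompactSupport_euclideanDiv {X : E → E} (hX : HasCompactSupport X) :
    HasCompactSupport (euclideanDiv X) := by
  refine HasCompactSupport.intro' hX (isClosed_tsupport _) fun z hz => ?_
  have : fderiv ℝ X z = 0 := by
    by_contra h
    exact hz (support_fderiv_subset ℝ h)
  simp [euclideanDiv, this]

/-- Integration by parts and vanishing mean are orthogonality relations in the space of pairs.
Expressed this way the Sobolev space of mean zero functions is a closed subspace, hence complete. -/
theorem mkPair_mem_orthogonal_euclideanTestPairs_iff {Ω : Set E} (hΩ : volume Ω ≠ ⊤) {w : E → ℝ}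
    {G : E → E} (hw : MemLp w 2 (volume.restrict Ω)) (hG : MemLp G 2 (volume.restrict Ω)) :
    mkPair hw hG ∈ (Submodule.span ℝ (euclideanTestPairs Ω))ᗮ ↔
      HasEuclideanWeakGradient Ω w G ∧ ∫ x in Ω, w x = 0 := by
  have : IsFiniteMeasure (volume.restrict Ω) := ⟨by simpa using hΩ.lt_top⟩
  rw [mem_orthogonal_span_iff]
  constructor
  · refine fun h => ⟨⟨hw, hG, fun X hXc hXs hXΩ => ?_⟩, ?_⟩
    · have ha : MemLp (euclideanDiv X) 2 (volume.restrict Ω) :=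
        (continuous_euclideanDiv hXc).memLp_of_hasCompactSupport
          (hasCompactSupport_euclideanDiv hXs)
      have hX : MemLp X 2 (volume.restrict Ω) :=
        hXc.continuous.memLp_of_hasCompactSupport hXs
      have := h _ (Or.inl ⟨X, ha, hX, hXc, hXs, hXΩ, rfl⟩)
      rw [inner_mkPair] at this
      linarith
    · have := h _ (Or.inr ⟨memLp_const 1, MemLp.zero, rfl⟩)
      rw [inner_mkPair] at this
      simpa using this
  · rintro ⟨h, h0⟩ t (⟨X, ha, hX, hXc, hXs, hXΩ, rfl⟩ | ⟨ha, hX, rfl⟩)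
    · rw [inner_mkPair, h.integral_by_parts X hXc hXs hXΩ]
      ring
    · rw [inner_mkPair]
      simpa using h0

theorem IsRellichSet.exists_finset {Ω : Set E} (h : IsRellichSet Ω Ω) {ε : ℝ} (hε : 0 < ε) :
    ∃ S : Finset (E → ℝ), (∀ k ∈ S, MemLp k 2 (volume.restrict Ω)) ∧
      ∀ (w : E → ℝ) (G : E → E), HasEuclideanWeakGradient Ω w G →
        (∀ k ∈ S, ∫ x in Ω, k x * w x = 0) →
        ∫ x in Ω, w x ^ 2 ≤ ε * ((∫ x in Ω, w x ^ 2) + ∫ x in Ω, ‖G x‖ ^ 2) := by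
  obtain ⟨S, C, -, hS, h1⟩ := h ε hε
  refine ⟨S, hS, fun w G hw h0 => ?_⟩
  have := h1 w G hw
  rw [Finset.sum_eq_zero fun k hk => by rw [h0 k hk]; simp] at this
  simpa using this

theorem norm_sq_mkPair {α F : Type*} [MeasurableSpace α] [NormedAddCommGroup F]
    [InnerProductSpace ℝ F] {μ : Measure α} {u : α → ℝ} {G : α → F} (hu : MemLp u 2 μ)
    (hG : MemLp G 2 μ) :
    ‖mkPair hu hG‖ ^ 2 = (∫ x, u x ^ 2 ∂μ) + ∫ x, ‖G x‖ ^ 2 ∂μ := by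
  rw [← real_inner_self_eq_norm_sq, inner_mkPair]
  simp only [real_inner_self_eq_norm_sq, sq]

/-- `IsGraphPair.exists_norm_le` for the projections to function and gradient: the first is compact
by the Rellich property, and the second is injective because a mean zero function without gradient
vanishes on a connected set. -/
theorem HasInteriorCones.poincare {Ω : Set E} (h : HasInteriorCones Ω) (hΩo : IsOpen Ω)
    (hb : Bornology.IsBounded Ω) (hconn : IsConnected Ω) :
    ∃ C : ℝ, 0 ≤ C ∧ ∀ (w : E → ℝ) (G : E → E), HasEuclideanWeakGradient Ω w G →
      ∫ x in Ω, w x = 0 → ∫ x in Ω, w x ^ 2 ≤ C * ∫ x in Ω, ‖G x‖ ^ 2 := by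
  have hΩ : volume Ω ≠ ⊤ := hb.measure_lt_top.ne
  set V := (Submodule.span ℝ (euclideanTestPairs Ω))ᗮ with hV
  have hR := h.isRellichSet hΩo.measurableSet hb
  have hVmem : ∀ x ∈ V, HasEuclideanWeakGradient Ω x.fst x.snd ∧ ∫ y in Ω, x.fst y = 0 := by
    intro x hx
    rwa [← mkPair_coe x, mkPair_mem_orthogonal_euclideanTestPairs_iff hΩ] at hx
  have hcomp : IsCompactOperator (pairFst V) := by
    refine isCompactOperator_pairFst V fun ε hε => ?_
    obtain ⟨S, hS, hSw⟩ := hR.exists_finset (ε := ε ^ 2) (by positivity)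
    refine ⟨Set.range fun k : S => (hS k k.2).toLp k.1, Set.finite_range _, fun x hx h0 => ?_⟩
    have hmem := hVmem x hx
    refine abs_le_of_sq_le_sq' ?_ (by positivity) |>.2
    have hn : ‖x‖ ^ 2 = (∫ y in Ω, x.fst y ^ 2) + ∫ y in Ω, ‖x.snd y‖ ^ 2 := by
      conv_lhs => rw [← mkPair_coe x]
      exact norm_sq_mkPair _ _
    rw [mul_pow, hn, norm_sq_Lp]
    simp only [Real.norm_eq_abs, sq_abs]
    refine hSw _ _ hmem.1 fun k hk => ?_
    have := h0 _ ⟨⟨k, hk⟩, rfl⟩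
    rw [L2.inner_def] at this
    rw [← this]
    refine integral_congr_ae ?_
    filter_upwards [(hS k hk).coeFn_toLp] with y hy
    simp [hy, mul_comm]
  obtain ⟨C, hC0, hC⟩ := (isGraphPair_pairFst_pairSnd V).exists_norm_le hcomp (by
    intro x hx
    obtain ⟨hw, hmean⟩ := hVmem x x.2
    have hx' : x.1.snd = 0 := hx
    have hw0 : HasEuclideanWeakGradient Ω x.1.fst 0 := by
      refine ⟨hw.memLp, MemLp.zero, fun X h1 h2 h3 => ?_⟩
      rw [hw.integral_by_parts X h1 h2 h3, hx']
      congr 1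
      refine integral_congr_ae ?_
      filter_upwards [Lp.coeFn_zero E 2 (volume.restrict Ω)] with y hy
      rw [hy]
    obtain ⟨c, hc⟩ := hw0.ae_eq_const hΩo hΩ hconn
    have hc' := (ae_restrict_iff' hΩo.measurableSet).2 hc
    rw [integral_congr_ae hc', setIntegral_const, smul_eq_mul, mul_eq_zero] at hmean
    have hc0 : c = 0 := hmean.resolve_left
      (ENNReal.toReal_pos (hΩo.measure_pos volume hconn.nonempty).ne' hΩ).ne'
    have hfst : x.1.fst = 0 := by
      refine Lp.ext ?_
      filter_upwards [hc', Lp.coeFn_zero ℝ 2 (volume.restrict Ω)] with y h1 h2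
      rw [h1, h2, hc0]; rfl
    refine Subtype.ext ?_
    exact (WithLp.ofLp_injective 2) (Prod.ext hfst hx'))
  refine ⟨C ^ 2, by positivity, fun w G hw hmean => ?_⟩
  have hmem : mkPair hw.memLp hw.memLp_grad ∈ V :=
    (mkPair_mem_orthogonal_euclideanTestPairs_iff hΩ _ _).2 ⟨hw, hmean⟩
  have h1 := pow_le_pow_left₀ (norm_nonneg _) (hC ⟨_, hmem⟩) 2
  have h2 : ‖pairSnd V ⟨_, hmem⟩‖ ^ 2 = ∫ x in Ω, ‖G x‖ ^ 2 := norm_sq_toLp hw.memLp_grad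
  rw [mul_pow, h2] at h1
  refine le_trans ?_ h1
  rw [Submodule.coe_norm, norm_sq_mkPair]
  exact le_add_of_nonneg_right (integral_nonneg fun x => sq_nonneg _)

end Poincare

/-! ### The divergence theorem on the sphere -/

section SphereDivergence

variable {E : Type*} [NormedAddCommGroup E] [InnerProductSpace ℝ E]
  [FiniteDimensional ℝ E] [MeasurableSpace E] [BorelSpace E]

theorem integral_euclideanDiv_eq_zero {X : E → E} (hX : ContDiff ℝ ∞ X)
    (hc : HasCompactSupport X) : ∫ x, euclideanDiv X x = 0 := by
  set b := stdOrthonormalBasis ℝ E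
  have hd : Differentiable ℝ X := hX.differentiable (by simp)
  have e : ∀ x, euclideanDiv X x = ∑ i, fderiv ℝ (fun y => ⟪b i, X y⟫) x (b i) := fun x => by
    rw [euclideanDiv, LinearMap.trace_eq_sum_inner _ b]
    refine Finset.sum_congr rfl fun i _ => ?_
    have : HasFDerivAt (fun y => ⟪b i, X y⟫) ((innerSL ℝ (b i)).comp (fderiv ℝ X x)) x :=
      (innerSL ℝ (b i)).hasFDerivAt.comp x (hd x).hasFDerivAt
    rw [this.fderiv]
    rfl
  have hi : ∀ i, ContDiff ℝ ∞ (fun y => ⟪b i, X y⟫) := fun i => contDiff_const.inner ℝ hX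
  have hic : ∀ i, HasCompactSupport (fun y => ⟪b i, X y⟫) := fun i =>
    hc.comp_left (g := fun z => ⟪b i, z⟫) (inner_zero_right _)
  have hci : ∀ i, Continuous fun x => fderiv ℝ (fun y => ⟪b i, X y⟫) x (b i) := fun i =>
    ((hi i).continuous_fderiv (by simp)).clm_apply continuous_const
  have hint : ∀ i, Integrable fun x => fderiv ℝ (fun y => ⟪b i, X y⟫) x (b i) := fun i =>
    (hci i).integrable_of_hasCompactSupport ((hic i).fderiv_apply (𝕜 := ℝ) (b i))
  simp only [e]
  rw [integral_finsetSum _ fun i _ => hint i]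
  refine Finset.sum_eq_zero fun i _ => ?_
  have := integral_mul_fderiv_eq_neg_fderiv_mul_of_integrable (μ := volume) (f := fun _ : E => (1 : ℝ))
    (g := fun y => ⟪b i, X y⟫) (v := b i) (by simp)
    (by simpa using hint i)
    (by simpa using (hi i).continuous.integrable_of_hasCompactSupport (hic i))
    (fun _ _ => differentiableAt_const _) (fun x _ => (hi i).differentiable (by simp) x)
  simpa using this

theorem integral_eq_mul_of_polar {F : E → ℝ} {b : sphere (0 : E) 1 → ℝ} {a : ℝ → ℝ}
    (h : ∀ (p : sphere (0 : E) 1) (t : ℝ), 0 < t → F (t • (p : E)) = b p * a t)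
    [Nontrivial E] :
    ∫ x, F x = (∫ p, b p ∂(volume : Measure E).toSphere) *
      ∫ t : Set.Ioi (0 : ℝ), a t ∂Measure.volumeIoiPow (Module.finrank ℝ E - 1) := by
  calc ∫ x, F x = ∫ x : ({(0)}ᶜ : Set E), F x ∂((volume : Measure E).comap (↑)) := by
        rw [integral_subtype_comap (measurableSet_singleton _).compl F,
          restrict_compl_singleton]
    _ = ∫ q, b q.1 * a q.2 ∂(volume : Measure E).toSphere.prod
          (.volumeIoiPow (Module.finrank ℝ E - 1)) := by
        rw [← (volume : Measure E).measurePreserving_homeomorphUnitSphereProd.integral_comp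
          (Homeomorph.measurableEmbedding _)]
        refine integral_congr_ae (ae_of_all _ fun x => ?_)
        have := h (homeomorphUnitSphereProd E x).1 (homeomorphUnitSphereProd E x).2
          (homeomorphUnitSphereProd E x).2.2
        refine Eq.trans ?_ this
        change F x = _
        congr 1
        have hx : ‖(x : E)‖ ≠ 0 := norm_ne_zero_iff.2 x.2
        simp [smul_smul, hx]
    _ = _ := integral_prod_mul (fun p => b p) (fun t : Set.Ioi (0 : ℝ) => a t)

omit [FiniteDimensional ℝ E] [MeasurableSpace E] [BorelSpace E] in
theorem hasFDerivAt_norm {x : E} (hx : x ≠ 0) :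
    HasFDerivAt (fun y : E => ‖y‖) (‖x‖⁻¹ • innerSL ℝ x) x := by
  have h1 := ((hasStrictFDerivAt_norm_sq x).hasFDerivAt).sqrt
    (pow_ne_zero 2 (norm_ne_zero_iff.2 hx))
  simp only [Real.sqrt_sq (norm_nonneg _)] at h1
  refine h1.congr_fderiv ?_
  have : ‖x‖ ≠ 0 := norm_ne_zero_iff.2 hx
  ext v
  simp
  field_simp

/-- The radially constant extension of a field, cut off by `ψ` in the radial variable. -/
noncomputable def radialExtension (ψ : ℝ → ℝ) (Z : E → E) (x : E) : E :=
  ψ ‖x‖ • Z (‖x‖⁻¹ • x)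

omit [FiniteDimensional ℝ E] [MeasurableSpace E] [BorelSpace E] in
theorem contDiff_radialExtension {ψ : ℝ → ℝ} (hψ : ContDiff ℝ ∞ ψ)
    (h0 : ∀ᶠ t in 𝓝 0, ψ t = 0) {Z : E → E} (hZ : ContDiff ℝ ∞ Z) :
    ContDiff ℝ ∞ (radialExtension ψ Z) := by
  rw [contDiff_iff_contDiffAt]
  intro x
  rcases eq_or_ne x 0 with rfl | hx
  · have : radialExtension ψ Z =ᶠ[𝓝 0] fun _ => 0 := by
      have ht : Tendsto (fun x : E => ‖x‖) (𝓝 0) (𝓝 0) := by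
        simpa using (continuous_norm (E := E)).tendsto 0
      filter_upwards [ht.eventually h0] with y hy
      rw [radialExtension, hy, zero_smul]
    exact contDiffAt_const.congr_of_eventuallyEq this
  · have hn : ContDiffAt ℝ ∞ (fun y : E => ‖y‖) x := contDiffAt_norm ℝ hx
    have hni : ContDiffAt ℝ ∞ (fun y : E => ‖y‖⁻¹) x := hn.inv (norm_ne_zero_iff.2 hx)
    exact (hψ.contDiffAt.comp x hn).smul
      (hZ.contDiffAt.comp x (hni.smul contDiffAt_id))

omit [MeasurableSpace E] [BorelSpace E] in
-- The map `y ↦ y / ‖y‖` has derivative `t⁻¹` times the tangential projection at `t • p`, which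
-- turns the Euclidean trace into the spherical divergence divided by `t`.
theorem euclideanDiv_radialExtension {ψ : ℝ → ℝ} (hψ : Differentiable ℝ ψ)
    {Z : E → E} (hZ : Differentiable ℝ Z) {p : E} (hp : ‖p‖ = 1) (hpZ : ⟪p, Z p⟫ = 0) {t : ℝ}
    (ht : 0 < t) :
    euclideanDiv (radialExtension ψ Z) (t • p) =
      (LinearMap.trace ℝ E (fderiv ℝ Z p).toLinearMap - ⟪fderiv ℝ Z p p, p⟫) * (ψ t / t) := by
  set x := t • p with hx
  have hx0 : x ≠ 0 := by
    refine smul_ne_zero ht.ne' fun h => ?_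
    rw [h, norm_zero] at hp
    exact zero_ne_one hp
  have hnx : ‖x‖ = t := by rw [hx, norm_smul, Real.norm_of_nonneg ht.le, hp, mul_one]
  have hxp : ‖x‖⁻¹ • x = p := by rw [hnx, hx, inv_smul_smul₀ ht.ne']
  have hN := hasFDerivAt_norm hx0
  have hf : HasFDerivAt (fun y : E => ψ ‖y‖) (deriv ψ ‖x‖ • (‖x‖⁻¹ • innerSL ℝ x)) x :=
    (hψ ‖x‖).hasDerivAt.comp_hasFDerivAt x hN
  have hNi : HasFDerivAt (fun y : E => ‖y‖⁻¹) (-(‖x‖ ^ 2)⁻¹ • (‖x‖⁻¹ • innerSL ℝ x)) x :=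
    (hasDerivAt_inv (norm_ne_zero_iff.2 hx0)).comp_hasFDerivAt x hN
  have hν : HasFDerivAt (fun y : E => ‖y‖⁻¹ • y) (‖x‖⁻¹ • ContinuousLinearMap.id ℝ E +
      ContinuousLinearMap.smulRight (-(‖x‖ ^ 2)⁻¹ • (‖x‖⁻¹ • innerSL ℝ x)) x) x :=
    hNi.smul (hasFDerivAt_id x)
  have hZx : HasFDerivAt Z (fderiv ℝ Z p) (‖x‖⁻¹ • x) := by rw [hxp]; exact (hZ p).hasFDerivAt
  have hX := HasFDerivAt.comp (g := Z) (f := fun y : E => ‖y‖⁻¹ • y) x hZx hν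
  have h1 := euclideanDiv_smul (f := fun y : E => ψ ‖y‖)
    (X := fun y : E => Z (‖y‖⁻¹ • y)) hf.differentiableAt hX.differentiableAt
  change euclideanDiv (fun y : E => ψ ‖y‖ • Z (‖y‖⁻¹ • y)) x = _
  rw [h1, hf.fderiv]
  -- The cut-off varies only radially, and the field is tangential at `p`.
  have e2 : (deriv ψ ‖x‖ • (‖x‖⁻¹ • innerSL ℝ x)) (Z (‖x‖⁻¹ • x)) = 0 := by
    rw [hxp]
    simp [hx, hpZ]
  rw [e2, add_zero, euclideanDiv, show fderiv ℝ (fun y : E => Z (‖y‖⁻¹ • y)) x = _ from hX.fderiv]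
  have e3 : (fderiv ℝ Z p ∘SL (‖x‖⁻¹ • ContinuousLinearMap.id ℝ E +
      ContinuousLinearMap.smulRight (-(‖x‖ ^ 2)⁻¹ • (‖x‖⁻¹ • innerSL ℝ x)) x)).toLinearMap =
      t⁻¹ • ((fderiv ℝ Z p).toLinearMap -
        (innerSL ℝ p).toLinearMap.smulRight (fderiv ℝ Z p p)) := by
    refine LinearMap.ext fun y => ?_
    change fderiv ℝ Z p (‖x‖⁻¹ • y + (-(‖x‖ ^ 2)⁻¹ * (‖x‖⁻¹ * ⟪x, y⟫)) • x) =
      t⁻¹ • (fderiv ℝ Z p y - ⟪p, y⟫ • fderiv ℝ Z p p)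
    have e4 : -(t ^ 2)⁻¹ * (t⁻¹ * (t * ⟪p, y⟫)) * t = -(t⁻¹ * ⟪p, y⟫) := by field_simp
    rw [hnx, hx, real_inner_smul_left, smul_smul, e4, map_add, map_smul, map_smul, smul_sub,
      smul_smul, neg_smul, sub_eq_add_neg]
  erw [e3]
  rw [map_smul, map_sub, LinearMap.trace_smulRight, hnx]
  simp only [ContinuousLinearMap.coe_coe, innerSL_apply_apply, smul_eq_mul]
  rw [real_inner_comm p]
  ring

/-- The divergence of the radial extension integrates to zero over the ambient space. In polar
coordinates this integral is the spherical one times a radial factor, so it is enough that the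
radial factor does not vanish. -/
theorem integral_sphericalDiv_eq_zero {d : ℕ} {Z : AmbientSpace d → AmbientSpace d}
    (hZ : ContDiff ℝ ∞ Z) (ht : ∀ p : UnitSphere d, ⟪(p : AmbientSpace d), Z p⟫ = 0) :
    ∫ p : UnitSphere d, sphericalDiv Z p ∂surfaceMeasure d = 0 := by
  let ρ : ContDiffBump (3 / 2 : ℝ) := ⟨1 / 4, 1 / 2, by norm_num, by norm_num⟩
  set ψ : ℝ → ℝ := fun t => ρ t with hψ
  have hψc : ContDiff ℝ ∞ ψ := ρ.contDiff
  have hψ0 : ∀ t, ψ t ≠ 0 → t ∈ Set.Icc (1 : ℝ) 2 := fun t h => by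
    have : t ∈ Function.support ρ := h
    rw [ρ.support_eq, Real.ball_eq_Ioo] at this
    change t ∈ Set.Ioo (3 / 2 - 1 / 2 : ℝ) (3 / 2 + 1 / 2) at this
    constructor <;> linarith [this.1, this.2]
  have hψn : ∀ᶠ t in 𝓝 (0 : ℝ), ψ t = 0 := by
    filter_upwards [gt_mem_nhds (zero_lt_one' ℝ)] with t ht
    by_contra h
    linarith [(hψ0 t h).1]
  have hsupp : ∀ {F : Type} [Zero F] (f : AmbientSpace d → F),
      (∀ x, ψ ‖x‖ = 0 → f x = 0) → HasCompactSupport f := fun f hf => by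
    refine HasCompactSupport.intro (isCompact_closedBall (0 : AmbientSpace d) 2) fun x hx => hf x ?_
    by_contra h
    exact hx (mem_closedBall_zero_iff.2 (hψ0 _ h).2)
  have h1 := integral_euclideanDiv_eq_zero (contDiff_radialExtension hψc hψn hZ)
    (hsupp (radialExtension ψ Z) fun x hx => by rw [radialExtension, hx, zero_smul])
  rw [integral_eq_mul_of_polar (b := fun p : UnitSphere d => sphericalDiv Z p)
    (a := fun t => ψ t / t) (fun p t htp => euclideanDiv_radialExtension
      (hψc.differentiable (by simp)) (hZ.differentiable (by simp))
      (by simp) (ht p) htp)] at h1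
  -- The same splitting with constant angular part: positivity of the left side shows that the
  -- radial factor is nonzero.
  have h2 : ∫ x : AmbientSpace d, ψ ‖x‖ / ‖x‖ = (∫ _p : UnitSphere d, (1 : ℝ) ∂surfaceMeasure d) *
      ∫ t : Set.Ioi (0 : ℝ), ψ t / t ∂Measure.volumeIoiPow
        (Module.finrank ℝ (AmbientSpace d) - 1) := by
    refine integral_eq_mul_of_polar (b := fun _ => 1) (a := fun t => ψ t / t) fun p t htp => ?_
    have hp : ‖(p : AmbientSpace d)‖ = 1 := by simp
    rw [norm_smul, hp, mul_one, Real.norm_of_nonneg htp.le, one_mul]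
  have h3 : 0 < ∫ x : AmbientSpace d, ψ ‖x‖ / ‖x‖ := by
    have hcont : Continuous fun x : AmbientSpace d => ψ ‖x‖ / ‖x‖ := by
      have e : (fun x : AmbientSpace d => ψ ‖x‖ / ‖x‖) = fun x => ψ ‖x‖ / max ‖x‖ 1 := by
        ext x
        by_cases h : ψ ‖x‖ = 0
        · simp [h]
        · rw [max_eq_left (hψ0 _ h).1]
      rw [e]
      have hc := hψc.continuous
      exact (hc.comp continuous_norm).div (by fun_prop) fun x => by positivity
    refine hcont.integral_pos_of_hasCompactSupport_nonneg_nonzero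
      (hsupp _ fun x hx => by simp [hx]) (fun x => div_nonneg ρ.nonneg (norm_nonneg _))
      (x := (3 / 2 : ℝ) • northPole d) ?_
    have hn : ‖(3 / 2 : ℝ) • northPole d‖ = 3 / 2 := by
      rw [norm_smul, northPole]; simp
    rw [hn]
    have : ψ (3 / 2) = 1 := ρ.one_of_mem_closedBall (mem_closedBall_self (by norm_num))
    rw [this]
    norm_num
  rw [h2] at h3
  exact (mul_eq_zero.1 h1).resolve_right fun h => by
    rw [h, mul_zero] at h3
    exact lt_irrefl _ h3

theorem continuous_sphericalDiv {d : ℕ} {Z : AmbientSpace d → AmbientSpace d}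
    (hZ : ContDiff ℝ ∞ Z) : Continuous (sphericalDiv Z) :=
  (continuous_euclideanDiv hZ).sub
    (((hZ.continuous_fderiv (by simp)).clm_apply continuous_id).inner continuous_id)

instance isFiniteMeasure_surfaceMeasure (d : ℕ) : IsFiniteMeasure (surfaceMeasure d) := by
  unfold surfaceMeasure
  infer_instance

theorem integrable_surfaceMeasure_of_continuous {d : ℕ} {f : UnitSphere d → ℝ}
    (hf : Continuous f) : Integrable f (surfaceMeasure d) := by
  obtain ⟨C, hC⟩ := isCompact_univ.exists_bound_of_continuousOn hf.continuousOn
  exact Integrable.of_bound hf.aestronglyMeasurable C (ae_of_all _ fun p => hC p (Set.mem_univ p))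

theorem integral_mul_sphericalDiv {d : ℕ} {f : AmbientSpace d → ℝ} (hf : ContDiff ℝ ∞ f)
    {X : AmbientSpace d → AmbientSpace d} (hX : ContDiff ℝ ∞ X)
    (ht : ∀ p : UnitSphere d, ⟪(p : AmbientSpace d), X p⟫ = 0) :
    ∫ p : UnitSphere d, f p * sphericalDiv X p ∂surfaceMeasure d =
      -∫ p : UnitSphere d, fderiv ℝ f p (X p) ∂surfaceMeasure d := by
  have h0 := integral_sphericalDiv_eq_zero (Z := fun x => f x • X x) (hf.smul hX) fun p => by
    rw [real_inner_smul_right, ht p, mul_zero]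
  have e : ∀ p : UnitSphere d, sphericalDiv (fun x => f x • X x) p =
      f p * sphericalDiv X p + fderiv ℝ f p (X p) := fun p => by
    have hfp := hf.differentiable (by simp) (p : AmbientSpace d)
    have hXp := hX.differentiable (by simp) (p : AmbientSpace d)
    have h1 := euclideanDiv_smul hfp hXp
    unfold euclideanDiv at h1
    unfold sphericalDiv
    rw [h1, show fderiv ℝ (fun x => f x • X x) p = _ from fderiv_fun_smul hfp hXp]
    simp only [add_apply, smul_apply, ContinuousLinearMap.smulRight_apply, inner_add_left, real_inner_smul_left]
    rw [real_inner_comm _ (X p), ht p]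
    ring
  have hc1 : Continuous fun p : UnitSphere d => f p * sphericalDiv X p :=
    (hf.continuous.comp continuous_subtype_val).mul
      ((continuous_sphericalDiv hX).comp continuous_subtype_val)
  have hc2 : Continuous fun p : UnitSphere d => fderiv ℝ f p (X p) :=
    ((hf.continuous_fderiv (by simp)).comp continuous_subtype_val).clm_apply
      (hX.continuous.comp continuous_subtype_val)
  simp only [e] at h0
  rw [integral_add (integrable_surfaceMeasure_of_continuous hc1)
    (integrable_surfaceMeasure_of_continuous hc2)] at h0
  linarith

/-- The tangential part of the gradient of an ambient function. -/
noncomputable def tangentialGradient {d : ℕ} (f : AmbientSpace d → ℝ) (p : UnitSphere d) :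
    AmbientSpace d :=
  gradient f p - ⟪(p : AmbientSpace d), gradient f p⟫ • (p : AmbientSpace d)

/-- Test fields vanish outside `D`, so both integrals extend to the whole sphere, where the
divergence theorem applies. This supplies `H¹(D)` with constants and with infinitely many
independent functions. -/
theorem hasWeakGradient_of_contDiff {d : ℕ} (D : Set (UnitSphere d)) {f : AmbientSpace d → ℝ}
    (hf : ContDiff ℝ ∞ f) :
    HasWeakGradient D (fun p => f p) (tangentialGradient f) := by
  have hg : Continuous (gradient f) :=
    (InnerProductSpace.toDual ℝ (AmbientSpace d)).symm.continuous.comp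
      (hf.continuous_fderiv (by simp))
  have hgs : Continuous fun p : UnitSphere d => gradient f p := hg.comp continuous_subtype_val
  have hT : Continuous (tangentialGradient f : UnitSphere d → AmbientSpace d) :=
    by unfold tangentialGradient; fun_prop
  refine ⟨(hf.continuous.comp continuous_subtype_val).memLp_domainMeasure D,
    hT.memLp_domainMeasure D, ae_of_all _ fun p => ?_, fun X hX => ?_⟩
  · have hp : ‖(p : AmbientSpace d)‖ = 1 := by simp
    rw [tangentialGradient, inner_sub_right, real_inner_smul_right, real_inner_self_eq_norm_sq, hp]
    ring
  · have hzero : ∀ p : UnitSphere d, p ∉ D → X p = 0 ∧ fderiv ℝ X p = 0 := fun p hp => by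
      have hp' : (p : AmbientSpace d) ∉ tsupport X := fun h => hp (hX.support_subset p h)
      refine ⟨image_eq_zero_of_notMem_tsupport hp', ?_⟩
      by_contra h
      exact hp' (support_fderiv_subset ℝ h)
    unfold domainMeasure
    rw [setIntegral_eq_integral_of_forall_compl_eq_zero,
      setIntegral_eq_integral_of_forall_compl_eq_zero, integral_mul_sphericalDiv hf hX.contDiff
        hX.tangent]
    · congr 2
      ext p
      rw [tangentialGradient, inner_sub_left, real_inner_smul_left, hX.tangent p, mul_zero, sub_zero,
        gradient, InnerProductSpace.toDual_symm_apply]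
    · intro p hp
      rw [(hzero p hp).1, inner_zero_right]
    · intro p hp
      simp [sphericalDiv, (hzero p hp).2]

end SphereDivergence

/-! ### Parametrisations of the sphere and the Jacobian of their cones -/

section SphereChart

variable {E : Type*} [NormedAddCommGroup E] [InnerProductSpace ℝ E]

/-- A parametrisation of an open part of the unit sphere by an open subset of a Euclidean space. -/
structure IsSphereChart {d : ℕ} (e : E → AmbientSpace d) (Ω : Set E) : Prop where
  contDiff : ContDiff ℝ ∞ e
  norm_eq_one : ∀ x, ‖e x‖ = 1
  isOpen : IsOpen Ω
  injOn : Set.InjOn e Ω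
  immersion : ∀ x ∈ Ω, ∀ w, fderiv ℝ e x w = 0 → w = 0

/-- The point of the sphere given by a unit vector field. -/
noncomputable def sphereMap {d : ℕ} {e : E → AmbientSpace d} (he : ∀ x, ‖e x‖ = 1) (x : E) :
    UnitSphere d :=
  ⟨e x, mem_sphere_zero_iff_norm.2 (he x)⟩

/-- The cone over a parametrisation. -/
def coneMap {d : ℕ} (e : E → AmbientSpace d) (z : E × ℝ) : AmbientSpace d := z.2 • e z.1

/-- The derivative of the cone over a parametrisation. -/
noncomputable def coneDeriv {d : ℕ} (e : E → AmbientSpace d) (z : E × ℝ) :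
    E × ℝ →L[ℝ] AmbientSpace d :=
  z.2 • (fderiv ℝ e z.1 ∘L ContinuousLinearMap.fst ℝ E ℝ) +
    (ContinuousLinearMap.snd ℝ E ℝ).smulRight (e z.1)

theorem coneDeriv_apply {d : ℕ} (e : E → AmbientSpace d) (z w : E × ℝ) :
    coneDeriv e z w = z.2 • fderiv ℝ e z.1 w.1 + w.2 • e z.1 := rfl

theorem hasFDerivAt_coneMap {d : ℕ} {e : E → AmbientSpace d} (he : Differentiable ℝ e)
    (z : E × ℝ) : HasFDerivAt (coneMap e) (coneDeriv e z) z :=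
  (hasFDerivAt_snd (p := z)).smul ((he z.1).hasFDerivAt.comp z hasFDerivAt_fst)

theorem contDiff_coneMap {d : ℕ} {e : E → AmbientSpace d} (he : ContDiff ℝ ∞ e) :
    ContDiff ℝ ∞ (coneMap e) :=
  contDiff_snd.smul (he.comp contDiff_fst)

theorem inner_fderiv_eq_zero {d : ℕ} {e : E → AmbientSpace d} (he : Differentiable ℝ e)
    (hn : ∀ x, ‖e x‖ = 1) (x w : E) : ⟪e x, fderiv ℝ e x w⟫ = 0 := by
  have h1 := ((he x).hasFDerivAt.norm_sq).congr_of_eventuallyEq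
    (f₁ := fun _ => (1 : ℝ)) (Eventually.of_forall fun y => by simp [hn y])
  have h2 := h1.unique (hasFDerivAt_const (1 : ℝ) x)
  have := congrArg (fun T : E →L[ℝ] ℝ => T w) h2
  simpa using this

/-- The derivative of a unit vector field is orthogonal to it, so the radial and tangential
components must vanish separately. -/
theorem coneDeriv_injective {d : ℕ} {e : E → AmbientSpace d} (he : Differentiable ℝ e)
    (hn : ∀ x, ‖e x‖ = 1) {z : E × ℝ} (hz : z.2 ≠ 0)
    (himm : ∀ w, fderiv ℝ e z.1 w = 0 → w = 0) :
    Function.Injective (coneDeriv e z) := by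
  rw [injective_iff_map_eq_zero]
  rintro ⟨w, τ⟩ h
  rw [coneDeriv_apply] at h
  have h1 := congrArg (fun y => ⟪e z.1, y⟫) h
  simp only [inner_add_right, real_inner_smul_right, inner_fderiv_eq_zero he hn,
    real_inner_self_eq_norm_sq, hn, inner_zero_right] at h1
  have hτ : τ = 0 := by linarith
  simp only [hτ, zero_smul, add_zero, smul_eq_zero, hz, false_or] at h
  rw [himm w h, hτ, Prod.mk_zero_zero]

variable {d : ℕ}

/-- The Jacobian determinant of the cone over a parametrisation, in linear coordinates `L`. -/
noncomputable def coneDet (L : AmbientSpace d ≃L[ℝ] E × ℝ) (e : E → AmbientSpace d)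
    (z : E × ℝ) : ℝ :=
  (coneDeriv e z ∘L (L : AmbientSpace d →L[ℝ] E × ℝ)).det

theorem det_comp_prodMap_smul [FiniteDimensional ℝ E] (L : AmbientSpace d ≃L[ℝ] E × ℝ)
    (B : E × ℝ →L[ℝ] AmbientSpace d)
    (c : ℝ) :
    ((B ∘L ((c • ContinuousLinearMap.id ℝ E).prodMap (ContinuousLinearMap.id ℝ ℝ))) ∘L
      (L : AmbientSpace d →L[ℝ] E × ℝ)).det =
      c ^ Module.finrank ℝ E * (B ∘L (L : AmbientSpace d →L[ℝ] E × ℝ)).det := by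
  set M : E × ℝ →ₗ[ℝ] E × ℝ := (c • LinearMap.id).prodMap LinearMap.id
  have h1 : LinearMap.det M = c ^ Module.finrank ℝ E := by
    rw [LinearMap.det_prodMap, LinearMap.det_smul, LinearMap.det_id, LinearMap.det_id]; simp
  have h2 : (((B ∘L ((c • ContinuousLinearMap.id ℝ E).prodMap (ContinuousLinearMap.id ℝ ℝ))) ∘L
      (L : AmbientSpace d →L[ℝ] E × ℝ)) : AmbientSpace d →ₗ[ℝ] AmbientSpace d) =
      ((B ∘L (L : AmbientSpace d →L[ℝ] E × ℝ)) : AmbientSpace d →ₗ[ℝ] AmbientSpace d) ∘ₗ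
      ((L.symm.toLinearEquiv : E × ℝ →ₗ[ℝ] AmbientSpace d) ∘ₗ M ∘ₗ
        (L.symm.toLinearEquiv.symm : AmbientSpace d →ₗ[ℝ] E × ℝ)) := by
    refine LinearMap.ext fun y => ?_
    simp [M]
  rw [ContinuousLinearMap.det, ContinuousLinearMap.det, h2, LinearMap.det_comp,
    LinearMap.det_conj, h1, mul_comm]

theorem coneDet_eq [FiniteDimensional ℝ E] (L : AmbientSpace d ≃L[ℝ] E × ℝ)
    (e : E → AmbientSpace d) (x : E) (t : ℝ) :
    coneDet L e (x, t) = t ^ Module.finrank ℝ E * coneDet L e (x, 1) := by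
  unfold coneDet
  rw [← det_comp_prodMap_smul]
  congr 2
  refine ContinuousLinearMap.ext fun w => ?_
  rw [ContinuousLinearMap.comp_apply, coneDeriv_apply, coneDeriv_apply]
  simp

/-- Scaling the parameter by `a` multiplies each of the tangential directions by `a` and leaves the
radial one alone. This exact power of `a` later cancels between the two density bounds. -/
theorem coneDet_comp_smul [FiniteDimensional ℝ E] (L : AmbientSpace d ≃L[ℝ] E × ℝ)
    {e : E → AmbientSpace d} (he : Differentiable ℝ e) (a : ℝ) (x : E) :
    coneDet L (fun y => e (a • y)) (x, 1) = a ^ Module.finrank ℝ E * coneDet L e (a • x, 1) := by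
  unfold coneDet
  rw [← det_comp_prodMap_smul]
  congr 2
  have h1 : HasFDerivAt (fun y => e (a • y)) (a • fderiv ℝ e (a • x)) x := by
    have := (he (a • x)).hasFDerivAt.comp x ((hasFDerivAt_id x).const_smul a)
    refine this.congr_fderiv ?_
    ext w
    simp
  refine ContinuousLinearMap.ext fun w => ?_
  rw [ContinuousLinearMap.comp_apply, coneDeriv_apply, coneDeriv_apply, h1.fderiv]
  simp

theorem coneDet_ne_zero (L : AmbientSpace d ≃L[ℝ] E × ℝ) {e : E → AmbientSpace d}
    (he : Differentiable ℝ e) (hn : ∀ x, ‖e x‖ = 1) {x : E}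
    (himm : ∀ w, fderiv ℝ e x w = 0 → w = 0) : coneDet L e (x, 1) ≠ 0 := by
  have hinj : Function.Injective (coneDeriv e (x, 1) ∘L (L : AmbientSpace d →L[ℝ] E × ℝ)) :=
    (coneDeriv_injective he hn one_ne_zero himm).comp L.injective
  have hu := (LinearMap.isUnit_iff_ker_eq_bot
    ((coneDeriv e (x, 1) ∘L (L : AmbientSpace d →L[ℝ] E × ℝ)) :
      AmbientSpace d →ₗ[ℝ] AmbientSpace d)).2 (LinearMap.ker_eq_bot.2 hinj)
  exact ((LinearMap.isUnit_iff_isUnit_det _).1 hu).ne_zero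

theorem contDiff_coneDet (L : AmbientSpace d ≃L[ℝ] E × ℝ) {e : E → AmbientSpace d}
    (he : ContDiff ℝ ∞ e) : ContDiff ℝ ∞ fun x => coneDet L e (x, 1) := by
  have hB : ContDiff ℝ ∞ fun x =>
      coneDeriv e (x, 1) ∘L (L : AmbientSpace d →L[ℝ] E × ℝ) := by
    have h1 : ContDiff ℝ ∞ (fderiv ℝ e) := he.fderiv_right (by simp)
    unfold coneDeriv
    simp only [one_smul]
    refine ContDiff.clm_comp (ContDiff.add (h1.clm_comp contDiff_const) ?_) contDiff_const
    exact ContDiff.smulRight contDiff_const he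
  set b := EuclideanSpace.basisFun (Fin (d + 1)) ℝ
  have hdet : ∀ x, coneDet L e (x, 1) = Matrix.det (LinearMap.toMatrix b.toBasis b.toBasis
      ((coneDeriv e (x, 1) ∘L (L : AmbientSpace d →L[ℝ] E × ℝ)) :
        AmbientSpace d →ₗ[ℝ] AmbientSpace d)) := fun x => by
    rw [LinearMap.det_toMatrix]; rfl
  simp only [hdet, Matrix.det_apply]
  refine ContDiff.sum fun σ _ => ContDiff.const_smul _ (contDiff_prod fun i _ => ?_)
  simp only [LinearMap.toMatrix_apply]
  have h2 : ContDiff ℝ ∞ fun x => (coneDeriv e (x, 1) ∘L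
      (L : AmbientSpace d →L[ℝ] E × ℝ)) (b i) := hB.clm_apply contDiff_const
  exact (contDiff_euclidean.1 h2) (σ i)

end SphereChart

/-! ### The surface measure in a parametrisation -/

section ChartMeasure

variable {E : Type*} [NormedAddCommGroup E] [InnerProductSpace ℝ E]
  {d : ℕ} {e : E → AmbientSpace d} {Ω : Set E}

omit [InnerProductSpace ℝ E] in
theorem continuous_sphereMap (he : Continuous e) (hn : ∀ x, ‖e x‖ = 1) :
    Continuous (sphereMap hn) :=
  he.subtype_mk _

theorem IsSphereChart.injOn_sphereMap (h : IsSphereChart e Ω) :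
    Set.InjOn (sphereMap h.norm_eq_one) Ω := fun _ hx _ hy hxy =>
  h.injOn hx hy (congrArg Subtype.val hxy)

theorem IsSphereChart.injOn_coneMap (h : IsSphereChart e Ω) :
    Set.InjOn (coneMap e) (Ω ×ˢ Set.Ioi (0 : ℝ)) := by
  rintro ⟨x, t⟩ ⟨hx, ht⟩ ⟨y, s⟩ ⟨hy, hs⟩ hxy
  simp only [coneMap] at hxy hx hy ht hs
  have h1 := congrArg (‖·‖) hxy
  simp only [norm_smul, h.norm_eq_one, mul_one, Real.norm_of_nonneg (Set.mem_Ioi.1 ht).le,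
    Real.norm_of_nonneg (Set.mem_Ioi.1 hs).le] at h1
  subst h1
  rw [h.injOn hx hy (smul_right_injective _ (ne_of_gt ht) hxy)]

variable [FiniteDimensional ℝ E] [MeasurableSpace E] [BorelSpace E]

/-- Uniqueness of Haar measure; `L` is an arbitrary linear identification and need not preserve
volume. -/
theorem exists_map_volume_eq_smul (L : AmbientSpace d ≃L[ℝ] E × ℝ) :
    ∃ c : NNReal, c ≠ 0 ∧
      Measure.map L (volume : Measure (AmbientSpace d)) = c • (volume : Measure (E × ℝ)) := by
  have : (Measure.map L (volume : Measure (AmbientSpace d))).IsAddHaarMeasure :=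
    L.isAddHaarMeasure_map _
  have : (volume : Measure (E × ℝ)).IsAddHaarMeasure :=
    inferInstanceAs ((volume : Measure E).prod (volume : Measure ℝ)).IsAddHaarMeasure
  exact ⟨_, (Measure.addHaarScalarFactor_pos_of_isAddHaarMeasure _ _).ne',
    Measure.isAddLeftInvariant_eq_smul _ _⟩

theorem IsSphereChart.volume_image_coneMap (h : IsSphereChart e Ω)
    (L : AmbientSpace d ≃L[ℝ] E × ℝ) {c : NNReal}
    (hc : Measure.map L (volume : Measure (AmbientSpace d)) = c • (volume : Measure (E × ℝ)))
    {B : Set E} (hB : MeasurableSet B) (hBΩ : B ⊆ Ω) :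
    volume (coneMap e '' (B ×ˢ Set.Ioo (0 : ℝ) 1)) =
      c * (∫⁻ t in Set.Ioo (0 : ℝ) 1, ENNReal.ofReal (t ^ Module.finrank ℝ E)) *
        ∫⁻ x in B, ENNReal.ofReal |coneDet L e (x, 1)| := by
  set T : Set (E × ℝ) := B ×ˢ Set.Ioo (0 : ℝ) 1
  have hT : MeasurableSet T := hB.prod measurableSet_Ioo
  have hd : Differentiable ℝ e := h.contDiff.differentiable (by simp)
  have hm : Measurable (L : AmbientSpace d → E × ℝ) := L.continuous.measurable
  have e1 : coneMap e '' T = (coneMap e ∘ L) '' (L ⁻¹' T) := by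
    rw [Set.image_comp, Set.image_preimage_eq _ L.surjective]
  have hJm : Measurable fun x => coneDet L e (x, 1) := (contDiff_coneDet L h.contDiff).continuous.measurable
  have hg : Measurable fun z : E × ℝ => ENNReal.ofReal |coneDet L e z| := by
    have : (fun z : E × ℝ => ENNReal.ofReal |coneDet L e z|) = fun z : E × ℝ =>
        ENNReal.ofReal |z.2 ^ Module.finrank ℝ E * coneDet L e (z.1, 1)| := by
      ext z; rw [← coneDet_eq]
    rw [this]
    exact (((measurable_snd.pow_const _).mul (hJm.comp measurable_fst)).abs).ennreal_ofReal
  rw [e1, ← lintegral_abs_det_fderiv_eq_addHaar_image volume (hm hT)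
    (f' := fun y => coneDeriv e (L y) ∘L (L : AmbientSpace d →L[ℝ] E × ℝ))
    (fun y _ => ((hasFDerivAt_coneMap hd (L y)).comp y L.hasFDerivAt).hasFDerivWithinAt)
    ((h.injOn_coneMap.mono (Set.prod_mono hBΩ fun t ht => ht.1)).comp L.injective.injOn
      fun y hy => hy)]
  calc ∫⁻ y in L ⁻¹' T, ENNReal.ofReal |coneDet L e (L y)|
      = ∫⁻ z in T, ENNReal.ofReal |coneDet L e z| ∂Measure.map L volume := by
        rw [setLIntegral_map hT hg hm]
    _ = c * ∫⁻ z in T, ENNReal.ofReal |coneDet L e z| := by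
        rw [hc, Measure.restrict_smul, lintegral_smul_measure]; rfl
    _ = c * ∫⁻ z, ENNReal.ofReal |coneDet L e (z.1, 1)| * ENNReal.ofReal (z.2 ^ Module.finrank ℝ E)
          ∂((volume.restrict B).prod (volume.restrict (Set.Ioo (0 : ℝ) 1))) := by
        rw [Measure.prod_restrict, ← Measure.volume_eq_prod]
        congr 1
        refine setLIntegral_congr_fun hT fun z hz => ?_
        rw [← ENNReal.ofReal_mul (abs_nonneg _), show z = (z.1, z.2) from rfl, coneDet_eq, abs_mul,
          abs_of_nonneg (pow_nonneg (Set.mem_Ioo.1 hz.2).1.le _), mul_comm]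
    _ = _ := by
        rw [lintegral_prod_mul (f := fun x => ENNReal.ofReal |coneDet L e (x, 1)|)
          (g := fun t : ℝ => ENNReal.ofReal (t ^ Module.finrank ℝ E))
          hJm.abs.ennreal_ofReal.aemeasurable
          (by fun_prop)]
        ring

open scoped Pointwise in
-- The surface measure is defined through volumes of cones, and these are computed by the change of
-- variables formula. The constant `κ` precedes the chart in the quantifiers, as uniformity in the
-- dilation requires.
theorem exists_surfaceMeasure_image (L : AmbientSpace d ≃L[ℝ] E × ℝ) :
    ∃ κ : ℝ, 0 < κ ∧ ∀ (e : E → AmbientSpace d) (Ω : Set E) (h : IsSphereChart e Ω) (B : Set E),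
      MeasurableSet B → B ⊆ Ω → surfaceMeasure d (sphereMap h.norm_eq_one '' B) =
        ENNReal.ofReal κ * ∫⁻ x in B, ENNReal.ofReal |coneDet L e (x, 1)| := by
  obtain ⟨c, hc0, hc⟩ := exists_map_volume_eq_smul L
  set I := ∫⁻ t in Set.Ioo (0 : ℝ) 1, ENNReal.ofReal (t ^ Module.finrank ℝ E)
  have hI0 : I ≠ 0 := by
    have := (setLIntegral_pos_iff (μ := volume) (s := Set.Ioo (0 : ℝ) 1)
      (f := fun t : ℝ => ENNReal.ofReal (t ^ Module.finrank ℝ E)) (by fun_prop)).2 ?_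
    · exact this.ne'
    · have hs : Set.Ioo (0 : ℝ) 1 ⊆
          (Function.support fun t : ℝ => ENNReal.ofReal (t ^ Module.finrank ℝ E)) ∩
            Set.Ioo (0 : ℝ) 1 := fun t ht =>
        ⟨(ENNReal.ofReal_pos.2 (pow_pos ht.1 _)).ne', ht⟩
      refine lt_of_lt_of_le ?_ (measure_mono hs)
      simp
  have hIt : I ≠ ⊤ := by
    refine ne_top_of_le_ne_top (b := ∫⁻ _ in Set.Ioo (0 : ℝ) 1, (1 : ENNReal)) (by simp)
      (setLIntegral_mono measurable_const fun t ht => ?_)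
    exact ENNReal.ofReal_le_one.2 (pow_le_one₀ ht.1.le ht.2.le)
  -- The surface measure of a set is the ambient dimension times the volume of its cone over `(0,
  -- 1)`; `c` comes from `L` and `I` from the radial integral.
  set K : ENNReal := Module.finrank ℝ (AmbientSpace d) * (c * I) with hK
  have hK0 : K ≠ 0 := by simp [hK, hc0, hI0]
  have hKt : K ≠ ⊤ := by
    refine ENNReal.mul_ne_top (ENNReal.natCast_ne_top _) (ENNReal.mul_ne_top ENNReal.coe_ne_top hIt)
  refine ⟨K.toReal, ENNReal.toReal_pos hK0 hKt, fun e Ω h B hB hBΩ => ?_⟩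
  have himg : MeasurableSet (sphereMap h.norm_eq_one '' B) :=
    hB.image_of_continuousOn_injOn
      (continuous_sphereMap h.contDiff.continuous h.norm_eq_one).continuousOn
      (h.injOn_sphereMap.mono hBΩ)
  have e1 : Set.Ioo (0 : ℝ) 1 • ((↑) '' (sphereMap h.norm_eq_one '' B) : Set (AmbientSpace d)) =
      coneMap e '' (B ×ˢ Set.Ioo (0 : ℝ) 1) := by
    ext y
    simp only [Set.mem_smul, Set.mem_image, Set.mem_prod, coneMap]
    constructor
    · rintro ⟨t, ht, _, ⟨_, ⟨x, hx, rfl⟩, rfl⟩, rfl⟩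
      exact ⟨(x, t), ⟨hx, ht⟩, rfl⟩
    · rintro ⟨⟨x, t⟩, ⟨hx, ht⟩, rfl⟩
      exact ⟨t, ht, _, ⟨_, ⟨x, hx, rfl⟩, rfl⟩, rfl⟩
  rw [surfaceMeasure, Measure.toSphere_apply' _ himg, e1, h.volume_image_coneMap L hc hB hBΩ,
    ENNReal.ofReal_toReal hKt, hK]
  simp only [mul_assoc]
  rfl

/-- The parametrisation `e` of `sphereMap '' Ω` has the density `ρ` for the surface measure. -/
def HasChartDensity (h : IsSphereChart e Ω) (ρ : E → ℝ) : Prop :=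
  (surfaceMeasure d).restrict (sphereMap h.norm_eq_one '' Ω) =
    Measure.map (sphereMap h.norm_eq_one)
      ((volume.restrict Ω).withDensity fun x => ENNReal.ofReal (ρ x))

theorem exists_hasChartDensity (L : AmbientSpace d ≃L[ℝ] E × ℝ) :
    ∃ κ : ℝ, 0 < κ ∧ ∀ (e : E → AmbientSpace d) (Ω : Set E) (h : IsSphereChart e Ω),
      HasChartDensity h fun x => κ * |coneDet L e (x, 1)| := by
  obtain ⟨κ, hκ, H⟩ := exists_surfaceMeasure_image (E := E) L
  refine ⟨κ, hκ, fun e Ω h => Measure.ext fun A hA => ?_⟩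
  have hs := continuous_sphereMap h.contDiff.continuous h.norm_eq_one
  have hpre := hs.measurable hA
  have hJm : Measurable fun x => coneDet L e (x, 1) :=
    (contDiff_coneDet L h.contDiff).continuous.measurable
  rw [Measure.restrict_apply hA, Measure.map_apply hs.measurable hA,
    withDensity_apply _ hpre, Measure.restrict_restrict hpre, Set.inter_comm A,
    ← Set.image_inter_preimage, Set.inter_comm Ω,
    H e Ω h _ (hpre.inter h.isOpen.measurableSet) Set.inter_subset_right]
  rw [← lintegral_const_mul _ hJm.abs.ennreal_ofReal]
  simp only [ENNReal.ofReal_mul hκ.le]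

end ChartMeasure

/-! ### Integrals and square integrability in a chart -/

section ChartDensity

variable {E : Type*} [NormedAddCommGroup E] [InnerProductSpace ℝ E]
  [FiniteDimensional ℝ E] [MeasurableSpace E] [BorelSpace E]
  {d : ℕ} {e : E → AmbientSpace d} {Ω : Set E} {h : IsSphereChart e Ω} {ρ : E → ℝ}

theorem HasChartDensity.integral_eq (hρ : HasChartDensity h ρ) (hm : Measurable ρ)
    (hpos : ∀ x ∈ Ω, 0 < ρ x) {f : UnitSphere d → ℝ}
    (hf : AEStronglyMeasurable f (domainMeasure (sphereMap h.norm_eq_one '' Ω))) :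
    ∫ p, f p ∂domainMeasure (sphereMap h.norm_eq_one '' Ω) =
      ∫ x in Ω, ρ x * f (sphereMap h.norm_eq_one x) := by
  have hs := (continuous_sphereMap h.contDiff.continuous h.norm_eq_one).measurable
  unfold domainMeasure at hf ⊢
  rw [show (surfaceMeasure d).restrict _ = _ from hρ] at hf ⊢
  rw [integral_map hs.aemeasurable hf, integral_withDensity_eq_integral_toReal_smul
    hm.ennreal_ofReal (ae_of_all _ fun x => ENNReal.ofReal_lt_top)]
  refine setIntegral_congr_fun h.isOpen.measurableSet fun x hx => ?_
  simp only [ENNReal.toReal_ofReal (hpos x hx).le, smul_eq_mul]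

theorem HasChartDensity.memLp_comp {F : Type*} [NormedAddCommGroup F]
    (hρ : HasChartDensity h ρ) (hm : Measurable ρ)
    {m : ℝ} (hm0 : 0 < m) (hle : ∀ x ∈ Ω, m ≤ ρ x) {f : UnitSphere d → F}
    (hf : MemLp f 2 (domainMeasure (sphereMap h.norm_eq_one '' Ω))) :
    MemLp (fun x => f (sphereMap h.norm_eq_one x)) 2 (volume.restrict Ω) := by
  have hs := (continuous_sphereMap h.contDiff.continuous h.norm_eq_one).measurable
  unfold domainMeasure at hf
  rw [show (surfaceMeasure d).restrict _ = _ from hρ] at hf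
  have h1 := (memLp_map_measure_iff hf.aestronglyMeasurable hs.aemeasurable).1 hf
  refine h1.of_measure_le_smul (c := ENNReal.ofReal m⁻¹) ENNReal.ofReal_ne_top ?_
  rw [← withDensity_smul _ hm.ennreal_ofReal]
  conv_lhs => rw [← withDensity_one (μ := volume.restrict Ω)]
  refine withDensity_mono ?_
  filter_upwards [ae_restrict_mem h.isOpen.measurableSet] with x hx
  simp only [Pi.one_apply, Pi.smul_apply, smul_eq_mul]
  rw [← ENNReal.ofReal_mul (inv_nonneg.2 hm0.le), ENNReal.one_le_ofReal, ← div_eq_inv_mul,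
    one_le_div hm0]
  exact hle x hx

/-- On the image of the chart `k'` is `k / ρ` read through the inverse parametrisation. It carries
the functionals of the Euclidean Rellich property to the sphere. -/
theorem HasChartDensity.exists_memLp_pullback (hρ : HasChartDensity h ρ) (hm : Measurable ρ)
    {m M : ℝ} (hm0 : 0 < m) (hle : ∀ x ∈ Ω, m ≤ ρ x) (hge : ∀ x ∈ Ω, ρ x ≤ M) {k : E → ℝ}
    (hk : MemLp k 2 (volume.restrict Ω)) :
    ∃ k' : UnitSphere d → ℝ, MemLp k' 2 (domainMeasure (sphereMap h.norm_eq_one '' Ω)) ∧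
      ∀ u : UnitSphere d → ℝ, MemLp u 2 (domainMeasure (sphereMap h.norm_eq_one '' Ω)) →
        ∫ p, k' p * u p ∂domainMeasure (sphereMap h.norm_eq_one '' Ω) =
          ∫ x in Ω, k x * u (sphereMap h.norm_eq_one x) := by
  have hsc := continuous_sphereMap h.contDiff.continuous h.norm_eq_one
  have hs := hsc.measurable
  have hpos : ∀ x ∈ Ω, 0 < ρ x := fun x hx => hm0.trans_le (hle x hx)
  have hemb : MeasurableEmbedding (Ω.domRestrict (sphereMap h.norm_eq_one)) :=
    hsc.continuousOn.measurableEmbedding h.isOpen.measurableSet h.injOn_sphereMap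
  set k₀ := hk.aestronglyMeasurable.mk k
  have hk₀ : Measurable k₀ := hk.aestronglyMeasurable.stronglyMeasurable_mk.measurable
  obtain ⟨k', hk'm, hk'⟩ := hemb.exists_measurable_extend
    (g := fun x : Ω => k₀ x * (ρ x)⁻¹)
    ((hk₀.mul hm.inv).comp measurable_subtype_coe) fun _ => ⟨0⟩
  have hval : ∀ x ∈ Ω, k' (sphereMap h.norm_eq_one x) = k₀ x * (ρ x)⁻¹ := fun x hx =>
    congrFun hk' ⟨x, hx⟩
  have hkk : ∀ᵐ x ∂volume.restrict Ω, k' (sphereMap h.norm_eq_one x) = k x * (ρ x)⁻¹ := by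
    filter_upwards [ae_restrict_mem h.isOpen.measurableSet, hk.aestronglyMeasurable.ae_eq_mk]
      with x hx hx2
    rw [hval x hx, hx2]
  have hL : MemLp (fun x => k' (sphereMap h.norm_eq_one x)) 2 (volume.restrict Ω) := by
    refine hk.of_le_mul (c := m⁻¹) (hk'm.comp hs).aestronglyMeasurable ?_
    filter_upwards [ae_restrict_mem h.isOpen.measurableSet, hkk] with x hx hx2
    rw [hx2, norm_mul, mul_comm, norm_inv, Real.norm_of_nonneg (hpos x hx).le]
    gcongr
    exact hle x hx
  refine ⟨k', ?_, fun u hu => ?_⟩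
  · unfold domainMeasure
    rw [show (surfaceMeasure d).restrict _ = _ from hρ]
    refine (memLp_map_measure_iff hk'm.aestronglyMeasurable hs.aemeasurable).2 ?_
    refine hL.of_measure_le_smul (c := ENNReal.ofReal M) ENNReal.ofReal_ne_top ?_
    rw [← withDensity_const]
    refine withDensity_mono ?_
    filter_upwards [ae_restrict_mem h.isOpen.measurableSet] with x hx
    exact ENNReal.ofReal_le_ofReal (hge x hx)
  · rw [hρ.integral_eq (f := fun p => k' p * u p) hm hpos (hk'm.aestronglyMeasurable.mul hu.aestronglyMeasurable)]
    refine integral_congr_ae ?_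
    filter_upwards [ae_restrict_mem h.isOpen.measurableSet, hkk] with x hx hx2
    have := (hpos x hx).ne'
    rw [hx2]
    field_simp

end ChartDensity

/-! ### Extending compactly supported functions from a chart to the ambient space -/

section ChartExtension

variable {E : Type*} [NormedAddCommGroup E] [InnerProductSpace ℝ E]
  [FiniteDimensional ℝ E] {d : ℕ} {e : E → AmbientSpace d} {Ω : Set E}

theorem IsSphereChart.exists_local_inverse (h : IsSphereChart e Ω)
    (hfin : Module.finrank ℝ (E × ℝ) = Module.finrank ℝ (AmbientSpace d))
    {z : E × ℝ} (hz : z ∈ Ω ×ˢ Set.Ioi (0 : ℝ)) :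
    ∃ g : AmbientSpace d → E × ℝ, ContDiffAt ℝ ∞ g (coneMap e z) ∧
      ∀ᶠ y in 𝓝 (coneMap e z), g y ∈ Ω ×ˢ Set.Ioi (0 : ℝ) ∧ coneMap e (g y) = y := by
  have : CompleteSpace (E × ℝ) := FiniteDimensional.complete ℝ _
  have hd : Differentiable ℝ e := h.contDiff.differentiable (by simp)
  have hinj := coneDeriv_injective hd h.norm_eq_one (ne_of_gt hz.2) (h.immersion z.1 hz.1)
  let f' : (E × ℝ) ≃L[ℝ] AmbientSpace d :=
    (LinearMap.linearEquivOfInjective (coneDeriv e z : E × ℝ →ₗ[ℝ] AmbientSpace d) hinj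
      hfin).toContinuousLinearEquiv
  have hf' : HasFDerivAt (coneMap e) (f' : E × ℝ →L[ℝ] AmbientSpace d) z :=
    (hasFDerivAt_coneMap hd z).congr_fderiv (ContinuousLinearMap.ext fun w => rfl)
  have hc : ContDiffAt ℝ ∞ (coneMap e) z := (contDiff_coneMap h.contDiff).contDiffAt
  have hn : (∞ : WithTop ℕ∞) ≠ 0 := by simp
  have hg := hc.to_localInverse hf' hn
  refine ⟨hc.localInverse hf' hn, hg, ?_⟩
  have ho : Ω ×ˢ Set.Ioi (0 : ℝ) ∈ 𝓝 (hc.localInverse hf' hn (coneMap e z)) := by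
    rw [hc.localInverse_apply_image hf' hn]
    exact (h.isOpen.prod isOpen_Ioi).mem_nhds hz
  exact (hg.continuousAt.eventually ho).and
    (hc.hasStrictFDerivAt' hf' hn).eventually_right_inverse

/-- Test fields are ambient objects, so data on the chart are made radially constant on the cone and
cut off near radius one. Smoothness is local and comes from the inverse function theorem for the
cone map. -/
theorem IsSphereChart.exists_extension (h : IsSphereChart e Ω)
    (hfin : Module.finrank ℝ (E × ℝ) = Module.finrank ℝ (AmbientSpace d))
    {F : Type*} [NormedAddCommGroup F] [NormedSpace ℝ F] {a : E → F} (ha : ContDiff ℝ ∞ a)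
    (hac : HasCompactSupport a) (haΩ : tsupport a ⊆ Ω) :
    ∃ A : AmbientSpace d → F, ContDiff ℝ ∞ A ∧ HasCompactSupport A ∧
      (∀ x ∈ Ω, A (e x) = a x) ∧
      ∀ p : UnitSphere d, (p : AmbientSpace d) ∈ tsupport A →
        p ∈ sphereMap h.norm_eq_one '' Ω := by
  classical
  set S : Set (E × ℝ) := Ω ×ˢ Set.Ioi (0 : ℝ)
  set Θ := Function.invFunOn (coneMap e) S
  have hΘ : ∀ z ∈ S, Θ (coneMap e z) = z := fun z hz => h.injOn_coneMap.leftInvOn_invFunOn hz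
  let ρ : ContDiffBump (1 : ℝ) := ⟨1 / 4, 1 / 2, by norm_num, by norm_num⟩
  have hρ0 : ∀ t : ℝ, ρ t ≠ 0 → t ∈ Set.Icc (1 / 2 : ℝ) 2 := fun t ht => by
    have : t ∈ Function.support ρ := ht
    rw [ρ.support_eq, Real.ball_eq_Ioo] at this
    change t ∈ Set.Ioo (1 - 1 / 2 : ℝ) (1 + 1 / 2) at this
    constructor <;> linarith [this.1, this.2]
  have hnorm : ∀ z ∈ S, ‖coneMap e z‖ = z.2 := fun z hz => by
    rw [coneMap, norm_smul, h.norm_eq_one, mul_one, Real.norm_of_nonneg (Set.mem_Ioi.1 hz.2).le]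
  set A : AmbientSpace d → F := fun y => if y ∈ coneMap e '' S then ρ ‖y‖ • a (Θ y).1 else 0
  have hAv : ∀ z ∈ S, A (coneMap e z) = ρ z.2 • a z.1 := fun z hz => by
    simp only [A]
    rw [if_pos (Set.mem_image_of_mem _ hz), hΘ z hz, hnorm z hz]
  set K : Set (AmbientSpace d) := coneMap e '' (tsupport a ×ˢ Set.Icc (1 / 2 : ℝ) 2)
  have hsub : tsupport a ×ˢ Set.Icc (1 / 2 : ℝ) 2 ⊆ S := fun z hz =>
    ⟨haΩ hz.1, Set.mem_Ioi.2 (lt_of_lt_of_le (by norm_num) (Set.mem_Icc.1 hz.2).1)⟩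
  have hK : IsCompact K :=
    (hac.isCompact.prod isCompact_Icc).image (contDiff_coneMap h.contDiff).continuous
  have hAK : ∀ y, y ∉ K → A y = 0 := fun y hy => by
    by_cases hyS : y ∈ coneMap e '' S
    · obtain ⟨z, hz, rfl⟩ := hyS
      rw [hAv z hz]
      by_contra hne
      have h1 : z.1 ∈ tsupport a := subset_tsupport a fun h0 => hne (by rw [h0, smul_zero])
      have h2 := hρ0 z.2 fun h0 => hne (by rw [h0, zero_smul])
      exact hy ⟨z, ⟨h1, h2⟩, rfl⟩
    · simp only [A]
      rw [if_neg hyS]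
  have hts : tsupport A ⊆ K :=
    closure_minimal (fun y hy => by_contra fun hn => hy (hAK y hn)) hK.isClosed
  refine ⟨A, ?_, HasCompactSupport.intro hK fun y hy => hAK y hy, fun x hx => ?_, fun p hp => ?_⟩
  · rw [contDiff_iff_contDiffAt]
    intro y
    by_cases hy : y ∈ K
    · obtain ⟨z, hz, rfl⟩ := hy
      have hzS := hsub hz
      obtain ⟨g, hg, hgv⟩ := h.exists_local_inverse hfin hzS
      have hne : coneMap e z ≠ 0 := fun h0 => by
        have := hnorm z hzS
        rw [h0, norm_zero] at this
        exact (ne_of_lt (Set.mem_Ioi.1 hzS.2)) this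
      have hs : ContDiffAt ℝ ∞ (fun y => ρ ‖y‖ • a (g y).1) (coneMap e z) :=
        (ρ.contDiff.contDiffAt.comp _ (contDiffAt_norm ℝ hne)).smul
          (ha.contDiffAt.comp _ (contDiffAt_fst.comp _ hg))
      refine hs.congr_of_eventuallyEq ?_
      filter_upwards [hgv] with y hy
      have hyS : y ∈ coneMap e '' S := ⟨g y, hy.1, hy.2⟩
      -- The cone map is injective on `S`, so any local inverse with values in `S` agrees with the
      -- chosen global one.
      have hΘy : Θ y = g y := by
        have := hΘ (g y) hy.1
        rwa [hy.2] at this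
      simp only [A]
      rw [if_pos hyS, hΘy]
    · refine contDiffAt_const (c := (0 : F)).congr_of_eventuallyEq ?_
      filter_upwards [hK.isClosed.isOpen_compl.mem_nhds hy] with y' hy' using hAK y' hy'
  · have := hAv (x, 1) ⟨hx, Set.mem_Ioi.2 zero_lt_one⟩
    simp only [coneMap, one_smul] at this
    rw [this, ρ.one_of_mem_closedBall (mem_closedBall_self (by norm_num)), one_smul]
  · obtain ⟨z, hz, hzp⟩ := hts hp
    have h1 := hnorm z (hsub hz)
    rw [hzp, norm_eq_of_mem_sphere p] at h1
    refine ⟨z.1, (hsub hz).1, Subtype.ext ?_⟩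
    rw [← hzp, coneMap, ← h1, one_smul]
    rfl

end ChartExtension

/-! ### Transfer of weak gradients from the sphere to the chart -/

section WeakGradientTransfer

variable {E : Type*} [NormedAddCommGroup E] [InnerProductSpace ℝ E]
  [FiniteDimensional ℝ E] [MeasurableSpace E] [BorelSpace E]
  {d : ℕ} {e : E → AmbientSpace d} {Ω : Set E} {h : IsSphereChart e Ω} {ρ : E → ℝ}

theorem ae_eq_of_integral_contDiff_mul {d : ℕ} {g₁ g₂ : AmbientSpace d → ℝ}
    (h₁ : Continuous g₁) (h₂ : Continuous g₂)
    (H : ∀ f : AmbientSpace d → ℝ, ContDiff ℝ ∞ f → HasCompactSupport f →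
      ∫ p : UnitSphere d, f p * g₁ p ∂surfaceMeasure d =
        ∫ p : UnitSphere d, f p * g₂ p ∂surfaceMeasure d) :
    ∀ᵐ p : UnitSphere d ∂surfaceMeasure d, g₁ p = g₂ p := by
  have hval : Measurable (Subtype.val : UnitSphere d → AmbientSpace d) := measurable_subtype_coe
  have hc : Continuous fun y => g₁ y - g₂ y := h₁.sub h₂
  have := ae_eq_zero_of_integral_contDiff_smul_eq_zero
    (μ := Measure.map (Subtype.val : UnitSphere d → AmbientSpace d) (surfaceMeasure d))
    (f := fun y => g₁ y - g₂ y) hc.locallyIntegrable fun f hf hfc => by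
      rw [integral_map (f := fun y => f y • (g₁ y - g₂ y)) hval.aemeasurable
        (hf.continuous.smul hc).aestronglyMeasurable]
      simp only [smul_eq_mul, mul_sub]
      rw [integral_sub, H f hf hfc, sub_self]
      · exact integrable_surfaceMeasure_of_continuous
          ((hf.continuous.mul h₁).comp continuous_subtype_val)
      · exact integrable_surfaceMeasure_of_continuous
          ((hf.continuous.mul h₂).comp continuous_subtype_val)
  exact (ae_of_ae_map hval.aemeasurable this).mono fun p hp => sub_eq_zero.1 hp

omit [FiniteDimensional ℝ E] [MeasurableSpace E] [BorelSpace E] in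
theorem contDiff_smul_of_tsupport_subset {F : Type*} [NormedAddCommGroup F] [NormedSpace ℝ F]
    {Ω : Set E} {r : E → ℝ} {a : E → F} (hr : ∀ x ∈ Ω, ContDiffAt ℝ ∞ r x) (ha : ContDiff ℝ ∞ a)
    (hs : tsupport a ⊆ Ω) : ContDiff ℝ ∞ fun x => r x • a x := by
  rw [contDiff_iff_contDiffAt]
  intro x
  by_cases hx : x ∈ tsupport a
  · exact (hr x (hs hx)).smul ha.contDiffAt
  · refine contDiffAt_const (c := (0 : F)).congr_of_eventuallyEq ?_
    filter_upwards [notMem_tsupport_iff_eventuallyEq.1 hx] with y hy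
    rw [hy, Pi.zero_apply, smul_zero]

/-- The field is the push-forward of `X` divided by the density, whose divergence is `div X / ρ` as
in the coordinate formula for the Riemannian divergence. The formula is obtained by duality, so the
derivatives of `Y` never have to be computed; an identity almost everywhere is enough for
integration by parts. -/
theorem HasChartDensity.exists_testField (hρ : HasChartDensity h ρ) (hm : Measurable ρ)
    (hpos : ∀ x ∈ Ω, 0 < ρ x) (hs : ∀ x ∈ Ω, ContDiffAt ℝ ∞ ρ x)
    (hfin : Module.finrank ℝ (E × ℝ) = Module.finrank ℝ (AmbientSpace d))
    {X : E → E} (hX : ContDiff ℝ ∞ X) (hc : HasCompactSupport X) (hXΩ : tsupport X ⊆ Ω) :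
    ∃ Y : AmbientSpace d → AmbientSpace d, IsTestField (sphereMap h.norm_eq_one '' Ω) Y ∧
      (∀ x ∈ Ω, ρ x • Y (e x) = fderiv ℝ e x (X x)) ∧
      ∃ Q : AmbientSpace d → ℝ, Continuous Q ∧
      (∀ x ∈ Ω, ρ x * Q (e x) = euclideanDiv X x) ∧
      ∀ᵐ p : UnitSphere d ∂domainMeasure (sphereMap h.norm_eq_one '' Ω),
        sphericalDiv Y p = Q p := by
  set D := sphereMap h.norm_eq_one '' Ω
  have hed : Differentiable ℝ e := h.contDiff.differentiable (by simp)
  have hri : ∀ x ∈ Ω, ContDiffAt ℝ ∞ (fun x => (ρ x)⁻¹) x := fun x hx =>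
    (hs x hx).inv (hpos x hx).ne'
  have hb : ContDiff ℝ ∞ (euclideanDiv X) := by
    have h1 : ContDiff ℝ ∞ (fderiv ℝ X) := hX.fderiv_right (by simp)
    exact ((LinearMap.trace ℝ E ∘ₗ ContinuousLinearMap.coeLM ℝ).toContinuousLinearMap).contDiff.comp
      h1
  have hbc := hasCompactSupport_euclideanDiv hc
  have hbs : tsupport (euclideanDiv X) ⊆ tsupport X := by
    refine closure_minimal (fun x hx => by_contra fun hn => hx ?_) (isClosed_tsupport X)
    have : fderiv ℝ X x = 0 := by
      by_contra h0
      exact hn (support_fderiv_subset ℝ h0)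
    simp [euclideanDiv, this]
  have ha : ContDiff ℝ ∞ fun x => fderiv ℝ e x (X x) :=
    (h.contDiff.fderiv_right (by simp)).clm_apply hX
  have has : tsupport (fun x => fderiv ℝ e x (X x)) ⊆ tsupport X :=
    closure_mono fun x hx h0 => hx (by simp [h0])
  have hsupp : ∀ {F : Type} [NormedAddCommGroup F] [NormedSpace ℝ F] (a : E → F),
      tsupport a ⊆ tsupport X → tsupport (fun x => (ρ x)⁻¹ • a x) ⊆ tsupport X := fun a hat =>
    (tsupport_smul_subset_right (fun x => (ρ x)⁻¹) a).trans hat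
  obtain ⟨Y, hYs, hYc, hYv, hYD⟩ := h.exists_extension hfin
    (contDiff_smul_of_tsupport_subset hri ha (has.trans hXΩ))
    (hc.of_isClosed_subset (isClosed_tsupport _) (hsupp _ has)) ((hsupp _ has).trans hXΩ)
  obtain ⟨Q, hQs, hQc, hQv, hQD⟩ := h.exists_extension hfin
    (contDiff_smul_of_tsupport_subset hri hb (hbs.trans hXΩ))
    (hc.of_isClosed_subset (isClosed_tsupport _) (hsupp _ hbs)) ((hsupp _ hbs).trans hXΩ)
  have hYv' : ∀ x ∈ Ω, ρ x • Y (e x) = fderiv ℝ e x (X x) := fun x hx => by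
    rw [hYv x hx, smul_inv_smul₀ (hpos x hx).ne']
  have hQv' : ∀ x ∈ Ω, ρ x * Q (e x) = euclideanDiv X x := fun x hx => by
    rw [hQv x hx, smul_eq_mul, mul_inv_cancel_left₀ (hpos x hx).ne']
  have hY0 : ∀ p : UnitSphere d, p ∉ D → Y p = 0 := fun p hp =>
    image_eq_zero_of_notMem_tsupport fun h0 => hp (hYD p h0)
  have hQ0 : ∀ p : UnitSphere d, p ∉ D → Q p = 0 := fun p hp =>
    image_eq_zero_of_notMem_tsupport fun h0 => hp (hQD p h0)
  have hYt : ∀ p : UnitSphere d, ⟪(p : AmbientSpace d), Y p⟫ = 0 := fun p => by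
    by_cases hp : p ∈ D
    · obtain ⟨x, hx, rfl⟩ := hp
      change ⟪e x, Y (e x)⟫ = 0
      rw [hYv x hx, real_inner_smul_right, inner_fderiv_eq_zero hed h.norm_eq_one, mul_zero]
    · rw [hY0 p hp, inner_zero_right]
  refine ⟨Y, ⟨hYs, hYc, hYD, hYt⟩, hYv', Q, hQs.continuous, hQv', ?_⟩
  -- Against a test function `f`, the divergence of `Y` is moved onto `f` on the sphere, the
  -- integral is pulled back to `Ω`, and the derivative is moved back onto `X` there.
  refine ae_restrict_of_ae (ae_eq_of_integral_contDiff_mul (continuous_sphericalDiv hYs)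
    hQs.continuous fun f hf hfc => ?_)
  rw [integral_mul_sphericalDiv hf hYs hYt]
  have hcf : Continuous fun p : UnitSphere d => fderiv ℝ f p (Y p) :=
    ((hf.continuous_fderiv (by simp)).comp continuous_subtype_val).clm_apply
      (hYs.continuous.comp continuous_subtype_val)
  have hcQ : Continuous fun p : UnitSphere d => f p * Q p :=
    (hf.mul hQs).continuous.comp continuous_subtype_val
  have i1 : ∫ p : UnitSphere d, fderiv ℝ f p (Y p) ∂surfaceMeasure d =
      ∫ x in Ω, fderiv ℝ (fun x => f (e x)) x (X x) := by
    rw [← setIntegral_eq_integral_of_forall_compl_eq_zero (s := D) fun p hp => by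
      rw [hY0 p hp, map_zero]]
    refine (hρ.integral_eq hm hpos hcf.aestronglyMeasurable).trans ?_
    refine setIntegral_congr_fun h.isOpen.measurableSet fun x hx => ?_
    have hfe : HasFDerivAt (fun x => f (e x)) (fderiv ℝ f (e x) ∘L fderiv ℝ e x) x :=
      HasFDerivAt.comp x (hf.differentiable (by simp) (e x)).hasFDerivAt (hed x).hasFDerivAt
    beta_reduce
    rw [hfe.fderiv, ContinuousLinearMap.comp_apply, ← hYv' x hx, map_smul]
    rfl
  have i2 : ∫ p : UnitSphere d, f p * Q p ∂surfaceMeasure d =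
      ∫ x in Ω, f (e x) * euclideanDiv X x := by
    rw [← setIntegral_eq_integral_of_forall_compl_eq_zero (s := D) fun p hp => by
      rw [hQ0 p hp, mul_zero]]
    refine (hρ.integral_eq hm hpos hcQ.aestronglyMeasurable).trans ?_
    refine setIntegral_congr_fun h.isOpen.measurableSet fun x hx => ?_
    change ρ x * (f (e x) * Q (e x)) = f (e x) * euclideanDiv X x
    rw [← hQv' x hx]
    ring
  rw [i1, i2]
  have hfe : ContDiff ℝ ∞ fun x => f (e x) := hf.comp h.contDiff
  have hX0 : ∀ x, x ∉ Ω → X x = 0 := fun x hx =>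
    image_eq_zero_of_notMem_tsupport fun h0 => hx (hXΩ h0)
  have hD0 : ∀ x, x ∉ Ω → euclideanDiv X x = 0 := fun x hx =>
    image_eq_zero_of_notMem_tsupport fun h0 => hx (hXΩ (hbs h0))
  rw [setIntegral_eq_integral_of_forall_compl_eq_zero fun x hx => by rw [hX0 x hx, map_zero],
    setIntegral_eq_integral_of_forall_compl_eq_zero fun x hx => by rw [hD0 x hx, mul_zero]]
  have hz := integral_euclideanDiv_eq_zero (hfe.smul hX) (hc.smul_left (f := fun x => f (e x)))
  have hsum : ∀ x, euclideanDiv ((fun x => f (e x)) • X) x =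
      f (e x) * euclideanDiv X x + fderiv ℝ (fun x => f (e x)) x (X x) := fun x =>
    euclideanDiv_smul (hfe.differentiable (by simp) x) (hX.differentiable (by simp) x)
  simp only [hsum] at hz
  rw [integral_add] at hz
  · linarith
  · exact (hfe.continuous.mul hb.continuous).integrable_of_hasCompactSupport hbc.mul_left
  · refine ((hfe.continuous_fderiv (by simp)).clm_apply
      hX.continuous).integrable_of_hasCompactSupport ?_
    exact hc.mono fun x hx h0 => hx (by simp [h0])

/-- The chain rule for weak gradients: pairing `G` with a pushed-forward field is pairing its image
under the adjoint derivative with the original field. -/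
theorem HasWeakGradient.hasEuclideanWeakGradient (hρ : HasChartDensity h ρ) (hm : Measurable ρ)
    {m K : ℝ} (hm0 : 0 < m) (hle : ∀ x ∈ Ω, m ≤ ρ x) (hs : ∀ x ∈ Ω, ContDiffAt ℝ ∞ ρ x)
    (hK : ∀ x ∈ Ω, ‖fderiv ℝ e x‖ ≤ K)
    (hfin : Module.finrank ℝ (E × ℝ) = Module.finrank ℝ (AmbientSpace d))
    {u : UnitSphere d → ℝ} {G : UnitSphere d → AmbientSpace d}
    (hu : HasWeakGradient (sphereMap h.norm_eq_one '' Ω) u G) :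
    HasEuclideanWeakGradient Ω (fun x => u (sphereMap h.norm_eq_one x))
      (fun x => (fderiv ℝ e x).adjoint (G (sphereMap h.norm_eq_one x))) := by
  have hpos : ∀ x ∈ Ω, 0 < ρ x := fun x hx => hm0.trans_le (hle x hx)
  have hGL := hρ.memLp_comp hm hm0 hle hu.memLp_grad
  refine ⟨hρ.memLp_comp hm hm0 hle hu.memLp, ?_, fun X hX hc hXΩ => ?_⟩
  · refine hGL.of_le_mul (c := K) ?_ ?_
    · have hc : Continuous fun x => (fderiv ℝ e x).adjoint :=
        (ContinuousLinearMap.adjoint (𝕜 := ℝ) (E := E) (F := AmbientSpace d)).continuous.comp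
          (h.contDiff.continuous_fderiv (by simp))
      exact (ContinuousLinearMap.id ℝ (AmbientSpace d →L[ℝ] E)).aestronglyMeasurable_comp₂
        hc.aestronglyMeasurable hGL.aestronglyMeasurable
    · filter_upwards [ae_restrict_mem h.isOpen.measurableSet] with x hx
      refine (ContinuousLinearMap.le_opNorm _ _).trans ?_
      rw [LinearIsometryEquiv.norm_map]
      gcongr
      exact hK x hx
  · obtain ⟨Y, hY, hYv, Q, hQ, hQv, hYQ⟩ := hρ.exists_testField hm hpos hs hfin hX hc hXΩ
    have hQs : Continuous fun p : UnitSphere d => Q p := hQ.comp continuous_subtype_val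
    have hYs : Continuous fun p : UnitSphere d => Y p :=
      hY.contDiff.continuous.comp continuous_subtype_val
    calc ∫ x in Ω, u (sphereMap h.norm_eq_one x) * euclideanDiv X x
        = ∫ x in Ω, ρ x * (u (sphereMap h.norm_eq_one x) * Q (e x)) := by
          refine setIntegral_congr_fun h.isOpen.measurableSet fun x hx => ?_
          rw [← hQv x hx]
          ring
      _ = ∫ p, u p * Q p ∂domainMeasure (sphereMap h.norm_eq_one '' Ω) :=
          (hρ.integral_eq (f := fun p => u p * Q p) hm hpos
            (hu.memLp.aestronglyMeasurable.mul hQs.aestronglyMeasurable)).symm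
      _ = ∫ p, u p * sphericalDiv Y p ∂domainMeasure (sphereMap h.norm_eq_one '' Ω) :=
          integral_congr_ae (hYQ.mono fun p hp => by beta_reduce; rw [hp])
      _ = -∫ p, ⟪G p, Y p⟫ ∂domainMeasure (sphereMap h.norm_eq_one '' Ω) :=
          hu.integral_by_parts Y hY
      _ = -∫ x in Ω, ρ x * ⟪G (sphereMap h.norm_eq_one x), Y (e x)⟫ := by
          rw [hρ.integral_eq (f := fun p => ⟪G p, Y p⟫) hm hpos
            (hu.memLp_grad.aestronglyMeasurable.inner hYs.aestronglyMeasurable)]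
          rfl
      _ = -∫ x in Ω, ⟪(fderiv ℝ e x).adjoint (G (sphereMap h.norm_eq_one x)), X x⟫ := by
          congr 1
          refine setIntegral_congr_fun h.isOpen.measurableSet fun x hx => ?_
          beta_reduce
          rw [← real_inner_smul_right, hYv x hx, ContinuousLinearMap.adjoint_inner_left]

end WeakGradientTransfer

/-! ### Existence of Neumann eigenvalues and their lower bound -/

section NeumannSpectrum

variable {d : ℕ} {D : Set (UnitSphere d)}

/-- `L²` functions that are orthogonal to suitable finite sets are small with respect to the
Sobolev norm. This is the form in which compactness of `H¹(D) → L²(D)` is used. -/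
def IsSphericalRellichSet (D : Set (UnitSphere d)) : Prop :=
  ∀ ε : ℝ, 0 < ε → ∃ S : Set (UnitSphere d → ℝ), S.Finite ∧
    (∀ k ∈ S, MemLp k 2 (domainMeasure D)) ∧
    ∀ (u : UnitSphere d → ℝ) (G : UnitSphere d → AmbientSpace d), HasWeakGradient D u G →
      (∀ k ∈ S, ∫ p, k p * u p ∂domainMeasure D = 0) →
      ∫ p, u p ^ 2 ∂domainMeasure D ≤
        ε * ((∫ p, u p ^ 2 ∂domainMeasure D) + ∫ p, ‖G p‖ ^ 2 ∂domainMeasure D)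

/-- The Poincaré inequality with constant `Λ`. -/
def SatisfiesPoincare (D : Set (UnitSphere d)) (Λ : ℝ) : Prop :=
  ∀ (u : UnitSphere d → ℝ) (G : UnitSphere d → AmbientSpace d), HasWeakGradient D u G →
    ∃ c : ℝ, ∫ p, (u p - c) ^ 2 ∂domainMeasure D ≤ Λ * ∫ p, ‖G p‖ ^ 2 ∂domainMeasure D

/-- The test pairs that characterise functions with their weak gradients. -/
def sphericalTestPairs (D : Set (UnitSphere d)) :
    Set (L2Pair (AmbientSpace d) (domainMeasure D)) :=
  {t | ∃ (X : AmbientSpace d → AmbientSpace d)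
      (ha : MemLp (fun p : UnitSphere d => sphericalDiv X p) 2 (domainMeasure D))
      (hX : MemLp (fun p : UnitSphere d => X p) 2 (domainMeasure D)),
      IsTestField D X ∧ t = mkPair ha hX} ∪
  {t | ∃ (f : UnitSphere d → ℝ) (h0 : MemLp (0 : UnitSphere d → ℝ) 2 (domainMeasure D))
      (hf : MemLp (fun p : UnitSphere d => f p • (p : AmbientSpace d)) 2 (domainMeasure D)),
      t = mkPair h0 hf}

/-- The closed space of pairs of a function in `H¹(D)` and its weak gradient. -/
noncomputable abbrev weakGradientPairs (D : Set (UnitSphere d)) :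
    Submodule ℝ (L2Pair (AmbientSpace d) (domainMeasure D)) :=
  (Submodule.span ℝ (sphericalTestPairs D))ᗮ

/-- The first family of test pairs encodes integration by parts. The second, radial, family forces
tangency: with `f p = ⟪p, G p⟫` the orthogonality relation says that `f` has vanishing `L²` norm. -/
theorem mkPair_mem_weakGradientPairs_iff {u : UnitSphere d → ℝ}
    {G : UnitSphere d → AmbientSpace d} (hu : MemLp u 2 (domainMeasure D))
    (hG : MemLp G 2 (domainMeasure D)) :
    mkPair hu hG ∈ weakGradientPairs D ↔ HasWeakGradient D u G := by
  rw [mem_orthogonal_span_iff]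
  constructor
  · refine fun h => ⟨hu, hG, ?_, fun X hX => ?_⟩
    · set f : UnitSphere d → ℝ := fun p => ⟪(p : AmbientSpace d), G p⟫
      have hf : MemLp (fun p : UnitSphere d => f p • (p : AmbientSpace d)) 2
          (domainMeasure D) := by
        have hc : AEStronglyMeasurable (fun p : UnitSphere d => (p : AmbientSpace d))
          (domainMeasure D) := continuous_subtype_val.aestronglyMeasurable
        have hfm : AEStronglyMeasurable f (domainMeasure D) := hc.inner hG.aestronglyMeasurable
        refine hG.mono (hfm.smul hc) (ae_of_all _ fun p => ?_)
        have h1 : ‖(p : AmbientSpace d)‖ = 1 := norm_eq_of_mem_sphere p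
        rw [norm_smul, h1, mul_one]
        exact (norm_inner_le_norm _ _).trans (by rw [h1, one_mul])
      have h1 := h _ (Or.inr ⟨f, MemLp.zero, hf, rfl⟩)
      rw [inner_mkPair] at h1
      have h2 : ∀ p : UnitSphere d, ⟪G p, f p • (p : AmbientSpace d)⟫ = f p ^ 2 := fun p => by
        rw [real_inner_smul_right, real_inner_comm, sq]
      simp only [h2, Pi.zero_apply, mul_zero, integral_zero, zero_add] at h1
      have hi : Integrable (fun p => f p ^ 2) (domainMeasure D) := by
        simpa only [h2] using MemLp.integrable_inner_domainMeasure hG hf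
      filter_upwards [(integral_eq_zero_iff_of_nonneg (fun p => sq_nonneg (f p)) hi).1 h1] with p hp
      exact pow_eq_zero_iff two_ne_zero |>.1 hp
    · have := h _ (Or.inl ⟨X, hX.continuous_sphericalDiv.memLp_domainMeasure D,
        (hX.contDiff.continuous.comp continuous_subtype_val).memLp_domainMeasure D, hX, rfl⟩)
      rw [inner_mkPair] at this
      linarith
  · rintro h t (⟨X, ha, hX, hXt, rfl⟩ | ⟨f, h0, hf, rfl⟩)
    · rw [inner_mkPair, h.integral_by_parts X hXt]
      ring
    · rw [inner_mkPair]
      simp only [Pi.zero_apply, mul_zero, integral_zero, zero_add]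
      refine integral_eq_zero_of_ae (h.tangent.mono fun p hp => ?_)
      simp only [Pi.zero_apply]
      rw [real_inner_smul_right, real_inner_comm, hp, mul_zero]

theorem IsSphericalRellichSet.isCompactOperator (hR : IsSphericalRellichSet D) :
    IsCompactOperator (pairFst (weakGradientPairs D)) := by
  refine isCompactOperator_pairFst _ fun ε hε => ?_
  obtain ⟨S, hSf, hS, hSw⟩ := hR (ε ^ 2) (by positivity)
  have := hSf.to_subtype
  refine ⟨Set.range fun k : S => (hS k k.2).toLp k.1, Set.finite_range _, fun x hx h0 => ?_⟩
  have hmem := hx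
  rw [← mkPair_coe x, mkPair_mem_weakGradientPairs_iff] at hmem
  refine abs_le_of_sq_le_sq' ?_ (by positivity) |>.2
  have hn : ‖x‖ ^ 2 = (∫ p, x.fst p ^ 2 ∂domainMeasure D) +
      ∫ p, ‖x.snd p‖ ^ 2 ∂domainMeasure D := by
    conv_lhs => rw [← mkPair_coe x]
    exact norm_sq_mkPair _ _
  rw [mul_pow, hn, norm_sq_Lp]
  simp only [Real.norm_eq_abs, sq_abs]
  refine hSw _ _ hmem fun k hk => ?_
  have := h0 _ ⟨⟨k, hk⟩, rfl⟩
  rw [L2.inner_def] at this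
  rw [← this]
  refine integral_congr_ae ?_
  filter_upwards [(hS k hk).coeFn_toLp] with y hy
  simp [hy, mul_comm]

/-- As in Lagrange interpolation, `f i` vanishes at every chosen point except the `i`-th. A
continuous combination that is zero almost everywhere on the open set `D` is zero at those points.
-/
theorem exists_linearIndependent_contDiff (hD : IsOpen D) (hinf : D.Infinite) (m : ℕ) :
    ∃ f : Fin m → AmbientSpace d → ℝ, (∀ i, ContDiff ℝ ∞ (f i)) ∧
      ∀ hL : ∀ i, MemLp (fun p : UnitSphere d => f i p) 2 (domainMeasure D),
        LinearIndependent ℝ fun i => (hL i).toLp (fun p : UnitSphere d => f i p) := by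
  classical
  obtain ⟨q, hq⟩ : ∃ q : Fin m → UnitSphere d, Function.Injective q ∧ ∀ i, q i ∈ D := by
    have := hinf.to_subtype
    refine ⟨fun i => (Infinite.natEmbedding D i : UnitSphere d), fun i j hij => ?_, fun i =>
      Subtype.coe_prop _⟩
    exact Fin.ext ((Infinite.natEmbedding D).injective (Subtype.ext hij))
  let f : Fin m → AmbientSpace d → ℝ := fun i x =>
    ∏ j ∈ Finset.univ.erase i, ‖x - (q j : AmbientSpace d)‖ ^ 2
  have hf : ∀ i, ContDiff ℝ ∞ (f i) := fun i =>
    contDiff_prod fun j _ => (contDiff_id.sub contDiff_const).norm_sq ℝ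
  refine ⟨f, hf, fun hL => ?_⟩
  rw [Fintype.linearIndependent_iff]
  intro c hc i
  have hpos : (surfaceMeasure d).IsOpenPosMeasure := by unfold surfaceMeasure; infer_instance
  have h1 : (fun p : UnitSphere d => ∑ j, c j * f j p) =ᵐ[(surfaceMeasure d).restrict D]
      fun _ => 0 := by
    have h2 : ∀ᵐ p : UnitSphere d ∂domainMeasure D, ∀ j,
        (hL j).toLp (fun p : UnitSphere d => f j p) p = f j p :=
      ae_all_iff.2 fun j => (hL j).coeFn_toLp
    have h3 : ∀ᵐ p : UnitSphere d ∂domainMeasure D, ∀ j,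
        (c j • (hL j).toLp (fun p : UnitSphere d => f j p)) p =
          c j • (hL j).toLp (fun p : UnitSphere d => f j p) p :=
      ae_all_iff.2 fun j => Lp.coeFn_smul _ _
    have h4 := Lp.coeFn_finsetSum Finset.univ
      (fun j => c j • (hL j).toLp (fun p : UnitSphere d => f j p))
    rw [hc] at h4
    filter_upwards [h2, h3, h4, Lp.coeFn_zero ℝ 2 (domainMeasure D)] with p e2 e3 e4 e5
    rw [e5, Pi.zero_apply] at e4
    rw [e4]
    simp [e2, e3]
  have hcont : Continuous fun p : UnitSphere d => ∑ j, c j * f j p :=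
    continuous_finsetSum _ fun j _ =>
      continuous_const.mul ((hf j).continuous.comp continuous_subtype_val)
  have h2 := Measure.eqOn_open_of_ae_eq h1 hD hcont.continuousOn continuousOn_const (hq.2 i)
  beta_reduce at h2
  rw [Finset.sum_eq_single i] at h2
  · refine (mul_eq_zero.1 h2).resolve_right (Finset.prod_ne_zero_iff.2 fun j hj => ?_)
    refine pow_ne_zero 2 (norm_ne_zero_iff.2 (sub_ne_zero.2 fun h0 => ?_))
    exact Finset.ne_of_mem_erase hj (hq.1 (Subtype.ext h0)).symm
  · intro j _ hj
    have : f j (q i) = 0 := Finset.prod_eq_zero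
      (Finset.mem_erase.2 ⟨hj.symm, Finset.mem_univ i⟩) (by simp)
    rw [this, mul_zero]
  · exact fun h => absurd (Finset.mem_univ i) h

theorem pairFst_mkPair {u : UnitSphere d → ℝ} {G : UnitSphere d → AmbientSpace d}
    {hu : MemLp u 2 (domainMeasure D)} {hG : MemLp G 2 (domainMeasure D)}
    {V : Submodule ℝ (L2Pair (AmbientSpace d) (domainMeasure D))} (h : mkPair hu hG ∈ V) :
    pairFst V ⟨mkPair hu hG, h⟩ = hu.toLp u := rfl

theorem pairSnd_mkPair {u : UnitSphere d → ℝ} {G : UnitSphere d → AmbientSpace d}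
    {hu : MemLp u 2 (domainMeasure D)} {hG : MemLp G 2 (domainMeasure D)}
    {V : Submodule ℝ (L2Pair (AmbientSpace d) (domainMeasure D))} (h : mkPair hu hG ∈ V) :
    pairSnd V ⟨mkPair hu hG, h⟩ = hG.toLp G := rfl

theorem pairFst_mem_neumannEigenspace (x : weakGradientPairs D) {ν : ℝ}
    (hx : ∀ y, ⟪pairSnd (weakGradientPairs D) x, pairSnd (weakGradientPairs D) y⟫ =
      ν * ⟪pairFst (weakGradientPairs D) x, pairFst (weakGradientPairs D) y⟫) :
    pairFst (weakGradientPairs D) x ∈ neumannEigenspace D ν := by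
  obtain ⟨x, hxV⟩ := x
  have hxw := hxV
  rw [← mkPair_coe x, mkPair_mem_weakGradientPairs_iff] at hxw
  refine ⟨x.snd, hxw, fun v H hv => ?_⟩
  have hy := (mkPair_mem_weakGradientPairs_iff hv.memLp hv.memLp_grad).2 hv
  have h1 := hx ⟨_, hy⟩
  rw [pairFst_mkPair, pairSnd_mkPair,
    show pairSnd _ ⟨x, hxV⟩ = (Lp.memLp x.snd).toLp _ from (Lp.toLp_coeFn _ _).symm,
    show pairFst _ ⟨x, hxV⟩ = (Lp.memLp x.fst).toLp _ from (Lp.toLp_coeFn _ _).symm,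
    inner_toLp_toLp, inner_toLp_toLp] at h1
  rw [h1]
  simp only [RCLike.inner_apply, conj_trivial, mul_comm]
  rfl

theorem IsSphericalRellichSet.exists_le_neumannCount (hR : IsSphericalRellichSet D)
    (hD : IsOpen D) (hinf : D.Infinite) (m : ℕ) :
    ∃ t, (m : Cardinal) ≤ neumannCount D t := by
  obtain ⟨f, hf, hli⟩ := exists_linearIndependent_contDiff hD hinf m
  have hG := fun i => hasWeakGradient_of_contDiff D (hf i)
  have hmem := fun i =>
    (mkPair_mem_weakGradientPairs_iff (hG i).memLp (hG i).memLp_grad).2 (hG i)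
  have hli' := hli fun i => (hG i).memLp
  unfold neumannCount
  refine (isGraphPair_pairFst_pairSnd _).exists_le_rank_iSup hR.isCompactOperator
    (neumannEigenspace D) (fun x ν hx => pairFst_mem_neumannEigenspace x hx)
    (v := fun i => ⟨mkPair (hG i).memLp (hG i).memLp_grad, hmem i⟩) ?_
  simp only [pairFst_mkPair]
  exact hli'

theorem hasWeakGradient_const (D : Set (UnitSphere d)) (c : ℝ) :
    HasWeakGradient D (fun _ => c) 0 := by
  have := hasWeakGradient_of_contDiff D (f := fun _ => c) contDiff_const
  have e : (tangentialGradient fun _ : AmbientSpace d => c) = 0 := by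
    ext p; simp [tangentialGradient, gradient]
  rwa [e] at this

/-- For `μ ≠ 0`, testing with the constant `1` shows that `u` has mean zero, so subtracting `c`
cannot decrease its norm and `∫ u² ≤ Λ μ ∫ u²` with `Λ μ < 1`. For `μ = 0` the gradient vanishes and
the Poincaré inequality itself gives the constant. -/
theorem SatisfiesPoincare.ae_eq_const {Λ : ℝ} (hP : SatisfiesPoincare D Λ) (hΛ : 0 < Λ)
    {μ : ℝ} (hμ : μ < Λ⁻¹) {u : UnitSphere d → ℝ} (hu : IsNeumannSolution D μ u) :
    ∃ c : ℝ, u =ᵐ[domainMeasure D] fun _ => c := by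
  obtain ⟨G, hG, hw⟩ := hu
  obtain ⟨c, hc⟩ := hP u G hG
  have hint : Integrable (fun p => u p ^ 2) (domainMeasure D) := hG.memLp.integrable_sq
  have hui : Integrable u (domainMeasure D) := hG.memLp.integrable (by norm_num)
  have hintc : Integrable (fun p => (u p - c) ^ 2) (domainMeasure D) :=
    (hG.memLp.sub (memLp_const c)).integrable_sq
  have h1 := hw u G hG
  have h2 := hw _ 0 (hasWeakGradient_const D 1)
  simp only [real_inner_self_eq_norm_sq, Pi.zero_apply, inner_zero_right, integral_zero,
    mul_one, ← sq] at h1 h2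
  rw [h1] at hc
  set A := ∫ p, u p ^ 2 ∂domainMeasure D
  have hA : 0 ≤ A := integral_nonneg fun p => sq_nonneg _
  have hzero : ∀ g : UnitSphere d → ℝ, Integrable (fun p => g p ^ 2) (domainMeasure D) →
      ∫ p, g p ^ 2 ∂domainMeasure D ≤ 0 → g =ᵐ[domainMeasure D] 0 := fun g hg hle => by
    have := (integral_eq_zero_iff_of_nonneg (fun p => sq_nonneg (g p)) hg).1
      (le_antisymm hle (integral_nonneg fun p => sq_nonneg _))
    exact this.mono fun p hp => pow_eq_zero_iff two_ne_zero |>.1 hp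
  rcases eq_or_ne μ 0 with rfl | hμ0
  · refine ⟨c, (hzero (fun p => u p - c) hintc (by simpa using hc)).mono fun p hp => ?_⟩
    exact sub_eq_zero.1 hp
  · refine ⟨0, hzero u hint ?_⟩
    have hmean : ∫ p, u p ∂domainMeasure D = 0 := (mul_eq_zero.1 h2.symm).resolve_left hμ0
    have hle : A ≤ ∫ p, (u p - c) ^ 2 ∂domainMeasure D := by
      have e : ∀ p, (u p - c) ^ 2 = u p ^ 2 - 2 * c * u p + c ^ 2 := fun p => by ring
      simp only [e]
      have hi : Integrable (fun p => u p ^ 2 - 2 * c * u p) (domainMeasure D) :=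
        hint.sub (hui.const_mul _)
      rw [integral_add hi (integrable_const _),
        integral_sub hint (hui.const_mul _), integral_const_mul, hmean]
      have : 0 ≤ ∫ _ : UnitSphere d, c ^ 2 ∂domainMeasure D :=
        integral_nonneg fun _ => sq_nonneg c
      linarith
    have h3 := hle.trans hc
    by_contra hlt
    rw [not_le] at hlt
    have h4 : Λ * μ < 1 := by
      have := mul_lt_mul_of_pos_left hμ hΛ
      rwa [mul_inv_cancel₀ hΛ.ne'] at this
    nlinarith

/-- Below `Λ⁻¹` all eigenspaces consist of constants, so the count is at most one, less than `j +
1`. The hypothesis `hne` excludes the default value `0` of an empty infimum. -/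
theorem SatisfiesPoincare.le_neumannEigenvalue {Λ : ℝ} (hP : SatisfiesPoincare D Λ) (hΛ : 0 < Λ)
    {j : ℕ} (hj : 1 ≤ j) (hne : ∃ t, ((j + 1 : ℕ) : Cardinal) ≤ neumannCount D t) :
    Λ⁻¹ ≤ neumannEigenvalue D j := by
  refine le_csInf hne fun t ht => ?_
  by_contra hlt
  rw [not_le] at hlt
  set one : Lp ℝ 2 (domainMeasure D) := (memLp_const (1 : ℝ)).toLp _
  have hsub : (⨆ μ ∈ Set.Iic t, neumannEigenspace D μ) ≤ Submodule.span ℝ {one} := by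
    refine iSup₂_le fun μ hμ u hu => ?_
    obtain ⟨c, hc⟩ := hP.ae_eq_const hΛ ((Set.mem_Iic.1 hμ).trans_lt hlt)
      (show IsNeumannSolution D μ u from hu)
    refine Submodule.mem_span_singleton.2 ⟨c, Lp.ext ?_⟩
    filter_upwards [hc, Lp.coeFn_smul c one,
      (memLp_const (μ := domainMeasure D) (p := 2) (1 : ℝ)).coeFn_toLp] with p h1 h2 h3
    rw [h2, h1, Pi.smul_apply, h3, smul_eq_mul, mul_one]
  have h1 : neumannCount D t ≤ 1 :=
    (Submodule.rank_mono hsub).trans ((rank_span_le _).trans (Cardinal.mk_singleton _).le)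
  have h2 : ((j + 1 : ℕ) : Cardinal) ≤ (1 : ℕ) := by
    rw [Nat.cast_one]
    exact (show ((j + 1 : ℕ) : Cardinal) ≤ neumannCount D t from ht).trans h1
  have := Nat.cast_le.1 h2
  omega

end NeumannSpectrum

/-! ### Rellich and Poincaré estimates through a chart with bounded density -/

section ControlledChart

variable {E : Type*} [NormedAddCommGroup E] [InnerProductSpace ℝ E]
  [FiniteDimensional ℝ E] [MeasurableSpace E] [BorelSpace E]
  {d : ℕ} {e : E → AmbientSpace d} {Ω : Set E} {h : IsSphereChart e Ω} {ρ : E → ℝ} {m M K : ℝ}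

/-- A chart with density `m ≤ ρ ≤ M` and derivative bounded by `K`. -/
structure IsControlledChart (h : IsSphereChart e Ω) (ρ : E → ℝ) (m M K : ℝ) : Prop where
  hasChartDensity : HasChartDensity h ρ
  measurable : Measurable ρ
  contDiffAt : ∀ x ∈ Ω, ContDiffAt ℝ ∞ ρ x
  pos : 0 < m
  le_density : ∀ x ∈ Ω, m ≤ ρ x
  density_le : ∀ x ∈ Ω, ρ x ≤ M
  norm_fderiv_le : ∀ x ∈ Ω, ‖fderiv ℝ e x‖ ≤ K

theorem IsControlledChart.integral_norm_sq {F : Type*} [NormedAddCommGroup F]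
    (hc : IsControlledChart h ρ m M K)
    {f : UnitSphere d → F} (hf : MemLp f 2 (domainMeasure (sphereMap h.norm_eq_one '' Ω))) :
    ∫ p, ‖f p‖ ^ 2 ∂domainMeasure (sphereMap h.norm_eq_one '' Ω) =
      ∫ x in Ω, ρ x * ‖f (sphereMap h.norm_eq_one x)‖ ^ 2 :=
  hc.hasChartDensity.integral_eq (f := fun p => ‖f p‖ ^ 2) hc.measurable
    (fun x hx => hc.pos.trans_le (hc.le_density x hx)) (hf.aestronglyMeasurable.norm.pow 2)

theorem IsControlledChart.integrable_density_mul {F : Type*} [NormedAddCommGroup F]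
    (hc : IsControlledChart h ρ m M K)
    {f : UnitSphere d → F} (hf : MemLp f 2 (domainMeasure (sphereMap h.norm_eq_one '' Ω))) :
    IntegrableOn (fun x => ρ x * ‖f (sphereMap h.norm_eq_one x)‖ ^ 2) Ω := by
  have hi := (hc.hasChartDensity.memLp_comp hc.measurable hc.pos hc.le_density hf).integrable_norm_pow
    (by simp)
  refine hi.bdd_mul (c := M) hc.measurable.aestronglyMeasurable ?_
  filter_upwards [ae_restrict_mem h.isOpen.measurableSet] with x hx
  rw [Real.norm_of_nonneg (hc.pos.le.trans (hc.le_density x hx))]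
  exact hc.density_le x hx

theorem IsControlledChart.integral_comp_le {F : Type*} [NormedAddCommGroup F]
    (hc : IsControlledChart h ρ m M K)
    {f : UnitSphere d → F} (hf : MemLp f 2 (domainMeasure (sphereMap h.norm_eq_one '' Ω))) :
    ∫ x in Ω, ‖f (sphereMap h.norm_eq_one x)‖ ^ 2 ≤
      m⁻¹ * ∫ p, ‖f p‖ ^ 2 ∂domainMeasure (sphereMap h.norm_eq_one '' Ω) := by
  have hi := (hc.hasChartDensity.memLp_comp hc.measurable hc.pos hc.le_density hf).integrable_norm_pow
    (by simp)
  rw [hc.integral_norm_sq hf, ← div_eq_inv_mul, le_div_iff₀' hc.pos, ← integral_const_mul]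
  refine setIntegral_mono_on (hi.const_mul m) (hc.integrable_density_mul hf)
    h.isOpen.measurableSet fun x hx => ?_
  gcongr
  exact hc.le_density x hx

theorem IsControlledChart.integral_le {F : Type*} [NormedAddCommGroup F]
    (hc : IsControlledChart h ρ m M K)
    {f : UnitSphere d → F} (hf : MemLp f 2 (domainMeasure (sphereMap h.norm_eq_one '' Ω))) :
    ∫ p, ‖f p‖ ^ 2 ∂domainMeasure (sphereMap h.norm_eq_one '' Ω) ≤
      M * ∫ x in Ω, ‖f (sphereMap h.norm_eq_one x)‖ ^ 2 := by
  have hi := (hc.hasChartDensity.memLp_comp hc.measurable hc.pos hc.le_density hf).integrable_norm_pow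
    (by simp)
  rw [hc.integral_norm_sq hf, ← integral_const_mul]
  refine setIntegral_mono_on (hc.integrable_density_mul hf) (hi.const_mul M)
    h.isOpen.measurableSet fun x hx => ?_
  gcongr
  exact hc.density_le x hx

theorem IsControlledChart.integral_adjoint_le (hc : IsControlledChart h ρ m M K)
    {G : UnitSphere d → AmbientSpace d}
    (hG : MemLp G 2 (domainMeasure (sphereMap h.norm_eq_one '' Ω))) :
    ∫ x in Ω, ‖(fderiv ℝ e x).adjoint (G (sphereMap h.norm_eq_one x))‖ ^ 2 ≤
      K ^ 2 * m⁻¹ * ∫ p, ‖G p‖ ^ 2 ∂domainMeasure (sphereMap h.norm_eq_one '' Ω) := by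
  have hi := (hc.hasChartDensity.memLp_comp hc.measurable hc.pos hc.le_density hG).integrable_norm_pow
    (by simp)
  rw [mul_assoc]
  refine le_trans ?_ (mul_le_mul_of_nonneg_left (hc.integral_comp_le hG) (sq_nonneg K))
  rw [← integral_const_mul]
  refine integral_mono_of_nonneg (ae_of_all _ fun x => sq_nonneg _) (hi.const_mul _) ?_
  filter_upwards [ae_restrict_mem h.isOpen.measurableSet] with x hx
  rw [← mul_pow]
  refine pow_le_pow_left₀ (norm_nonneg _) ((ContinuousLinearMap.le_opNorm _ _).trans ?_) 2
  rw [LinearIsometryEquiv.norm_map]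
  gcongr
  exact hc.norm_fderiv_le x hx

theorem IsControlledChart.hasEuclideanWeakGradient (hc : IsControlledChart h ρ m M K)
    (hfin : Module.finrank ℝ (E × ℝ) = Module.finrank ℝ (AmbientSpace d))
    {u : UnitSphere d → ℝ} {G : UnitSphere d → AmbientSpace d}
    (hu : HasWeakGradient (sphereMap h.norm_eq_one '' Ω) u G) :
    HasEuclideanWeakGradient Ω (fun x => u (sphereMap h.norm_eq_one x))
      (fun x => (fderiv ℝ e x).adjoint (G (sphereMap h.norm_eq_one x))) :=
  hu.hasEuclideanWeakGradient hc.hasChartDensity hc.measurable hc.pos hc.le_density hc.contDiffAt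
    hc.norm_fderiv_le hfin

theorem IsControlledChart.isSphericalRellichSet (hc : IsControlledChart h ρ m M K)
    (hfin : Module.finrank ℝ (E × ℝ) = Module.finrank ℝ (AmbientSpace d))
    (hR : IsRellichSet Ω Ω) (hM : 0 < M) :
    IsSphericalRellichSet (sphereMap h.norm_eq_one '' Ω) := by
  intro ε hε
  have hm := hc.pos
  -- Passing to the chart and back costs `M / m`, and the gradient costs a further `K ^ 2`.
  obtain ⟨S, hS, hSw⟩ := hR.exists_finset (ε := ε * m / (M * (1 + K ^ 2))) (by positivity)
  choose! k' hk' hk'u using fun k hk => hc.hasChartDensity.exists_memLp_pullback hc.measurable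
    hc.pos hc.le_density hc.density_le (hS k hk)
  refine ⟨k' '' S, S.finite_toSet.image _, ?_, fun u G hu h0 => ?_⟩
  · rintro _ ⟨k, hk, rfl⟩
    exact hk' k hk
  · have h1 := hSw _ _ (hc.hasEuclideanWeakGradient hfin hu) fun k hk => by
      rw [← hk'u k hk u hu.memLp]
      exact h0 _ ⟨k, hk, rfl⟩
    have h2 := hc.integral_le hu.memLp
    have h3 := hc.integral_comp_le hu.memLp
    have h4 := hc.integral_adjoint_le hu.memLp_grad
    simp only [Real.norm_eq_abs, sq_abs] at h2 h3
    set A := ∫ p, u p ^ 2 ∂domainMeasure (sphereMap h.norm_eq_one '' Ω)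
    set B := ∫ p, ‖G p‖ ^ 2 ∂domainMeasure (sphereMap h.norm_eq_one '' Ω)
    set a := ∫ x in Ω, u (sphereMap h.norm_eq_one x) ^ 2
    set b := ∫ x in Ω, ‖(fderiv ℝ e x).adjoint (G (sphereMap h.norm_eq_one x))‖ ^ 2
    have hA : 0 ≤ A := integral_nonneg fun p => sq_nonneg _
    have hB : 0 ≤ B := integral_nonneg fun p => sq_nonneg _
    calc A ≤ M * a := h2
      _ ≤ M * (ε * m / (M * (1 + K ^ 2)) * (a + b)) := by gcongr
      _ ≤ M * (ε * m / (M * (1 + K ^ 2)) * (m⁻¹ * A + K ^ 2 * m⁻¹ * B)) := by gcongr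
      _ = ε * ((A + K ^ 2 * B) / (1 + K ^ 2)) := by field_simp
      _ ≤ ε * (A + B) := by
        gcongr
        rw [div_le_iff₀ (by positivity)]
        nlinarith [mul_nonneg (sq_nonneg K) hA]

theorem IsControlledChart.satisfiesPoincare (hc : IsControlledChart h ρ m M K)
    (hfin : Module.finrank ℝ (E × ℝ) = Module.finrank ℝ (AmbientSpace d))
    (hΩ : volume Ω ≠ ⊤) (hne : Ω.Nonempty) {C : ℝ} (hC0 : 0 ≤ C) (hM : 0 < M)
    (hC : ∀ (w : E → ℝ) (G : E → E), HasEuclideanWeakGradient Ω w G →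
      ∫ x in Ω, w x = 0 → ∫ x in Ω, w x ^ 2 ≤ C * ∫ x in Ω, ‖G x‖ ^ 2) :
    SatisfiesPoincare (sphereMap h.norm_eq_one '' Ω) (M * (C * (K ^ 2 * m⁻¹))) := by
  intro u G hu
  have : IsFiniteMeasure (volume.restrict Ω) := ⟨by simpa using hΩ.lt_top⟩
  have hint : IntegrableOn (fun x => u (sphereMap h.norm_eq_one x)) Ω :=
    (hc.hasEuclideanWeakGradient hfin hu).memLp.integrable (by norm_num)
  -- The mean is taken for Lebesgue measure on `Ω`, not for the surface measure; the spherical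
  -- inequality admits any constant.
  set c := ((volume Ω).toReal)⁻¹ * ∫ x in Ω, u (sphereMap h.norm_eq_one x)
  have hvol : (volume Ω).toReal ≠ 0 :=
    (ENNReal.toReal_pos (h.isOpen.measure_pos volume hne).ne' hΩ).ne'
  have huc : HasWeakGradient (sphereMap h.norm_eq_one '' Ω) (fun p => u p - c) G := by
    have := hu.add (hasWeakGradient_const (sphereMap h.norm_eq_one '' Ω) (-c))
    rw [add_zero] at this
    exact this
  refine ⟨c, ?_⟩
  have h1 := hC _ _ (hc.hasEuclideanWeakGradient hfin huc) (by
    rw [integral_sub hint (integrable_const c), setIntegral_const, smul_eq_mul, Measure.real]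
    simp only [c]
    rw [mul_inv_cancel_left₀ hvol, sub_self])
  have h2 := hc.integral_le huc.memLp
  have h4 := hc.integral_adjoint_le huc.memLp_grad
  simp only [Real.norm_eq_abs, sq_abs] at h2
  refine h2.trans ?_
  rw [mul_assoc]
  refine mul_le_mul_of_nonneg_left (h1.trans ?_) hM.le
  rw [mul_assoc]
  exact mul_le_mul_of_nonneg_left h4 hC0

end ControlledChart

/-! ### Cosine and sine as smooth functions of the squared radius -/

section TrigonometricSeries

/-- The power series with coefficients `(-1) ^ n / (2 n + i)!`; for `i = 0, 1` it is `cos √s` and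
`sin √s / √s`. -/
noncomputable def trigSeries (i : ℕ) (s : ℝ) : ℝ :=
  ∑' n : ℕ, ((-1) ^ n / ((2 * n + i).factorial : ℝ)) * s ^ n

/-- The coefficient ratios tend to zero, so the series is entire. Since `‖x‖ ^ 2` is smooth at the
origin while `‖x‖` is not, this makes the exponential map smooth at the pole. -/
theorem contDiff_trigSeries (i : ℕ) : ContDiff ℝ ∞ (trigSeries i) := by
  set c : ℕ → ℝ := fun n => (-1) ^ n / ((2 * n + i).factorial : ℝ)
  have hcn : ∀ n, ‖c n‖ = ((2 * n + i).factorial : ℝ)⁻¹ := fun n => by simp [c]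
  have hr : (FormalMultilinearSeries.ofScalars ℝ c).radius = ⊤ := by
    refine FormalMultilinearSeries.ofScalars_radius_eq_top_of_tendsto ℝ c
      (Eventually.of_forall fun n => ?_) ?_
    · rw [← norm_ne_zero_iff, hcn]
      positivity
    · refine squeeze_zero (fun n => by positivity) (fun n => ?_)
        tendsto_one_div_add_atTop_nhds_zero_nat
      rw [hcn, hcn, inv_div_inv, div_le_div_iff₀ (by positivity) (by positivity), one_mul]
      have h1 : (2 * n.succ + i).factorial =
          (2 * n + i + 2) * ((2 * n + i + 1) * (2 * n + i).factorial) := by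
        rw [show 2 * n.succ + i = 2 * n + i + 1 + 1 by omega, Nat.factorial_succ,
          Nat.factorial_succ]
      have h2 : (2 * n + i).factorial * (n + 1) ≤ (2 * n.succ + i).factorial := by
        rw [h1]
        have : n + 1 ≤ (2 * n + i + 2) * (2 * n + i + 1) := by nlinarith
        calc (2 * n + i).factorial * (n + 1)
            ≤ (2 * n + i).factorial * ((2 * n + i + 2) * (2 * n + i + 1)) := by gcongr
          _ = _ := by ring
      exact_mod_cast h2
  have h1 := (FormalMultilinearSeries.ofScalars ℝ c).hasFPowerSeriesOnBall (by rw [hr]; simp)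
  have h2 := h1.analyticOnNhd
  rw [hr] at h2
  have h3 : (FormalMultilinearSeries.ofScalars ℝ c).sum = trigSeries i := by
    ext s
    rw [show (FormalMultilinearSeries.ofScalars ℝ c).sum s =
      FormalMultilinearSeries.ofScalarsSum c s from rfl, FormalMultilinearSeries.ofScalars_sum_eq]
    rfl
  rw [h3] at h2
  rw [contDiff_iff_contDiffAt]
  exact fun s => (h2 s (by simp)).contDiffAt

theorem trigSeries_zero_sq (r : ℝ) : trigSeries 0 (r ^ 2) = Real.cos r := by
  rw [← (Real.hasSum_cos r).tsum_eq, trigSeries]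
  refine tsum_congr fun n => ?_
  rw [add_zero, pow_mul]
  ring

theorem mul_trigSeries_one_sq (r : ℝ) : r * trigSeries 1 (r ^ 2) = Real.sin r := by
  rw [← (Real.hasSum_sin r).tsum_eq, trigSeries, ← tsum_mul_left]
  refine tsum_congr fun n => ?_
  rw [pow_succ r (2 * n), pow_mul]
  ring

theorem trigSeries_one_zero : trigSeries 1 0 = 1 := by
  rw [trigSeries, tsum_eq_single 0]
  · simp
  · intro n hn
    simp [hn]

theorem trigSeries_one_sq_pos {r : ℝ} (h0 : 0 ≤ r) (h1 : r < Real.pi) :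
    0 < trigSeries 1 (r ^ 2) := by
  rcases h0.eq_or_lt with rfl | h0
  · rw [zero_pow two_ne_zero, trigSeries_one_zero]
    exact one_pos
  · have := Real.sin_pos_of_pos_of_lt_pi h0 h1
    rw [← mul_trigSeries_one_sq] at this
    exact pos_of_mul_pos_right this h0.le

/-- Differentiating `trigSeries 0 (r ^ 2) = cos r` would otherwise give `sin r = 0`. -/
theorem deriv_trigSeries_zero_sq_ne_zero {r : ℝ} (h0 : 0 < r) (h1 : r < Real.pi) :
    deriv (trigSeries 0) (r ^ 2) ≠ 0 := by
  intro h
  have hd : HasDerivAt (trigSeries 0) 0 (r ^ 2) := by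
    rw [← h]
    exact ((contDiff_trigSeries 0).differentiable (by simp) _).hasDerivAt
  have h2 : HasDerivAt (fun r : ℝ => trigSeries 0 (r ^ 2)) (0 * (2 * r)) r := by
    have hp : HasDerivAt (fun r : ℝ => r ^ 2) (2 * r) r := by simpa using hasDerivAt_pow 2 r
    exact HasDerivAt.comp (h := fun r : ℝ => r ^ 2) r hd hp
  simp only [trigSeries_zero_sq] at h2
  have h3 := h2.unique (Real.hasDerivAt_cos r)
  have := Real.sin_pos_of_pos_of_lt_pi h0 h1
  linarith

end TrigonometricSeries

/-! ### The exponential map at the north pole and its inverse on the hemisphere -/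

section PolarMap

variable {d : ℕ}

theorem norm_northPole (d : ℕ) : ‖northPole d‖ = 1 := by simp [northPole]

/-- The space orthogonal to the north pole. -/
abbrev Equator (d : ℕ) : Type := (Submodule.span ℝ {northPole d})ᗮ

theorem inner_northPole_equator (x : Equator d) : ⟪northPole d, (x : AmbientSpace d)⟫ = 0 :=
  Submodule.mem_orthogonal_singleton_iff_inner_right.1 x.2

theorem finrank_equator (d : ℕ) : Module.finrank ℝ (Equator d) = d := by
  have : Fact (Module.finrank ℝ (AmbientSpace d) = d + 1) := ⟨by simp⟩
  refine Submodule.finrank_orthogonal_span_singleton fun h => ?_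
  have := norm_northPole d
  rw [h, norm_zero] at this
  exact zero_ne_one this

/-- The exponential map of the sphere at the north pole. -/
noncomputable def polarMap (x : Equator d) : AmbientSpace d :=
  trigSeries 0 (‖x‖ ^ 2) • northPole d + trigSeries 1 (‖x‖ ^ 2) • (x : AmbientSpace d)

theorem contDiff_polarMap : ContDiff ℝ ∞ (polarMap (d := d)) := by
  have hn : ContDiff ℝ ∞ fun x : Equator d => ‖x‖ ^ 2 := contDiff_norm_sq ℝ
  exact (((contDiff_trigSeries 0).comp hn).smul contDiff_const).add
    (((contDiff_trigSeries 1).comp hn).smul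
      (Submodule.subtypeL (Submodule.span ℝ {northPole d})ᗮ).contDiff)

theorem inner_northPole_polarMap (x : Equator d) :
    ⟪northPole d, polarMap x⟫ = Real.cos ‖x‖ := by
  rw [polarMap, inner_add_right, real_inner_smul_right, real_inner_smul_right,
    inner_northPole_equator, real_inner_self_eq_norm_sq, norm_northPole, trigSeries_zero_sq]
  ring

theorem norm_polarMap (x : Equator d) : ‖polarMap x‖ = 1 := by
  have h : ‖polarMap x‖ ^ 2 = 1 := by
    rw [polarMap, norm_add_sq_real, real_inner_smul_left, real_inner_smul_right,
      inner_northPole_equator, norm_smul, norm_smul, norm_northPole, mul_pow, mul_pow,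
      trigSeries_zero_sq, Real.norm_eq_abs, Real.norm_eq_abs, sq_abs, sq_abs]
    have h1 := mul_trigSeries_one_sq ‖x‖
    have h2 := Real.sin_sq_add_cos_sq ‖x‖
    rw [← h1] at h2
    rw [Submodule.coe_norm] at *
    linarith
  nlinarith [norm_nonneg (polarMap x)]

/-- The component along the pole is `cos ‖x‖`, which determines the radius; the remaining component
is then a fixed nonzero multiple of `x`. -/
theorem injOn_polarMap : Set.InjOn (polarMap (d := d)) (ball 0 Real.pi) := by
  intro x hx y hy hxy
  rw [mem_ball_zero_iff] at hx hy
  have h1 := congrArg (fun z => ⟪northPole d, z⟫) hxy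
  simp only [inner_northPole_polarMap] at h1
  have h2 := Real.injOn_cos ⟨norm_nonneg x, hx.le⟩ ⟨norm_nonneg y, hy.le⟩ h1
  rw [polarMap, polarMap, h2] at hxy
  exact Subtype.ext (smul_right_injective _
    (trigSeries_one_sq_pos (norm_nonneg y) hy).ne' (add_left_cancel hxy))

theorem hasFDerivAt_polarMap_apply (x w : Equator d) :
    fderiv ℝ (polarMap (d := d)) x w =
      (deriv (trigSeries 0) (‖x‖ ^ 2) * (2 * ⟪x, w⟫)) • northPole d +
      (trigSeries 1 (‖x‖ ^ 2) • (w : AmbientSpace d) +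
        (deriv (trigSeries 1) (‖x‖ ^ 2) * (2 * ⟪x, w⟫)) • (x : AmbientSpace d)) := by
  have hn : HasFDerivAt (fun x : Equator d => ‖x‖ ^ 2) (2 • innerSL ℝ x) x :=
    (hasStrictFDerivAt_norm_sq x).hasFDerivAt
  have ht : ∀ i, HasFDerivAt (fun x : Equator d => trigSeries i (‖x‖ ^ 2))
      (deriv (trigSeries i) (‖x‖ ^ 2) • (2 • innerSL ℝ x)) x := fun i =>
    ((contDiff_trigSeries i).differentiable (by simp) _).hasDerivAt.comp_hasFDerivAt x hn
  have hs : HasFDerivAt (fun x : Equator d => (x : AmbientSpace d))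
      (Submodule.subtypeL (Submodule.span ℝ {northPole d})ᗮ) x :=
    (Submodule.subtypeL (Submodule.span ℝ {northPole d})ᗮ).hasFDerivAt
  have h := ((ht 0).smul_const (northPole d)).add ((ht 1).smul hs)
  rw [show fderiv ℝ (polarMap (d := d)) x = _ from h.fderiv]
  simp

/-- The component along the pole forces `w` to be orthogonal to `x`; on such vectors the derivative
is multiplication by `sin ‖x‖ / ‖x‖`, understood as `1` at the origin. -/
theorem polarMap_immersion {x : Equator d} (hx : ‖x‖ < Real.pi) (w : Equator d)
    (hw : fderiv ℝ (polarMap (d := d)) x w = 0) : w = 0 := by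
  rw [hasFDerivAt_polarMap_apply] at hw
  have hxw : ⟪x, w⟫ = 0 := by
    rcases eq_or_ne x 0 with rfl | hx0
    · exact inner_zero_left _
    · have h1 := congrArg (fun z => ⟪northPole d, z⟫) hw
      simp only [inner_add_right, real_inner_smul_right, inner_northPole_equator,
        real_inner_self_eq_norm_sq, norm_northPole, inner_zero_right] at h1
      have h2 := deriv_trigSeries_zero_sq_ne_zero (norm_pos_iff.2 hx0) hx
      have h3 : deriv (trigSeries 0) (‖x‖ ^ 2) * (2 * ⟪x, w⟫) = 0 := by linarith
      linarith [(mul_eq_zero.1 h3).resolve_left h2]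
  rw [hxw] at hw
  simp only [mul_zero, zero_smul, zero_add, add_zero, smul_eq_zero,
    (trigSeries_one_sq_pos (norm_nonneg x) hx).ne', false_or] at hw
  exact Subtype.ext hw

/-- In normal coordinates the dilation is linear, which is what puts all `D_α` over one parameter
set. At the pole the direction is `0`, harmlessly, because the dilated radius is `0` as well. -/
theorem polarDilation_polarMap {x : Equator d} (hx : ‖x‖ < Real.pi) {α : ℝ} (hα : 0 ≤ α)
    {p : UnitSphere d} (hp : (p : AmbientSpace d) = polarMap x) :
    polarDilation α p = polarMap (α • x) := by
  have hr : polarRadius p = ‖x‖ := by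
    rw [polarRadius, InnerProductGeometry.angle, hp, inner_northPole_polarMap, norm_northPole,
      norm_polarMap, mul_one, div_one, Real.arccos_cos (norm_nonneg x) hx.le]
  have hk := trigSeries_one_sq_pos (norm_nonneg x) hx
  have hq : (p : AmbientSpace d) - ⟪northPole d, (p : AmbientSpace d)⟫ • northPole d =
      trigSeries 1 (‖x‖ ^ 2) • (x : AmbientSpace d) := by
    rw [hp, inner_northPole_polarMap, polarMap, trigSeries_zero_sq, add_sub_cancel_left]
  have hd : polarDirection p = ‖x‖⁻¹ • (x : AmbientSpace d) := by
    rw [polarDirection, hq, norm_smul, Real.norm_of_nonneg hk.le, mul_inv, smul_smul,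
      ← Submodule.coe_norm]
    congr 1
    rw [mul_right_comm, inv_mul_cancel₀ hk.ne', one_mul]
  rw [polarDilation, polarPoint, hr, hd, polarMap, norm_smul, Real.norm_of_nonneg hα,
    trigSeries_zero_sq, ← mul_trigSeries_one_sq]
  rcases eq_or_ne x 0 with rfl | hx0
  · simp
  · have hxn : ‖x‖ ≠ 0 := norm_ne_zero_iff.2 hx0
    rw [Submodule.coe_smul, smul_smul, smul_smul]
    congr 2
    field_simp

/-- The inverse of the exponential map at the north pole. -/
noncomputable def polarInverse (p : UnitSphere d) : Equator d :=
  (trigSeries 1 (Real.arccos ⟪northPole d, (p : AmbientSpace d)⟫ ^ 2))⁻¹ •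
    Submodule.orthogonalProjectionOnto (Submodule.span ℝ {northPole d})ᗮ (p : AmbientSpace d)

theorem mem_upperHemisphere_iff {p : UnitSphere d} :
    p ∈ upperHemisphere d ↔ 0 < ⟪northPole d, (p : AmbientSpace d)⟫ := by
  have : ⟪northPole d, (p : AmbientSpace d)⟫ = (p : AmbientSpace d) (Fin.last d) := by
    simp [northPole, EuclideanSpace.inner_single_left]
  rw [this]
  rfl

theorem trigSeries_arccos_pos {p : UnitSphere d} (hp : p ∈ upperHemisphere d) :
    0 < trigSeries 1 (Real.arccos ⟪northPole d, (p : AmbientSpace d)⟫ ^ 2) := by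
  have h1 := Real.arccos_lt_pi_div_two.2 (mem_upperHemisphere_iff.1 hp)
  exact trigSeries_one_sq_pos (Real.arccos_nonneg _) (by linarith [Real.pi_pos])

theorem coe_orthogonalProjection_equator (p : AmbientSpace d) :
    (Submodule.orthogonalProjectionOnto (Submodule.span ℝ {northPole d})ᗮ p : AmbientSpace d) =
      p - ⟪northPole d, p⟫ • northPole d := by
  have h := Submodule.starProjection_orthogonal_val (K := Submodule.span ℝ {northPole d}) p
  rw [Submodule.starProjection_unit_singleton ℝ (norm_northPole d)] at h
  exact h

theorem norm_polarInverse {p : UnitSphere d} (hp : p ∈ upperHemisphere d) :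
    ‖polarInverse p‖ = Real.arccos ⟪northPole d, (p : AmbientSpace d)⟫ := by
  set t := ⟪northPole d, (p : AmbientSpace d)⟫ with ht
  have hk := trigSeries_arccos_pos hp
  have hn : ‖(p : AmbientSpace d)‖ = 1 := norm_eq_of_mem_sphere p
  have hle : t ≤ 1 := (real_inner_le_norm _ _).trans (by rw [norm_northPole, hn, one_mul])
  have h0 : 0 < t := mem_upperHemisphere_iff.1 hp
  have hsin : ‖(p : AmbientSpace d) - t • northPole d‖ = Real.sin (Real.arccos t) := by
    rw [Real.sin_arccos]
    refine (Real.sqrt_eq_iff_mul_self_eq (by nlinarith) (norm_nonneg _)).2 ?_ |>.symm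
    rw [← sq, norm_sub_sq_real, hn, norm_smul, norm_northPole, real_inner_smul_right,
      real_inner_comm, ← ht, Real.norm_of_nonneg h0.le]
    ring
  rw [polarInverse, norm_smul, Submodule.coe_norm, coe_orthogonalProjection_equator, ← ht, hsin,
    ← mul_trigSeries_one_sq, norm_inv, Real.norm_of_nonneg hk.le, mul_comm, mul_assoc,
    mul_inv_cancel₀ hk.ne', mul_one]

theorem polarMap_polarInverse {p : UnitSphere d} (hp : p ∈ upperHemisphere d) :
    polarMap (polarInverse p) = p := by
  have hk := trigSeries_arccos_pos hp
  have hn : ‖(p : AmbientSpace d)‖ = 1 := norm_eq_of_mem_sphere p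
  have hle : ⟪northPole d, (p : AmbientSpace d)⟫ ≤ 1 :=
    (real_inner_le_norm _ _).trans (by rw [norm_northPole, hn, one_mul])
  have h0 := mem_upperHemisphere_iff.1 hp
  rw [polarMap, norm_polarInverse hp, polarInverse, Submodule.coe_smul, smul_inv_smul₀ hk.ne',
    trigSeries_zero_sq, Real.cos_arccos (by linarith) hle, coe_orthogonalProjection_equator,
    add_sub_cancel]

theorem continuousOn_polarInverse : ContinuousOn (polarInverse (d := d)) (upperHemisphere d) := by
  have h1 : Continuous fun p : UnitSphere d => ⟪northPole d, (p : AmbientSpace d)⟫ := by fun_prop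
  have h2 : Continuous fun p : UnitSphere d =>
      trigSeries 1 (Real.arccos ⟪northPole d, (p : AmbientSpace d)⟫ ^ 2) :=
    (contDiff_trigSeries 1).continuous.comp ((Real.continuous_arccos.comp h1).pow 2)
  exact (h2.continuousOn.inv₀ fun p hp => (trigSeries_arccos_pos hp).ne').smul
    ((ContinuousLinearMap.continuous _).comp continuous_subtype_val).continuousOn

end PolarMap

/-! ### Estimates for rescaled charts, uniform in the scale -/

section ScaledChart

variable {E : Type*} [NormedAddCommGroup E] [InnerProductSpace ℝ E]
  [FiniteDimensional ℝ E] [MeasurableSpace E] [BorelSpace E]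
  {d : ℕ} {e : E → AmbientSpace d} {Ω : Set E}

omit [FiniteDimensional ℝ E] [MeasurableSpace E] [BorelSpace E] in
theorem fderiv_comp_smul_eq (he : Differentiable ℝ e) (a : ℝ) (x : E) :
    fderiv ℝ (fun y => e (a • y)) x = a • fderiv ℝ e (a • x) := by
  have := (he (a • x)).hasFDerivAt.comp x ((hasFDerivAt_id x).const_smul a)
  rw [show fderiv ℝ (fun y => e (a • y)) x = _ from this.fderiv]
  ext w
  simp

omit [MeasurableSpace E] [BorelSpace E] in
theorem IsSphereChart.isOpen_image (h : IsSphereChart e Ω)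
    (hfin : Module.finrank ℝ (E × ℝ) = Module.finrank ℝ (AmbientSpace d)) :
    IsOpen (sphereMap h.norm_eq_one '' Ω) := by
  rw [isOpen_iff_mem_nhds]
  rintro _ ⟨x, hx, rfl⟩
  obtain ⟨g, -, hg⟩ := h.exists_local_inverse hfin (z := (x, 1)) ⟨hx, Set.mem_Ioi.2 one_pos⟩
  rw [show coneMap e (x, 1) = sphereMap h.norm_eq_one x from one_smul ℝ (e x)] at hg
  filter_upwards [continuous_subtype_val.continuousAt.eventually hg] with q ⟨hq1, hq2⟩
  refine ⟨(g q).1, hq1.1, Subtype.ext ?_⟩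
  have h1 := congrArg (‖·‖) hq2
  simp only [coneMap, norm_smul, h.norm_eq_one, mul_one, norm_eq_of_mem_sphere q,
    Real.norm_of_nonneg (Set.mem_Ioi.1 hq1.2).le] at h1
  rw [coneMap, h1, one_smul] at hq2
  exact hq2

/-- The Jacobian and the derivative of the unscaled map are bounded on the compact set `k`, which
contains all the rescaled points. Hence `m`, `M` and `K` can be fixed before the scale `a`, whose
effect is only the displayed powers. -/
theorem exists_isControlledChart (he : ContDiff ℝ ∞ e) (hn : ∀ x, ‖e x‖ = 1)
    (hfin : Module.finrank ℝ (E × ℝ) = Module.finrank ℝ (AmbientSpace d))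
    {k : Set E} (hk : IsCompact k) (hkn : k.Nonempty)
    (himm : ∀ x ∈ k, ∀ w, fderiv ℝ e x w = 0 → w = 0) :
    ∃ (m M K : ℝ), 0 < m ∧ 0 < M ∧ 0 < K ∧ ∀ (a : ℝ), 0 < a → (∀ x ∈ Ω, a • x ∈ k) →
      ∀ h : IsSphereChart (fun x => e (a • x)) Ω, ∃ ρ : E → ℝ,
        IsControlledChart h ρ (a ^ Module.finrank ℝ E * m) (a ^ Module.finrank ℝ E * M)
          (a * K) := by
  have hed : Differentiable ℝ e := he.differentiable (by simp)
  let L : AmbientSpace d ≃L[ℝ] E × ℝ := ContinuousLinearEquiv.ofFinrankEq hfin.symm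
  obtain ⟨κ, hκ, hdens⟩ := exists_hasChartDensity (E := E) L
  have hJ : ContDiff ℝ ∞ fun x => coneDet L e (x, 1) := contDiff_coneDet L he
  have hJ0 : ∀ x ∈ k, coneDet L e (x, 1) ≠ 0 := fun x hx =>
    coneDet_ne_zero L hed hn (himm x hx)
  obtain ⟨x₀, hx₀, hmin⟩ := hk.exists_isMinOn hkn hJ.continuous.abs.continuousOn
  obtain ⟨x₁, hx₁, hmax⟩ := hk.exists_isMaxOn hkn hJ.continuous.abs.continuousOn
  obtain ⟨K, hK⟩ := hk.exists_bound_of_continuousOn (he.continuous_fderiv (by simp)).continuousOn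
  have hm0 : 0 < |coneDet L e (x₀, 1)| := abs_pos.2 (hJ0 x₀ hx₀)
  have hM0 : 0 < |coneDet L e (x₁, 1)| := abs_pos.2 (hJ0 x₁ hx₁)
  refine ⟨κ * |coneDet L e (x₀, 1)|, κ * |coneDet L e (x₁, 1)|, |K| + 1, by positivity,
    by positivity, by positivity, fun a ha hak h => ?_⟩
  have hdet : ∀ x, coneDet L (fun x => e (a • x)) (x, 1) =
    a ^ Module.finrank ℝ E * coneDet L e (a • x, 1) := fun x => coneDet_comp_smul L hed a x
  have habs : ∀ x, κ * |coneDet L (fun x => e (a • x)) (x, 1)| =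
      a ^ Module.finrank ℝ E * (κ * |coneDet L e (a • x, 1)|) := fun x => by
    rw [hdet, abs_mul, abs_of_pos (pow_pos ha _)]
    ring
  refine ⟨_, hdens _ _ h, ?_, fun x hx => ?_, by positivity, fun x hx => ?_, fun x hx => ?_,
    fun x hx => ?_⟩
  · exact measurable_const.mul (contDiff_coneDet L h.contDiff).continuous.measurable.abs
  · refine contDiffAt_const.mul (ContDiffAt.abs (contDiff_coneDet L h.contDiff).contDiffAt ?_)
    rw [hdet]
    exact mul_ne_zero (pow_pos ha _).ne' (hJ0 _ (hak x hx))
  · rw [habs]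
    gcongr _ * (_ * ?_)
    exact hmin (hak x hx)
  · rw [habs]
    gcongr _ * (_ * ?_)
    exact hmax (hak x hx)
  · rw [fderiv_comp_smul_eq hed, norm_smul, Real.norm_of_nonneg ha.le]
    gcongr
    linarith [hK _ (hak x hx), le_abs_self K]

theorem exists_rellich_and_poincare_of_scaled (he : ContDiff ℝ ∞ e) (hn : ∀ x, ‖e x‖ = 1)
    (hfin : Module.finrank ℝ (E × ℝ) = Module.finrank ℝ (AmbientSpace d))
    {k : Set E} (hk : IsCompact k) (hkn : k.Nonempty)
    (himm : ∀ x ∈ k, ∀ w, fderiv ℝ e x w = 0 → w = 0)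
    (hΩo : IsOpen Ω) (hΩb : Bornology.IsBounded Ω) (hΩc : IsConnected Ω)
    (hcone : HasInteriorCones Ω) :
    ∃ B : ℝ, 0 < B ∧ ∀ a : ℝ, 0 < a → (∀ x ∈ Ω, a • x ∈ k) →
      ∀ h : IsSphereChart (fun x => e (a • x)) Ω,
        IsSphericalRellichSet (sphereMap h.norm_eq_one '' Ω) ∧
        SatisfiesPoincare (sphereMap h.norm_eq_one '' Ω) (B * a ^ 2) := by
  obtain ⟨m, M, K, hm, hM, hK, H⟩ := exists_isControlledChart (Ω := Ω) he hn hfin hk hkn himm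
  obtain ⟨C, hC0, hC⟩ := hcone.poincare hΩo hΩb hΩc
  -- The transferred constant is `a ^ n * M * (C + 1) * (a * K) ^ 2 / (a ^ n * m)`, in which only `a
  -- ^ 2` survives. Replacing `C` by `C + 1` keeps it positive.
  refine ⟨M * ((C + 1) * (K ^ 2 * m⁻¹)), by positivity, fun a ha hak h => ?_⟩
  obtain ⟨ρ, hc⟩ := H a ha hak h
  have hMa : 0 < a ^ Module.finrank ℝ E * M := by positivity
  refine ⟨hc.isSphericalRellichSet hfin (hcone.isRellichSet hΩo.measurableSet hΩb) hMa, ?_⟩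
  have h1 := hc.satisfiesPoincare (C := C + 1) hfin hΩb.measure_lt_top.ne hΩc.nonempty
    (by linarith) hMa fun w G hw h0 => (hC w G hw h0).trans (by
      gcongr
      linarith)
  convert h1 using 1
  have : a ^ Module.finrank ℝ E ≠ 0 := by positivity
  field_simp

end ScaledChart

/-! ### Interior cones from a nondegenerate defining function -/

section InteriorCone

variable {E : Type*} [NormedAddCommGroup E] [NormedSpace ℝ E] {Ω : Set E}

theorem exists_interior_cone_of_mem {p : E} (hΩ : Ω ∈ 𝓝 p) :
    ∃ (v : E) (c b r : ℝ), 0 < c ∧ 0 < b ∧ 0 < r ∧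
      ∀ x ∈ ball p r ∩ Ω, ∀ s ∈ Set.Ioc 0 b, closedBall (x + s • v) (s * c) ⊆ Ω := by
  obtain ⟨r, hr, hrΩ⟩ := Metric.mem_nhds_iff.1 hΩ
  refine ⟨0, 1, r / 2, r / 2, one_pos, by positivity, by positivity, fun x hx s hs y hy => hrΩ ?_⟩
  rw [smul_zero, add_zero, mul_one, mem_closedBall] at hy
  have h1 : dist x p < r / 2 := hx.1
  rw [mem_ball]
  linarith [dist_triangle y x p, hs.2]

/-- Directions close to `v` decrease `f`. Strict differentiability is needed to compare `f` at two
nearby points `x` and `y`, neither of which is `p`. -/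
theorem exists_interior_cone_of_sublevel {p : E} {f : E → ℝ} {f' : E →L[ℝ] ℝ}
    (hf : HasStrictFDerivAt f f' p) {v : E} (hv : f' v < 0)
    (hΩ : ∀ᶠ x in 𝓝 p, x ∈ Ω ↔ f x < 0) :
    ∃ (v : E) (c b r : ℝ), 0 < c ∧ 0 < b ∧ 0 < r ∧
      ∀ x ∈ ball p r ∩ Ω, ∀ s ∈ Set.Ioc 0 b, closedBall (x + s • v) (s * c) ⊆ Ω := by
  -- The decrease `s * a` along `v` is spent as follows: a quarter on the opening `c` of the cone, a
  -- quarter on the error `η` of the linear approximation, and half remains.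
  set a := -f' v with ha
  have ha0 : 0 < a := by rw [ha]; linarith
  set c := min 1 (a / (4 * (‖f'‖ + 1)))
  have hc0 : 0 < c := by positivity
  have hc1 : c ≤ 1 := min_le_left _ _
  have hcf : ‖f'‖ * c ≤ a / 4 := by
    calc ‖f'‖ * c ≤ (‖f'‖ + 1) * (a / (4 * (‖f'‖ + 1))) := by
          gcongr
          · linarith
          · exact min_le_right _ _
      _ = a / 4 := by field_simp
  set η := a / (4 * (‖v‖ + 1))
  have hη : 0 < η := by positivity
  have hs := (hf.isLittleO.def hη).and (((continuous_fst.tendsto (p, p)).eventually hΩ).and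
    ((continuous_snd.tendsto (p, p)).eventually hΩ))
  obtain ⟨R, hR, hball⟩ := Metric.eventually_nhds_iff_ball.1 hs
  refine ⟨v, c, R / (4 * (‖v‖ + 1)), R / 4, hc0, by positivity, by positivity,
    fun x hx s hs y hy => ?_⟩
  have hsv : s * (‖v‖ + 1) ≤ R / 4 := by
    calc s * (‖v‖ + 1) ≤ R / (4 * (‖v‖ + 1)) * (‖v‖ + 1) := by gcongr; exact hs.2
      _ = R / 4 := by field_simp
  set z := y - (x + s • v) with hz
  have hzn : ‖z‖ ≤ s * c := by rw [hz, ← dist_eq_norm]; exact hy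
  have hyx : y - x = s • v + z := by rw [hz]; abel
  have hnyx : ‖y - x‖ ≤ s * (‖v‖ + 1) := by
    rw [hyx]
    refine (norm_add_le _ _).trans ?_
    rw [norm_smul, Real.norm_of_nonneg hs.1.le]
    nlinarith [hs.1]
  have hxp : dist x p < R / 4 := hx.1
  have hyp : dist y p < R := by
    have : dist y x ≤ R / 4 := by rw [dist_eq_norm]; exact hnyx.trans hsv
    linarith [dist_triangle y x p]
  obtain ⟨h1, h2, h3⟩ := hball (y, x) (by
    rw [mem_ball, Prod.dist_eq, max_lt_iff]
    exact ⟨hyp, by linarith⟩)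
  simp only at h1 h2 h3
  refine h2.2 ?_
  have hfx : f x < 0 := h3.1 hx.2
  have h4 : f' (y - x) ≤ s * (-a + a / 4) := by
    rw [hyx, map_add, map_smul, smul_eq_mul]
    have : f' z ≤ ‖f'‖ * (s * c) :=
      (le_abs_self _).trans ((f'.le_opNorm z).trans (by gcongr))
    nlinarith [hs.1]
  have h5 : η * ‖y - x‖ ≤ s * (a / 4) := by
    calc η * ‖y - x‖ ≤ η * (s * (‖v‖ + 1)) := by gcongr
      _ = s * (a / 4) := by simp only [η]; field_simp
  have h6 := (abs_le.1 h1).2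
  nlinarith [hs.1]

end InteriorCone

/-! ### The domain in normal coordinates -/

section PolarDomain

variable {d : ℕ} {D : Set (UnitSphere d)}

/-- The domain `D` in normal coordinates at the north pole. -/
def polarDomain (D : Set (UnitSphere d)) : Set (Equator d) :=
  {x | ‖x‖ < Real.pi / 2 ∧ sphereMap norm_polarMap x ∈ D}

theorem continuous_sphereMap_polarMap :
    Continuous (sphereMap (norm_polarMap (d := d))) :=
  continuous_sphereMap contDiff_polarMap.continuous norm_polarMap

theorem isOpen_polarDomain (hD : IsOpen D) : IsOpen (polarDomain D) :=
  (isOpen_lt continuous_norm continuous_const).inter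
    (hD.preimage continuous_sphereMap_polarMap)

theorem norm_lt_of_sphereMap_mem {x : Equator d} (hx : ‖x‖ < Real.pi)
    (h : sphereMap norm_polarMap x ∈ upperHemisphere d) : ‖x‖ < Real.pi / 2 := by
  by_contra hle
  rw [not_lt] at hle
  have h1 : 0 < ⟪northPole d, polarMap x⟫ := mem_upperHemisphere_iff.1 h
  rw [inner_northPole_polarMap] at h1
  linarith [Real.cos_nonpos_of_pi_div_two_le_of_le hle (by linarith [Real.pi_pos])]

theorem sphereMap_polarInverse {p : UnitSphere d} (hp : p ∈ upperHemisphere d) :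
    sphereMap norm_polarMap (polarInverse p) = p :=
  Subtype.ext (polarMap_polarInverse hp)

theorem polarDomain_eq_image (hDS : D ⊆ upperHemisphere d) :
    polarDomain D = polarInverse '' D := by
  ext x
  constructor
  · rintro ⟨hx, hxD⟩
    refine ⟨_, hxD, injOn_polarMap ?_ ?_ (polarMap_polarInverse (hDS hxD))⟩
    · rw [mem_ball_zero_iff, norm_polarInverse (hDS hxD)]
      linarith [Real.arccos_lt_pi_div_two.2 (mem_upperHemisphere_iff.1 (hDS hxD)), Real.pi_pos]
    · rw [mem_ball_zero_iff]
      linarith [Real.pi_pos]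
  · rintro ⟨p, hp, rfl⟩
    refine ⟨?_, ?_⟩
    · rw [norm_polarInverse (hDS hp)]
      exact Real.arccos_lt_pi_div_two.2 (mem_upperHemisphere_iff.1 (hDS hp))
    · rwa [sphereMap_polarInverse (hDS hp)]

theorem isConnected_polarDomain (hD : IsConnected D) (hDS : D ⊆ upperHemisphere d) :
    IsConnected (polarDomain D) := by
  rw [polarDomain_eq_image hDS]
  exact hD.image _ (continuousOn_polarInverse.mono hDS)

theorem isBounded_polarDomain : Bornology.IsBounded (polarDomain D) :=
  isBounded_ball.subset fun _ hx => (mem_ball_zero_iff (r := Real.pi / 2)).2 hx.1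

theorem norm_smul_lt {x : Equator d} (hx : x ∈ polarDomain D) {α : ℝ} (h0 : 0 < α) (h1 : α < 1) :
    ‖α • x‖ < Real.pi / 2 := by
  rw [norm_smul, Real.norm_of_nonneg h0.le]
  nlinarith [hx.1, norm_nonneg x]

theorem isSphereChart_polarMap_smul (hD : IsOpen D) {α : ℝ} (h0 : 0 < α) (h1 : α < 1) :
    IsSphereChart (fun x : Equator d => polarMap (α • x)) (polarDomain D) := by
  refine ⟨contDiff_polarMap.comp (contDiff_const_smul α), fun x => norm_polarMap _,
    isOpen_polarDomain hD, fun x hx y hy hxy => ?_, fun x hx w hw => ?_⟩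
  · refine smul_right_injective _ h0.ne' (injOn_polarMap ?_ ?_ hxy)
    · rw [mem_ball_zero_iff]
      linarith [norm_smul_lt hx h0 h1, Real.pi_pos]
    · rw [mem_ball_zero_iff]
      linarith [norm_smul_lt hy h0 h1, Real.pi_pos]
  · rw [fderiv_comp_smul_eq (contDiff_polarMap.differentiable (by simp)), smul_apply,
      smul_eq_zero] at hw
    exact polarMap_immersion (by linarith [norm_smul_lt hx h0 h1, Real.pi_pos]) w
      (hw.resolve_left h0.ne')

theorem dilatedDomain_eq_image (hDS : D ⊆ upperHemisphere d) {α : ℝ} (h0 : 0 < α)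
    (hn : ∀ x : Equator d, ‖polarMap (α • x)‖ = 1) :
    dilatedDomain α D = sphereMap hn '' polarDomain D := by
  ext q
  constructor
  · rintro ⟨p, hp, hpq⟩
    have hx : polarInverse p ∈ polarDomain D := by
      rw [polarDomain_eq_image hDS]
      exact Set.mem_image_of_mem _ hp
    refine ⟨_, hx, Subtype.ext ?_⟩
    rw [← hpq, polarDilation_polarMap (by linarith [hx.1, Real.pi_pos]) h0.le
      (polarMap_polarInverse (hDS hp)).symm]
    rfl
  · rintro ⟨x, hx, rfl⟩
    exact ⟨_, hx.2, polarDilation_polarMap (by linarith [hx.1, Real.pi_pos]) h0.le rfl⟩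

theorem finrank_equator_prod (d : ℕ) :
    Module.finrank ℝ (Equator d × ℝ) = Module.finrank ℝ (AmbientSpace d) := by
  rw [Module.finrank_prod, finrank_equator]
  simp

/-- The cone derivative is injective between spaces of equal dimension, hence onto; a preimage of a
tangential vector has no radial part. -/
theorem exists_fderiv_polarMap_eq {x : Equator d} (hx : ‖x‖ < Real.pi) {v : AmbientSpace d}
    (hv : ⟪polarMap x, v⟫ = 0) : ∃ w, fderiv ℝ (polarMap (d := d)) x w = v := by
  have hd : Differentiable ℝ (polarMap (d := d)) := contDiff_polarMap.differentiable (by simp)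
  have hinj := coneDeriv_injective hd norm_polarMap (z := (x, 1)) one_ne_zero
    (polarMap_immersion hx)
  obtain ⟨⟨w, τ⟩, hw⟩ := (LinearMap.injective_iff_surjective_of_finrank_eq_finrank
    (f := (coneDeriv polarMap (x, 1) : Equator d × ℝ →ₗ[ℝ] AmbientSpace d))
    (finrank_equator_prod d)).1 hinj v
  have hw' : (1 : ℝ) • fderiv ℝ (polarMap (d := d)) x w + τ • polarMap x = v := hw
  have h1 := congrArg (fun y => ⟪polarMap x, y⟫) hw'
  simp only [one_smul, inner_add_right, real_inner_smul_right,
    inner_fderiv_eq_zero hd norm_polarMap, real_inner_self_eq_norm_sq, norm_polarMap, hv] at h1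
  have hτ : τ = 0 := by linarith
  rw [hτ, zero_smul, add_zero, one_smul] at hw'
  exact ⟨w, hw'⟩

/-- Composing a defining function of `D` with `polarMap` gives a defining function in normal
coordinates. A boundary point may lie on the equator, at radius `π / 2`, but `polarMap` is still an
immersion there. -/
theorem IsSmoothDomain.hasInteriorCones (hD : IsSmoothDomain D) (hDS : D ⊆ upperHemisphere d) :
    HasInteriorCones (polarDomain D) := by
  intro x₀ hx₀
  have hnx : ‖x₀‖ ≤ Real.pi / 2 :=
    closure_minimal (t := {x : Equator d | ‖x‖ ≤ Real.pi / 2}) (fun x hx => hx.1.le)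
      (isClosed_le continuous_norm continuous_const) hx₀
  have hpi : ‖x₀‖ < Real.pi := by linarith [Real.pi_pos]
  set p := sphereMap norm_polarMap x₀ with hp
  by_cases hpD : p ∈ D
  · exact exists_interior_cone_of_mem ((isOpen_polarDomain hD.isOpen).mem_nhds
      ⟨norm_lt_of_sphereMap_mem hpi (hDS hpD), hpD⟩)
  · have hcl : p ∈ closure D :=
      map_mem_closure continuous_sphereMap_polarMap hx₀ fun x hx => hx.2
    obtain ⟨g, hg, ⟨v, hv0, hv⟩, hgD⟩ := hD.smooth_boundary p
      ⟨hcl, by rwa [hD.isOpen.interior_eq]⟩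
    obtain ⟨w, hw⟩ := exists_fderiv_polarMap_eq hpi hv0
    have hs : HasStrictFDerivAt (fun x : Equator d => g (polarMap x))
        (fderiv ℝ g (polarMap x₀) ∘L fderiv ℝ polarMap x₀) x₀ :=
      HasStrictFDerivAt.comp x₀ (hg.hasStrictFDerivAt (by simp))
        (contDiff_polarMap.hasStrictFDerivAt (by simp))
    -- The radius bound in `polarDomain` imposes no extra condition here: within radius `π`, a point
    -- mapped into the hemisphere already has radius below `π / 2`.
    have hloc : ∀ᶠ x in 𝓝 x₀, x ∈ polarDomain D ↔ g (polarMap x) < 0 := by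
      filter_upwards [continuous_sphereMap_polarMap.continuousAt.eventually hgD,
        continuous_norm.continuousAt.eventually (gt_mem_nhds hpi)] with x h1 h2
      refine ⟨fun hx => h1.1 hx.2, fun hx => ?_⟩
      exact ⟨norm_lt_of_sphereMap_mem h2 (hDS (h1.2 hx)), h1.2 hx⟩
    rcases lt_or_gt_of_ne hv with hneg | hpos
    · refine exists_interior_cone_of_sublevel hs (v := w) ?_ hloc
      rw [ContinuousLinearMap.comp_apply, hw]
      exact hneg
    · refine exists_interior_cone_of_sublevel hs (v := -w) ?_ hloc
      rw [ContinuousLinearMap.comp_apply, map_neg, map_neg, hw]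
      exact neg_lt_zero.2 hpos

end PolarDomain

/-! ### The limit of the eigenvalues -/

theorem proposition2p1 (d : ℕ) (hd : 2 ≤ d) (D : Set (UnitSphere d))
    (hD : IsSmoothDomain D) (hDS : D ⊆ upperHemisphere d) (j : ℕ) (hj : 1 ≤ j) :
    Tendsto (fun α : ℝ => neumannEigenvalue (dilatedDomain α D) j) (𝓝[>] 0) atTop := by
  have hΩo := isOpen_polarDomain hD.isOpen
  have hΩc := isConnected_polarDomain hD.isConnected hDS
  obtain ⟨B, hB, H⟩ := exists_rellich_and_poincare_of_scaled (Ω := polarDomain D)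
    (k := closedBall 0 (Real.pi / 2)) contDiff_polarMap norm_polarMap (finrank_equator_prod d)
    (isCompact_closedBall _ _) ⟨0, mem_closedBall_self (by positivity)⟩
    (fun x hx => polarMap_immersion (by
      rw [mem_closedBall_zero_iff] at hx
      linarith [Real.pi_pos]))
    hΩo isBounded_polarDomain hΩc (hD.hasInteriorCones hDS)
  have hlim : Tendsto (fun α : ℝ => (B * α ^ 2)⁻¹) (𝓝[>] 0) atTop := by
    refine tendsto_inv_nhdsGT_zero.comp (tendsto_nhdsWithin_iff.2 ⟨?_, ?_⟩)
    · have : Tendsto (fun α : ℝ => B * α ^ 2) (𝓝 0) (𝓝 (B * 0 ^ 2)) :=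
        (by fun_prop : Continuous fun α : ℝ => B * α ^ 2).tendsto 0
      rw [zero_pow two_ne_zero, mul_zero] at this
      exact this.mono_left nhdsWithin_le_nhds
    · filter_upwards [self_mem_nhdsWithin] with α hα
      have : 0 < α := hα
      exact Set.mem_Ioi.2 (by positivity)
  refine tendsto_atTop_mono' _ ?_ hlim
  -- For `α < 1` the rescaled parameters stay in the closed ball of radius `π / 2`, where the
  -- constants were fixed.
  filter_upwards [Ioo_mem_nhdsGT (zero_lt_one' ℝ)] with α hα
  have hchart := isSphereChart_polarMap_smul hD.isOpen hα.1 hα.2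
  obtain ⟨hR, hP⟩ := H α hα.1 (fun x hx => mem_closedBall_zero_iff.2
    (norm_smul_lt hx hα.1 hα.2).le) hchart
  rw [dilatedDomain_eq_image hDS hα.1 hchart.norm_eq_one]
  refine hP.le_neumannEigenvalue (mul_pos hB (pow_pos hα.1 2)) hj
    (hR.exists_le_neumannCount ?_ ?_ (j + 1))
  · exact hchart.isOpen_image (finrank_equator_prod d)
  -- A nonempty open set in a space of positive dimension is infinite, and the chart is injective,
  -- so `D_α` is infinite and carries arbitrarily many independent functions.
  · have : Nontrivial (Equator d) := Module.nontrivial_of_finrank_pos (R := ℝ) (by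
      rw [finrank_equator]
      omega)
    obtain ⟨x, hx⟩ := hΩc.nonempty
    have := Module.punctured_nhds_neBot ℝ (Equator d) x
    exact (infinite_of_mem_nhds x (hΩo.mem_nhds hx)).image hchart.injOn_sphereMap
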